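/- **Setting.** Let $Y$ be a connected translation surface (a surface with an atlas into $\mathbb{R}^2$ whose transition maps are local translations) that is precompact (totally bounded) for the distance of its flat metric, and whose frontier $\partial Y=\overline Y\setminus Y$ ($\overline Y$ the metric completion) is finite and nonempty. Let $X\to Y$ be the universal covering with the lifted translation structure, and assume that $\partial X=\overline X\setminus X$ is discrete. Let ${\bf dev}:X\to\mathbb{R}^2$ be a developing map; it extends to $\overline X$. A *subconic* in $X$ is a subset $U\subset X$ that is convex (any two of its points are joined by a geodesic segment in $U$) and for which ${\bf dev}(U)$ is a proper subset of $\mathbb{R}^2$ of the form $U_q=\{(x_1,x_2): q(x_1,x_2,1)<0\}$, $q$ a quadratic form on $\mathbb{R}^3$. The space of subconics carries the coarsest topology for which $U\mapsto{\bf dev}(U)$ is continuous (planar subconics being topologized by quadratic forms) and all sets $\{U: x\in U\}$, $x\in X$, are open. Let $\partial U$ be the boundary of $U$ in $\overline X$. $U$ is *rigid* if $\partial U\cap\partial X$ has at least $5$ points and its developed image is not contained in a line. A *strip* is a subconic that develops onto the open region between two distinct parallel lines; it is *maximal* if it is not properly contained in another strip. For $Z\subset\partial X$ let $\mathcal S_Z$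 be the set of subconics $U$ with $\partial U\cap\partial X=Z$ and such that $Z$ meets each component of $\partial U$. The nonempty $\mathcal S_Z$ with ${\rm Card}(Z)=4$ (resp. $3$) are the *1-cells* (resp. *2-cells*). We write $\partial C=\overline C\setminus C$ for a cell $C$. The *link* ${\rm Lk}(U)$ of a rigid subconic $U$ is the graph whose vertices are the 1-cells $C$ with $U\in\overline C$; distinct vertices $C,C'$ are joined by an edge iff $U\in\partial C\cap\partial C'$ and there is a 2-cell $D$ with $C\cup C'\subset\partial D$. We denote the vertex $\mathcal S_Z$ by $Z$. For $x,y\in\partial U\cap\partial X$, $y$ is the *successor* of $x$, $y=s_U(x)$, if $x,y$ are adjacent (some component of $\partial U\setminus\{x,y\}$ does not meet $\partial X$) and some path in the closure of a component of $\partial U\setminus\partial X$ goes from $x$ to $y$ in the positive direction of $\partial U$ (with $U$ on its left). Write $x+k=s_U^k(x)$ and $Z(x,y)=\{x,x+1,y,y+1\}$. A set $Z\subset\partial U\cap\partial X$ is *consecutive* if $Z=\{x,x+1,\dots,x+k\}$ for some $x$ and $k\ge1$. ${\rm Grid}^2$ is the graph with vertex set $\mathbb{Z}^2$ in which two points are joined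 iff they differ in exactly one coordinate, and there by $\pm1$. **Proposition.** (1) Let $U\subset X$ be a rigid subconic. Then $s_U$ is a well-defined permutation of $\partial U\cap\partial X$, each vertex of ${\rm Lk}(U)$ has degree $4$, and each vertex is of the form $Z(x,y)$ with $x,y\in\partial U\cap\partial X$. Let $Z(x,y)$ be a vertex. If $Z(x,y)$ is consecutive, then $y=x+2$ or $x=y+2$, and if $y=x+2$ its neighbours are exactly $Z(x-1,x+2)$, $Z(x-1,x+1)$, $Z(x,x+3)$, $Z(x+1,x+3)$. If $Z(x,y)$ is not consecutive, its neighbours are exactly $Z(x,y-1)$, $Z(x,y+1)$, $Z(x+1,y)$, $Z(x-1,y)$. (2) Let $U\subset X$ be a maximal strip. Then $U$ is rigid and ${\rm Lk}(U)$ is isomorphic to ${\rm Grid}^2$. In particular, if $x,y\in\partial U\cap\partial X$ belong to distinct components of $\partial U$, then $f(m,n)=Z(x+m,y+n)$ defines an isomorphism $f:{\rm Grid}^2\to{\rm Lk}(U)$. -/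

import Mathlib

open Set Topology Filter
open scoped Manifold ENNReal

noncomputable section

namespace TranslationConics

/-! ## Translation surfaces -/

/-- The Euclidean plane. -/
abbrev Plane : Type := EuclideanSpace ℝ (Fin 2)

/-- The property of being, near every point of `s`, the restriction of a translation. -/
def IsLocalTranslationOn (f : Plane → Plane) (s : Set Plane) : Prop :=
  ∀ x ∈ s, ∃ c : Plane, ∀ᶠ y in 𝓝 x, y ∈ s → f y = y + c

/-- The pseudogroup of local translations of the plane. -/
def translationPregroupoid : Pregroupoid Plane where
  property := IsLocalTranslationOn
  comp := by
    intro f g u v hf hg hu hv huv x hx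
    obtain ⟨c, hc⟩ := hf x hx.1
    obtain ⟨d, hd⟩ := hg (f x) hx.2
    refine ⟨c + d, ?_⟩
    have hfx : f x = x + c := hc.self_of_nhds hx.1
    have hcont : Tendsto (fun y : Plane => y + c) (𝓝 x) (𝓝 (f x)) := by
      rw [hfx]
      exact (continuous_id.add continuous_const).tendsto x
    filter_upwards [hc, hcont.eventually hd] with y hy1 hy2 hy
    have h1 : f y = y + c := hy1 hy.1
    have h2 := hy2 (h1 ▸ hy.2)
    simp only [Function.comp_apply]
    rw [h1, h2, add_assoc]
  id_mem := fun x _ => ⟨0, by simp⟩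
  locality := by
    intro f u hu h x hx
    obtain ⟨v, hv, hxv, hf⟩ := h x hx
    obtain ⟨c, hc⟩ := hf x ⟨hx, hxv⟩
    refine ⟨c, ?_⟩
    filter_upwards [hc, hv.mem_nhds hxv] with y hy hyv hyu
    exact hy ⟨hyu, hyv⟩
  congr := by
    intro f g u hu hgf hf x hx
    obtain ⟨c, hc⟩ := hf x hx
    refine ⟨c, ?_⟩
    filter_upwards [hc] with y hy hyu
    rw [hgf y hyu, hy hyu]

/-- The structure groupoid of local translations of the plane. -/
def translationGroupoid : StructureGroupoid Plane := translationPregroupoid.groupoid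

/-- The distance of the flat Riemannian metric `dx² + dy²`, pulled back by the charts: the infimum
of the lengths of `C¹` paths. The tangent space at `x` is identified with the plane by a chart at
`x`; as the transition maps are translations, the resulting norm does not depend on the chart. -/
def flatEDist (M : Type*) [TopologicalSpace M] [ChartedSpace Plane M] (x y : M) : ℝ≥0∞ :=
  letI : ∀ z : M, ENorm (TangentSpace 𝓘(ℝ, Plane) z) := fun _ => inferInstanceAs (ENorm Plane)
  Manifold.riemannianEDist 𝓘(ℝ, Plane) x y

/-- `M`, with its charts, is a translation surface, and its metric is the distance
associated to the translation structure. -/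
class TranslationSurface (M : Type*) [MetricSpace M] [ChartedSpace Plane M] : Prop
    extends HasGroupoid M translationGroupoid where
  edist_eq : ∀ x y : M, edist x y = flatEDist M x y

/-- The frontier of `M`: the points of the metric completion that do not belong to `M`. -/
def metricFrontier (M : Type*) [MetricSpace M] : Set (UniformSpace.Completion M) :=
  (range ((↑) : M → UniformSpace.Completion M))ᶜ

/-- A map between translation surfaces which is locally a translation in the charts. -/
def IsTranslationMap {M N : Type*} [TopologicalSpace M] [ChartedSpace Plane M]
    [TopologicalSpace N] [ChartedSpace Plane N] (f : M → N) : Prop :=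
  ∀ x : M, ∃ c : Plane, ∀ᶠ y in 𝓝 x, chartAt Plane (f x) (f y) = chartAt Plane x y + c

/-- Developing maps: maps to the plane that are charts of the translation structure near
each point. On a simply connected surface such a map exists and is unique up to a translation. -/
def IsDevelopingMap {M : Type*} [TopologicalSpace M] [ChartedSpace Plane M]
    (dev : M → Plane) : Prop :=
  ∀ x : M, ∃ c : Plane, ∀ᶠ y in 𝓝 x, dev y = chartAt Plane x y + c

/-! ## Subconics of the plane -/

/-- The planar subconic `{x | q (x₁, x₂, 1) < 0}` of a quadratic form on `ℝ³`. -/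
def planarSubconic (q : QuadraticForm ℝ (Fin 3 → ℝ)) : Set Plane :=
  {x | q ![x 0, x 1, 1] < 0}

/-- The quadratic forms whose subconic is nontrivial, that is a proper subset of the plane. -/
def NontrivialForm : Type := {q : QuadraticForm ℝ (Fin 3 → ℝ) // planarSubconic q ≠ univ}

/-- The usual topology (of the finite-dimensional space of forms): pointwise convergence. -/
instance : TopologicalSpace NontrivialForm :=
  TopologicalSpace.induced (fun (q : NontrivialForm) (v : Fin 3 → ℝ) => q.1 v) inferInstance

/-- The set of nontrivial planar subconics. -/
def PlanarSubconic : Type := {V : Set Plane // ∃ q, V = planarSubconic q ∧ V ≠ univ}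

/-- The map `q ↦ U_q`. -/
def NontrivialForm.toSubconic (q : NontrivialForm) : PlanarSubconic :=
  ⟨planarSubconic q.1, q.1, rfl, q.2⟩

/-- A set of planar subconics is open iff the set of corresponding forms is open. -/
instance : TopologicalSpace PlanarSubconic :=
  TopologicalSpace.coinduced NontrivialForm.toSubconic inferInstance

/-- A planar strip: the open region between two distinct parallel lines. -/
def IsPlanarStrip (V : Set Plane) : Prop :=
  ∃ (u : Plane) (a b : ℝ), u ≠ 0 ∧ a < b ∧ V = {x | a < inner ℝ u x ∧ inner ℝ u x < b}

/-- A subset of the plane has maximal span if the span of its differences has dimension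
at least `2` or at least its cardinality minus one. -/
def HasMaximalSpan (A : Set Plane) : Prop :=
  2 ≤ Module.finrank ℝ (vectorSpan ℝ A) ∨ A.encard ≤ Module.finrank ℝ (vectorSpan ℝ A) + 1

/-! ## Subconics of a simply connected translation surface

In this part `X` is a simply connected translation surface and `dev` is a developing map. -/

section Subconics

variable {X : Type*} [MetricSpace X]

/-- Convexity: any two points of `A` are joined by a geodesic segment in `A`; geodesic segments
are the paths that are developed to straight segments. -/
def IsFlatConvex (dev : X → Plane) (A : Set X) : Prop :=
  ∀ x ∈ A, ∀ y ∈ A, ∃ γ : Path x y,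
    ∀ t : unitInterval, γ t ∈ A ∧ dev (γ t) = AffineMap.lineMap (dev x) (dev y) (t : ℝ)

/-- The set of subconics in `X`: the convex subsets that are developed onto
a nontrivial planar subconic. -/
def Subconic (dev : X → Plane) : Type _ :=
  {U : Set X // IsFlatConvex dev U ∧ ∃ q, dev '' U = planarSubconic q ∧ dev '' U ≠ univ}

/-- The planar subconic `dev U`. -/
def Subconic.develop {dev : X → Plane} (U : Subconic dev) : PlanarSubconic :=
  ⟨dev '' U.1, U.2.2⟩

/-- The topology on the set of subconics that is induced from the planar subconics by the
developing map, locally: it is the coarsest topology for which `U ↦ dev U` is continuous and for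
which the sets `{U | x ∈ U}`, on each of which `U ↦ dev U` is injective, are open. -/
instance (dev : X → Plane) : TopologicalSpace (Subconic dev) :=
  TopologicalSpace.induced Subconic.develop inferInstance ⊓
    TopologicalSpace.generateFrom {O | ∃ x : X, O = {U : Subconic dev | x ∈ U.1}}

/-- The extension of the developing map to the completion. -/
def devExt (dev : X → Plane) : UniformSpace.Completion X → Plane :=
  UniformSpace.Completion.extension dev

/-- The boundary `∂U`, in the completion of `X`. -/
def Subconic.boundary {dev : X → Plane} (U : Subconic dev) : Set (UniformSpace.Completion X) :=
  frontier (((↑) : X → UniformSpace.Completion X) '' U.1)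

/-- The set `∂U ∩ ∂X` of the frontier points that `U` meets. -/
def Subconic.conePoints {dev : X → Plane} (U : Subconic dev) :
    Set (UniformSpace.Completion X) :=
  U.boundary ∩ metricFrontier X

/-- The stratum `S_n(X)`. -/
def stratum (dev : X → Plane) (n : ℕ) : Set (Subconic dev) :=
  {U | (n : ℕ∞) ≤ U.conePoints.encard ∧ HasMaximalSpan (devExt dev '' U.conePoints)}

/-- Rigid subconics: the elements of `S_5(X)`. -/
def Subconic.IsRigid {dev : X → Plane} (U : Subconic dev) : Prop := U ∈ stratum dev 5

/-- Strips in `X`. -/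
def Subconic.IsStrip {dev : X → Plane} (U : Subconic dev) : Prop := IsPlanarStrip (dev '' U.1)

/-- Maximal strips: strips that are not properly contained in a strip. -/
def Subconic.IsMaximalStrip {dev : X → Plane} (U : Subconic dev) : Prop :=
  U.IsStrip ∧ ∀ W : Subconic dev, W.IsStrip → U.1 ⊆ W.1 → W = U

/-! ### The cells and the links -/

/-- The cell `S_Z`: the subconics `U` with `∂U ∩ ∂X = Z` such that `Z` meets each
component of `∂U`. -/
def cell (dev : X → Plane) (Z : Set (UniformSpace.Completion X)) : Set (Subconic dev) :=
  {U | U.conePoints = Z ∧ ∀ y ∈ U.boundary, (connectedComponentIn U.boundary y ∩ Z).Nonempty}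

/-- The `1`-cells (`k = 4`) and the `2`-cells (`k = 3`) of the complex `S_3(X)`: the nonempty `S_Z`
for which `Z` has `k` elements. -/
def IsCellOfCard (dev : X → Plane) (k : ℕ) (C : Set (Subconic dev)) : Prop :=
  C.Nonempty ∧ ∃ Z : Set (UniformSpace.Completion X), Z.encard = k ∧ C = cell dev Z

/-- The `1`-cells. -/
abbrev IsOneCell (dev : X → Plane) (C : Set (Subconic dev)) : Prop := IsCellOfCard dev 4 C

/-- The `2`-cells. -/
abbrev IsTwoCell (dev : X → Plane) (D : Set (Subconic dev)) : Prop := IsCellOfCard dev 3 D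

/-- The boundary of an (open) cell. -/
def cellBoundary {dev : X → Plane} (C : Set (Subconic dev)) : Set (Subconic dev) :=
  closure C \ C

/-- The vertices of the link of `U`: the `1`-cells whose closure contains `U`. -/
def LinkVertex {dev : X → Plane} (U : Subconic dev) : Type _ :=
  {C : Set (Subconic dev) // IsOneCell dev C ∧ U ∈ closure C}

/-- The link of `U`: two distinct `1`-cells `C`, `C'` are joined by an edge iff `U` lies in the
boundary of both and there is a `2`-cell whose boundary contains `C ∪ C'`. -/
def link {dev : X → Plane} (U : Subconic dev) : SimpleGraph (LinkVertex U) where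
  Adj C C' := C ≠ C' ∧ ∃ D, IsTwoCell dev D ∧
    U ∈ cellBoundary C.1 ∩ cellBoundary C'.1 ∧ C.1 ∪ C'.1 ⊆ cellBoundary D
  symm := ⟨by
    rintro C C' ⟨hne, D, hD, hU, hCD⟩
    exact ⟨hne.symm, D, hD, ⟨hU.2, hU.1⟩, by rwa [union_comm]⟩⟩
  loopless := ⟨fun C h => h.1 rfl⟩

/-! ### Adjacency and the successor function -/

/-- `x` and `y` are adjacent in `∂U ∩ ∂X`: some component of `∂U \ {x, y}` does not meet `∂X`. -/
def Subconic.Adjacent {dev : X → Plane} (U : Subconic dev)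
    (x y : UniformSpace.Completion X) : Prop :=
  ∃ c ∈ U.boundary \ {x, y},
    Disjoint (connectedComponentIn (U.boundary \ {x, y}) c) (metricFrontier X)

/-- A path `α` on `[-1, 1]` in `∂U` is oriented if it runs along `∂U` in the positive direction of
the boundary orientation: `U` lies on the left of the velocity vector of the developed path. -/
def Subconic.IsOrientedPath {dev : X → Plane} (U : Subconic dev)
    (α : ℝ → UniformSpace.Completion X) : Prop :=
  ContinuousOn α (Icc (-1) 1) ∧ (∀ t ∈ Icc (-1 : ℝ) 1, α t ∈ U.boundary) ∧
    ∀ t ∈ Icc (-1 : ℝ) 1, ∃ v : Plane,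
      HasDerivWithinAt (fun s => devExt dev (α s)) v (Icc (-1) 1) t ∧
      ∀ p ∈ U.1, 0 < v 0 * (dev p - devExt dev (α t)) 1 - v 1 * (dev p - devExt dev (α t)) 0

/-- `y` is the successor of `x` in `∂U ∩ ∂X`: the two points are adjacent, and an oriented path
in the closure of a component of `∂U \ ∂X` leads from `x` to `y`. -/
def Subconic.IsSuccessor {dev : X → Plane} (U : Subconic dev)
    (x y : UniformSpace.Completion X) : Prop :=
  U.Adjacent x y ∧ ∃ c ∈ U.boundary \ metricFrontier X,
    ∃ α : ℝ → UniformSpace.Completion X, U.IsOrientedPath α ∧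
      (∀ t ∈ Icc (-1 : ℝ) 1,
        α t ∈ closure (connectedComponentIn (U.boundary \ metricFrontier X) c)) ∧
      α (-1) = x ∧ α 1 = y

/-- The permutation `s` of `∂U ∩ ∂X` is the successor function `s_U`. -/
def Subconic.IsSuccessorFunction {dev : X → Plane} (U : Subconic dev)
    (s : Equiv.Perm U.conePoints) : Prop :=
  ∀ x y : U.conePoints, s x = y ↔ U.IsSuccessor x y

/-- The set `Z_U(x, y) = {x, s x, y, s y}`. -/
def quad {U : Set (UniformSpace.Completion X)} (s : Equiv.Perm U) (x y : U) :
    Set (UniformSpace.Completion X) :=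
  {(x : UniformSpace.Completion X), (s x : UniformSpace.Completion X),
    (y : UniformSpace.Completion X), (s y : UniformSpace.Completion X)}

/-- `Z` is consecutive: `Z = {x, s x, …, s^k x}` for some `x` and some `k ≥ 1`. -/
def IsConsecutive {U : Set (UniformSpace.Completion X)} (s : Equiv.Perm U)
    (Z : Set (UniformSpace.Completion X)) : Prop :=
  ∃ (x : U) (k : ℕ), 1 ≤ k ∧ Z = {z | ∃ i ≤ k, z = ((s ^ i) x : U)}

/-- The cells that are the neighbours of `v` in the link of `U`. -/
def neighbourCells {dev : X → Plane} (U : Subconic dev) (v : LinkVertex U) :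
    Set (Set (Subconic dev)) :=
  Subtype.val '' (link U).neighborSet v

end Subconics

/-- The `n`-dimensional infinite grid: two points of `ℤⁿ` are joined iff they differ in exactly one
coordinate, and there by `1`. -/
def grid (n : ℕ) : SimpleGraph (Fin n → ℤ) where
  Adj a b := ∃ i, |a i - b i| = 1 ∧ ∀ j, j ≠ i → a j = b j
  symm := ⟨by
    rintro a b ⟨i, hi, h⟩
    exact ⟨i, by rwa [abs_sub_comm], fun j hj => (h j hj).symm⟩⟩
  loopless := ⟨by
    rintro a ⟨i, hi, -⟩
    simp at hi⟩

end TranslationConics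

end

open TranslationConics

noncomputable section
namespace TranslationConics

section Length

variable {M N : Type*} [TopologicalSpace M] [ChartedSpace Plane M]
  [TopologicalSpace N] [ChartedSpace Plane N]

/-- The length of a path, measured in the charts. -/
def flatLength (γ : ℝ → M) : ℝ≥0∞ :=
  ∫⁻ t in Icc (0 : ℝ) 1, ‖fderiv ℝ (chartAt Plane (γ t) ∘ γ) t 1‖ₑ

/-- A `C¹` path on `[0, 1]`, in charts. -/
def IsC1Path (γ : ℝ → M) : Prop :=
  ∀ t ∈ Icc (0 : ℝ) 1, ContinuousWithinAt γ (Icc 0 1) t ∧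
    ContDiffWithinAt ℝ 1 (chartAt Plane (γ t) ∘ γ) (Icc 0 1) t

theorem isC1Path_iff {γ : ℝ → M} :
    IsC1Path γ ↔ ContMDiffOn 𝓘(ℝ, ℝ) 𝓘(ℝ, Plane) 1 γ (Icc 0 1) := by
  refine forall₂_congr fun t _ => ?_
  rw [contMDiffWithinAt_iff_target, contMDiffWithinAt_iff_contDiffWithinAt]
  simp [extChartAt]

theorem IsC1Path.continuousOn {γ : ℝ → M} (h : IsC1Path γ) : ContinuousOn γ (Icc 0 1) :=
  fun t ht => (h t ht).1

/-- The speed of a path, as the norm of its manifold derivative. -/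
def flatSpeed (γ : ℝ → M) (t : ℝ) : ℝ≥0∞ :=
  @enorm Plane _ (mfderiv 𝓘(ℝ, ℝ) 𝓘(ℝ, Plane) γ t (1 : ℝ))

theorem IsC1Path.lintegral_flatSpeed {γ : ℝ → M} (h : IsC1Path γ) :
    ∫⁻ t in Icc (0 : ℝ) 1, flatSpeed γ t = flatLength γ := by
  rw [flatLength, ← MeasureTheory.restrict_Ioo_eq_restrict_Icc]
  refine MeasureTheory.setLIntegral_congr_fun measurableSet_Ioo fun t ht => ?_
  have hm : MDifferentiableAt 𝓘(ℝ, ℝ) 𝓘(ℝ, Plane) γ t :=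
    ((isC1Path_iff.1 h).contMDiffAt (Icc_mem_nhds ht.1 ht.2)).mdifferentiableAt one_ne_zero
  have : mfderiv 𝓘(ℝ, ℝ) 𝓘(ℝ, Plane) γ t = fderiv ℝ (chartAt Plane (γ t) ∘ γ) t := by
    refine (if_pos hm).trans ?_
    simp only [writtenInExtChartAt, extChartAt, chartAt_self_eq]
    simp
    rfl
  simp only [flatSpeed, this]
  rfl

theorem flatEDist_le {γ : ℝ → M} (h : IsC1Path γ) : flatEDist M (γ 0) (γ 1) ≤ flatLength γ := by
  let _ : ∀ z : M, ENorm (TangentSpace 𝓘(ℝ, Plane) z) := fun _ => inferInstanceAs (ENorm Plane)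
  have _ : ∀ z : M, ENormSMulClass ℝ (TangentSpace 𝓘(ℝ, Plane) z) :=
    fun _ => inferInstanceAs (ENormSMulClass ℝ Plane)
  have := Manifold.riemannianEDist_le_pathELength (I := 𝓘(ℝ, Plane)) (isC1Path_iff.1 h)
    (x := γ 0) (y := γ 1) rfl rfl zero_le_one
  rw [Manifold.pathELength] at this
  exact this.trans_eq h.lintegral_flatSpeed

theorem exists_path_of_flatEDist_lt {x y : M} {r : ℝ≥0∞} (h : flatEDist M x y < r) :
    ∃ γ : ℝ → M, γ 0 = x ∧ γ 1 = y ∧ IsC1Path γ ∧ flatLength γ < r := by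
  let _ : ∀ z : M, ENorm (TangentSpace 𝓘(ℝ, Plane) z) := fun _ => inferInstanceAs (ENorm Plane)
  obtain ⟨γ, h0, h1, hγ, hl⟩ := Manifold.exists_lt_of_riemannianEDist_lt (I := 𝓘(ℝ, Plane)) h
  have hc := isC1Path_iff.2 hγ
  rw [Manifold.pathELength] at hl
  exact ⟨γ, h0, h1, hc, hc.lintegral_flatSpeed.symm.trans_lt hl⟩

variable {f : M → N}

theorem IsTranslationMap.eventuallyEq (hf : IsTranslationMap f) {γ : ℝ → M} {s : Set ℝ} {t : ℝ}
    (hγ : ContinuousWithinAt γ s t) :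
    ∃ c : Plane, (chartAt Plane (f (γ t)) ∘ (f ∘ γ)) =ᶠ[𝓝[s] t]
      fun u => (chartAt Plane (γ t) ∘ γ) u + c := by
  obtain ⟨c, hc⟩ := hf (γ t)
  exact ⟨c, hγ.eventually hc⟩

theorem IsTranslationMap.isC1Path_comp_iff (hf : IsTranslationMap f) (hfc : Continuous f)
    {γ : ℝ → M} (hγ : ContinuousOn γ (Icc 0 1)) : IsC1Path (f ∘ γ) ↔ IsC1Path γ := by
  refine forall₂_congr fun t ht => ?_
  obtain ⟨c, hc⟩ := hf.eventuallyEq (hγ t ht)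
  have h1 : ContinuousWithinAt (f ∘ γ) (Icc 0 1) t := hfc.continuousAt.comp_continuousWithinAt (hγ t ht)
  simp only [hγ t ht, h1, true_and]
  refine ⟨fun h => ?_, fun h => ?_⟩
  · have := (h.congr_of_eventuallyEq_of_mem hc.symm ht).sub (contDiffWithinAt_const (c := c))
    simpa [Function.comp_def] using this
  · exact (h.add (contDiffWithinAt_const (c := c))).congr_of_eventuallyEq_of_mem hc ht

theorem IsTranslationMap.flatLength_comp (hf : IsTranslationMap f)
    {γ : ℝ → M} (hγ : ContinuousOn γ (Icc 0 1)) : flatLength (f ∘ γ) = flatLength γ := by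
  rw [flatLength, flatLength, ← MeasureTheory.restrict_Ioo_eq_restrict_Icc]
  refine MeasureTheory.setLIntegral_congr_fun measurableSet_Ioo fun t ht => ?_
  have hct : ContinuousAt γ t := hγ.continuousAt (Icc_mem_nhds ht.1 ht.2)
  obtain ⟨c, hc⟩ := hf.eventuallyEq (s := univ) hct.continuousWithinAt
  rw [nhdsWithin_univ] at hc
  have : fderiv ℝ (chartAt Plane ((f ∘ γ) t) ∘ (f ∘ γ)) t = fderiv ℝ (chartAt Plane (γ t) ∘ γ) t :=
    hc.fderiv_eq.trans (by rw [fderiv_add_const])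
  simp only [this]

end Length

section Developing

variable {M : Type*} [TopologicalSpace M] [ChartedSpace Plane M] {dev : M → Plane}

theorem IsDevelopingMap.isTranslationMap (h : IsDevelopingMap dev) : IsTranslationMap dev := by
  intro x
  obtain ⟨c, hc⟩ := h x
  refine ⟨c, ?_⟩
  simp only [chartAt_self_eq]
  exact hc

theorem IsDevelopingMap.continuous (h : IsDevelopingMap dev) : Continuous dev := by
  refine continuous_iff_continuousAt.2 fun x => ?_
  obtain ⟨c, hc⟩ := h x
  exact (((chartAt Plane x).continuousAt (mem_chart_source _ x)).add continuousAt_const).congr (EventuallyEq.symm hc)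

theorem IsDevelopingMap.isLocalHomeomorph (h : IsDevelopingMap dev) : IsLocalHomeomorph dev := by
  refine IsLocalHomeomorph.mk _ fun x => ?_
  obtain ⟨c, hc⟩ := h x
  obtain ⟨W, hW, hWo, hxW⟩ := eventually_nhds_iff.1 hc
  refine ⟨((chartAt Plane x).restrOpen W hWo).trans (Homeomorph.addRight c).toOpenPartialHomeomorph,
    ?_, ?_⟩
  · simp [hxW]
  · intro y hy
    simp at hy
    simp [hW y hy.2]

theorem isC1Path_plane_iff {γ : ℝ → Plane} : IsC1Path γ ↔ ContDiffOn ℝ 1 γ (Icc 0 1) := by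
  rw [isC1Path_iff, contMDiffOn_iff_contDiffOn]

theorem edist_le_flatLength {γ : ℝ → Plane} (h : IsC1Path γ) :
    edist (γ 0) (γ 1) ≤ flatLength γ := by
  rw [edist_comm, edist_eq_enorm_sub]
  refine (enorm_sub_le_lintegral_deriv_of_contDiffOn_Icc (isC1Path_plane_iff.1 h)
    zero_le_one).trans_eq ?_
  simp only [flatLength, chartAt_self_eq, fderiv_apply_one_eq_deriv]
  rfl

end Developing

section Metric

variable {M N : Type*} [MetricSpace M] [ChartedSpace Plane M] [TranslationSurface M]
  [MetricSpace N] [ChartedSpace Plane N] [TranslationSurface N] {dev : M → Plane}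

/-- Developing maps are `1`-Lipschitz. -/
theorem IsDevelopingMap.lipschitzWith (h : IsDevelopingMap dev) : LipschitzWith 1 dev := by
  intro x y
  rw [ENNReal.coe_one, one_mul, TranslationSurface.edist_eq x y]
  refine le_of_forall_gt fun r hr => ?_
  obtain ⟨γ, rfl, rfl, hγ, hl⟩ := exists_path_of_flatEDist_lt hr
  have := edist_le_flatLength ((h.isTranslationMap.isC1Path_comp_iff h.continuous hγ.continuousOn).2 hγ)
  rw [h.isTranslationMap.flatLength_comp hγ.continuousOn] at this
  exact this.trans_lt hl

/-- Points joined by a geodesic segment are at most as far apart as their developments. -/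
theorem IsDevelopingMap.dist_le_of_segment (h : IsDevelopingMap dev) {γ : ℝ → M}
    (hc : ContinuousOn γ (Icc 0 1)) {a b : Plane}
    (hγ : ∀ t ∈ Icc (0 : ℝ) 1, dev (γ t) = AffineMap.lineMap a b t) :
    dist (γ 0) (γ 1) ≤ dist a b := by
  have hcd : ContDiff ℝ 1 (fun t : ℝ => (AffineMap.lineMap a b t : Plane)) := by
    simp only [AffineMap.lineMap_apply_module']
    fun_prop
  have hC : IsC1Path (dev ∘ γ) :=
    isC1Path_plane_iff.2 (hcd.contDiffOn.congr fun t ht => hγ t ht)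
  have h1 := flatEDist_le ((h.isTranslationMap.isC1Path_comp_iff h.continuous hc).1 hC)
  rw [← TranslationSurface.edist_eq, ← h.isTranslationMap.flatLength_comp hc] at h1
  have h2 : flatLength (dev ∘ γ) = edist a b := by
    rw [flatLength, ← MeasureTheory.restrict_Ioo_eq_restrict_Icc,
      MeasureTheory.setLIntegral_congr_fun (g := fun _ => edist a b) measurableSet_Ioo]
    · simp
    · intro t ht
      have he : (dev ∘ γ) =ᶠ[𝓝 t] fun t : ℝ => (AffineMap.lineMap a b t : Plane) := by
        filter_upwards [Icc_mem_nhds ht.1 ht.2] with u hu using hγ u hu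
      have hd : HasDerivAt (fun t : ℝ => (AffineMap.lineMap a b t : Plane)) (b - a) t := by
        simpa using (AffineMap.hasDerivAt_lineMap (a := a) (b := b) (x := t) (𝕜 := ℝ))
      have : fderiv ℝ (chartAt Plane ((dev ∘ γ) t) ∘ (dev ∘ γ)) t 1 = b - a := by
        simp only [chartAt_self_eq]
        change fderiv ℝ (dev ∘ γ) t 1 = b - a
        rw [he.fderiv_eq, fderiv_apply_one_eq_deriv, hd.deriv]
      simp only [this, edist_comm a b, edist_eq_enorm_sub]
  rw [h2, edist_dist, edist_dist] at h1
  exact (ENNReal.ofReal_le_ofReal_iff dist_nonneg).1 h1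

/-- Coverings by translation maps are surjective on balls. -/
theorem exists_lift_of_dist_lt {p : M → N} (hp : IsCoveringMap p) (hpt : IsTranslationMap p)
    {x : M} {y : N} {r : ℝ} (h : dist (p x) y < r) : ∃ x', dist x x' < r ∧ p x' = y := by
  have hr : 0 < r := dist_nonneg.trans_lt h
  have h' : flatEDist N (p x) y < ENNReal.ofReal r := by
    rw [← TranslationSurface.edist_eq, edist_dist]
    exact (ENNReal.ofReal_lt_ofReal_iff hr).2 h
  obtain ⟨γ, h0, h1, hγ, hl⟩ := exists_path_of_flatEDist_lt h'
  let γ' : C(unitInterval, N) := ⟨fun t => γ t, hγ.continuousOn.domRestrict⟩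
  obtain ⟨Γ, hΓ, hΓ0⟩ := hp.exists_path_lifts γ' x ((congrArg γ (by simp)).trans h0)
  let G : ℝ → M := fun t => Γ (projIcc 0 1 zero_le_one t)
  have hGc : ContinuousOn G (Icc 0 1) := (Γ.continuous.comp continuous_projIcc).continuousOn
  have hpG : ∀ t ∈ Icc (0 : ℝ) 1, (p ∘ G) t = γ t := by
    intro t ht
    have := congrFun hΓ (projIcc 0 1 zero_le_one t)
    simp only [Function.comp_apply] at this
    exact this.trans (congrArg γ (by simp [projIcc_of_mem zero_le_one ht]))
  have hC : IsC1Path (p ∘ G) :=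
    isC1Path_iff.2 ((isC1Path_iff.1 hγ).congr hpG)
  have hC' := (hpt.isC1Path_comp_iff hp.continuous hGc).1 hC
  have hlen : flatLength (p ∘ G) = flatLength γ := by
    rw [← hC.lintegral_flatSpeed, ← hγ.lintegral_flatSpeed, ← MeasureTheory.restrict_Ioo_eq_restrict_Icc]
    refine MeasureTheory.setLIntegral_congr_fun measurableSet_Ioo fun t ht => ?_
    have he : (p ∘ G) =ᶠ[𝓝 t] γ := by
      filter_upwards [Icc_mem_nhds ht.1 ht.2] with u hu using hpG u hu
    simp only [flatSpeed]
    rw [he.mfderiv_eq]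
    rfl
  refine ⟨G 1, ?_, ?_⟩
  · have := flatEDist_le hC'
    rw [← TranslationSurface.edist_eq, ← hpt.flatLength_comp hGc, hlen] at this
    have h2 := this.trans_lt hl
    have hG0 : G 0 = x := by simp [G, hΓ0]
    rw [hG0, edist_dist, ENNReal.ofReal_lt_ofReal_iff hr] at h2
    exact h2
  · rw [← h1]; exact hpG 1 (by simp)

end Metric

end TranslationConics
end

noncomputable section
namespace TranslationConics

section Star

variable {X : Type*} [TopologicalSpace X] {dev : X → Plane}

/-- The endpoints of the segments starting at `dev x` that lift to geodesics starting at `x`. -/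
def starDomain (dev : X → Plane) (x : X) : Set Plane :=
  {w | ∃ γ : ℝ → X, ContinuousOn γ (Icc 0 1) ∧ γ 0 = x ∧
    ∀ t ∈ Icc (0 : ℝ) 1, dev (γ t) = AffineMap.lineMap (dev x) w t}

open Classical in
/-- The endpoint of the geodesic starting at `x` that develops to the segment from `dev x` to `w`. -/
def sect (dev : X → Plane) (x : X) (w : Plane) : X :=
  if h : w ∈ starDomain dev x then h.choose 1 else x

theorem sect_spec {x : X} {w : Plane} (h : w ∈ starDomain dev x) :
    ∃ γ : ℝ → X, ContinuousOn γ (Icc 0 1) ∧ γ 0 = x ∧ γ 1 = sect dev x w ∧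
      ∀ t ∈ Icc (0 : ℝ) 1, dev (γ t) = AffineMap.lineMap (dev x) w t :=
  ⟨h.choose, h.choose_spec.1, h.choose_spec.2.1, by rw [sect, dif_pos h], h.choose_spec.2.2⟩

theorem dev_sect {x : X} {w : Plane} (h : w ∈ starDomain dev x) : dev (sect dev x w) = w := by
  obtain ⟨γ, -, -, h1, hγ⟩ := sect_spec h
  rw [← h1, hγ 1 (by simp)]
  simp

theorem eqOn_of_section {α : Type*} [TopologicalSpace α] [T2Space X] (hd : IsLocalHomeomorph dev)
    {S : Set α} (hS : IsPreconnected S)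
    {s₁ s₂ : α → X} (h₁ : ContinuousOn s₁ S) (h₂ : ContinuousOn s₂ S)
    (h : ∀ a ∈ S, dev (s₁ a) = dev (s₂ a)) {a : α} (ha : a ∈ S) (haa : s₁ a = s₂ a) :
    EqOn s₁ s₂ S :=
  (T2Space.isSeparatedMap dev).eqOn_of_comp_eqOn hd.isLocallyInjective hS h₁ h₂ h ha haa

variable [T2Space X] (hd : IsLocalHomeomorph dev)
include hd

theorem path_eq_sect {x : X} {w : Plane} {γ : ℝ → X} (hc : ContinuousOn γ (Icc 0 1)) (h0 : γ 0 = x)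
    (hγ : ∀ t ∈ Icc (0 : ℝ) 1, dev (γ t) = AffineMap.lineMap (dev x) w t) {t : ℝ}
    (ht : t ∈ Icc (0 : ℝ) 1) : AffineMap.lineMap (dev x) w t ∈ starDomain dev x ∧
      sect dev x (AffineMap.lineMap (dev x) w t) = γ t := by
  have hmem : AffineMap.lineMap (dev x) w t ∈ starDomain dev x := by
    refine ⟨fun s => γ (s * t), hc.comp (by fun_prop) ?_, by simp [h0], ?_⟩
    · exact fun s hs => ⟨mul_nonneg hs.1 ht.1, mul_le_one₀ hs.2 ht.1 ht.2⟩
    · intro s hs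
      rw [hγ _ ⟨mul_nonneg hs.1 ht.1, mul_le_one₀ hs.2 ht.1 ht.2⟩]
      simp only [AffineMap.lineMap_apply_module']
      module
  refine ⟨hmem, ?_⟩
  obtain ⟨δ, hδc, hδ0, hδ1, hδ⟩ := sect_spec hmem
  have := eqOn_of_section hd isPreconnected_Icc hδc (s₂ := fun s => γ (s * t))
    (hc.comp (by fun_prop) fun s hs => ⟨mul_nonneg hs.1 ht.1, mul_le_one₀ hs.2 ht.1 ht.2⟩)
    (fun s hs => by
      rw [hδ s hs, hγ _ ⟨mul_nonneg hs.1 ht.1, mul_le_one₀ hs.2 ht.1 ht.2⟩]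
      simp only [AffineMap.lineMap_apply_module']
      module) (a := 0) (by simp) (by simp [hδ0, h0])
  rw [← hδ1, this (by simp : (1 : ℝ) ∈ Icc (0 : ℝ) 1)]
  simp

theorem lineMap_mem_starDomain {x : X} {w : Plane} (hw : w ∈ starDomain dev x) {t : ℝ}
    (ht : t ∈ Icc (0 : ℝ) 1) : AffineMap.lineMap (dev x) w t ∈ starDomain dev x := by
  obtain ⟨γ, hc, h0, hγ⟩ := hw
  exact (path_eq_sect hd hc h0 hγ ht).1

/-- Continuous sections over star-shaped sets are given by `sect`. -/
theorem subset_starDomain {x : X} {S : Set Plane} (hS : StarConvex ℝ (dev x) S) {s : Plane → X}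
    (hs : ContinuousOn s S) (hds : ∀ w ∈ S, dev (s w) = w) (hx : s (dev x) = x) {w : Plane}
    (hw : w ∈ S) : w ∈ starDomain dev x ∧ sect dev x w = s w := by
  have hmem : ∀ t ∈ Icc (0 : ℝ) 1, (AffineMap.lineMap (dev x) w t : Plane) ∈ S := by
    intro t ht
    rw [AffineMap.lineMap_apply_module]
    exact hS hw (by linarith [ht.2]) ht.1 (by ring)
  have hl : Continuous fun t : ℝ => (AffineMap.lineMap (dev x) w t : Plane) :=
    AffineMap.lineMap_continuous
  have := path_eq_sect hd (x := x) (w := w) (γ := fun t => s (AffineMap.lineMap (dev x) w t))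
    (hs.comp hl.continuousOn hmem) (by simp [hx]) (fun t ht => hds _ (hmem t ht)) (t := 1) (by simp)
  simpa using this

theorem self_mem_starDomain (x : X) : dev x ∈ starDomain dev x ∧ sect dev x (dev x) = x :=
  subset_starDomain hd (S := {dev x}) (s := fun _ => x) (starConvex_singleton _) (by fun_prop)
    (by simp) rfl rfl

omit [T2Space X] in
theorem isLocalHomeomorph_sumElim : IsLocalHomeomorph (Sum.elim dev (id : Plane → Plane)) := by
  refine IsLocalHomeomorph.mk _ fun x => ?_
  rcases x with x | w
  · obtain ⟨e, hx, he⟩ := hd x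
    have : Nonempty X := ⟨x⟩
    refine ⟨(IsOpenEmbedding.inl.toOpenPartialHomeomorph Sum.inl).symm.trans e, ?_, ?_⟩
    · simp only [OpenPartialHomeomorph.trans_source, OpenPartialHomeomorph.symm_source,
        IsOpenEmbedding.toOpenPartialHomeomorph_target, mem_inter_iff, mem_range, mem_preimage]
      refine ⟨⟨x, rfl⟩, ?_⟩
      have := IsOpenEmbedding.toOpenPartialHomeomorph_left_inv (Sum.inl : X → X ⊕ Plane)
        IsOpenEmbedding.inl (x := x)
      rwa [this]
    · rintro y hy
      obtain ⟨y, rfl⟩ : y ∈ range (Sum.inl : X → X ⊕ Plane) := by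
        simpa using hy.1
      have := IsOpenEmbedding.toOpenPartialHomeomorph_left_inv (Sum.inl : X → X ⊕ Plane)
        IsOpenEmbedding.inl (x := y)
      simp [this, he]
  · refine ⟨(IsOpenEmbedding.inr.toOpenPartialHomeomorph Sum.inr).symm, by simp, ?_⟩
    rintro y hy
    obtain ⟨y, rfl⟩ : y ∈ range (Sum.inr : Plane → X ⊕ Plane) := by simpa using hy
    have := IsOpenEmbedding.toOpenPartialHomeomorph_left_inv (Sum.inr : Plane → X ⊕ Plane)
        IsOpenEmbedding.inr (x := y)
    simp [this]

theorem sect_nhds {x : X} {w : Plane} (hw : w ∈ starDomain dev x) :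
    ∀ᶠ v in 𝓝 w, v ∈ starDomain dev x ∧ ContinuousAt (sect dev x) v := by
  obtain ⟨γ, hc, h0, hγ⟩ := id hw
  let f : C(unitInterval × Plane, Plane) :=
    ⟨fun q => AffineMap.lineMap (dev x) q.2 (q.1 : ℝ), by
      simp only [AffineMap.lineMap_apply_module]; fun_prop⟩
  classical
  let g : unitInterval × Plane → X ⊕ Plane := fun q =>
    if q.2 = w then Sum.inl (γ q.1) else if q.1 = 0 then Sum.inl x else Sum.inr (f q)
  have hg : Sum.elim dev id ∘ g = f := by
    ext1 q
    simp only [Function.comp, g]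
    split_ifs with h1 h2
    · simp [hγ q.1 q.1.2, f, h1]
    · simp [f, h2]
    · simp
  have hcγ : Continuous fun t : unitInterval => γ t := hc.domRestrict
  obtain ⟨N, hN, g', hg'c, hg', hg'0, hg'w⟩ := (isLocalHomeomorph_sumElim hd).exists_lift_nhds hg
    (by
      have : (fun a : Plane => g (0, a)) = fun _ => Sum.inl x := by
        ext1 a; simp only [g]; split_ifs <;> simp [h0]
      rw [this]; fun_prop) w
    (by simp only [g, if_true]; exact continuous_inl.comp hcγ)
  obtain ⟨W, hWN, hWo, hwW⟩ := mem_nhds_iff.1 hN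
  have key : ∀ v ∈ W, v ∈ starDomain dev x ∧ g' (1, v) = Sum.inl (sect dev x v) := by
    intro v hv
    have hpc : Continuous fun t : unitInterval => g' (t, v) :=
      hg'c.comp_continuous (by fun_prop) fun t => ⟨mem_univ _, hWN hv⟩
    have hpre : IsPreconnected (range fun t : unitInterval => g' (t, v)) :=
      isPreconnected_range hpc
    have hsub : (range fun t : unitInterval => g' (t, v)) ⊆ range Sum.inl := by
      refine hpre.subset_isClopen ⟨isClosed_range_inl, isOpen_range_inl⟩
        ⟨g' (0, v), ⟨0, rfl⟩, ?_⟩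
      rw [hg'0]; simp only [g]; split_ifs <;> simp
    choose δ hδ using fun t : unitInterval => hsub ⟨t, rfl⟩
    have hδc : Continuous δ := by
      rw [IsOpenEmbedding.inl.isEmbedding.continuous_iff (Y := X) (Z := X ⊕ Plane)]
      exact hpc.congr fun t => (hδ t).symm
    have hδ0 : δ 0 = x := by
      have h2 : g (0, v) = Sum.inl x := by
        simp only [g]; split_ifs <;> simp [h0]
      exact Sum.inl_injective ((hδ 0).trans ((hg'0 v).trans h2))
    have := path_eq_sect hd (x := x) (w := v) (γ := fun t => δ (projIcc 0 1 zero_le_one t))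
      (hδc.comp continuous_projIcc).continuousOn (by simpa using hδ0)
      (fun t ht => by
        have h1 := congrFun hg' (projIcc 0 1 zero_le_one t, v)
        simp only [Function.comp_apply, ← hδ] at h1
        simpa [f, projIcc_of_mem zero_le_one ht] using h1) (t := 1) (by simp)
    simp only [AffineMap.lineMap_apply_one] at this
    refine ⟨this.1, ?_⟩
    rw [this.2, hδ]; simp
  filter_upwards [hWo.mem_nhds hwW] with v hv
  refine ⟨(key v hv).1, ?_⟩
  have hcv : ContinuousAt (fun v => g' (1, v)) v :=
    ((hg'c.comp (s := W) (f := fun v => ((1 : unitInterval), v)) (by fun_prop)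
      fun a ha => ⟨mem_univ _, hWN ha⟩)).continuousAt (hWo.mem_nhds hv)
  rw [IsOpenEmbedding.inl.isEmbedding.continuousAt_iff (Y := X) (Z := X ⊕ Plane)]
  refine hcv.congr ?_
  filter_upwards [hWo.mem_nhds hv] with a ha using (key a ha).2

theorem isOpen_starDomain (x : X) : IsOpen (starDomain dev x) :=
  isOpen_iff_mem_nhds.2 fun _ hw => (sect_nhds hd hw).mono fun _ h => h.1

theorem continuousOn_sect (x : X) : ContinuousOn (sect dev x) (starDomain dev x) :=
  fun _ hw => (sect_nhds hd hw).self_of_nhds.2.continuousWithinAt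

/-- A convex part of the star domain of `x` lies in the star domain of the points above it. -/
theorem sect_sect {x : X} {S : Set Plane} (hS : Convex ℝ S) (hSx : S ⊆ starDomain dev x)
    {v w : Plane} (hv : v ∈ S) (hw : w ∈ S) :
    w ∈ starDomain dev (sect dev x v) ∧ sect dev (sect dev x v) w = sect dev x w := by
  have hdv := dev_sect (hSx hv)
  refine subset_starDomain hd (S := S) (by rw [hdv]; exact hS.starConvex hv)
    ((continuousOn_sect hd x).mono hSx) (fun w hw => dev_sect (hSx hw)) (by rw [hdv]) hw

/-- Points over the same point of the base of a covering have the same star domains,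
up to a translation. -/
theorem starDomain_of_covering {Y : Type*} [TopologicalSpace Y] [ChartedSpace Plane Y]
    [ChartedSpace Plane X] {p : X → Y} (hp : IsCoveringMap p) (hpt : IsTranslationMap p)
    (hdev : IsDevelopingMap dev) {x x' : X} (hxx : p x = p x') {w : Plane}
    (hw : w ∈ starDomain dev x) :
    w + (dev x' - dev x) ∈ starDomain dev x' ∧
      p (sect dev x' (w + (dev x' - dev x))) = p (sect dev x w) := by
  obtain ⟨γ, hc, h0, h1, hγ⟩ := sect_spec hw
  let γ₀ : C(unitInterval, X) := ⟨fun t => γ t, hc.domRestrict⟩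
  let γ' : C(unitInterval, Y) := ⟨fun t => p (γ t), hp.continuous.comp hc.domRestrict⟩
  obtain ⟨Γ, hΓ, hΓ0⟩ := hp.exists_path_lifts γ' x' ((congrArg p (by simpa using h0)).trans hxx)
  have hpΓ : ∀ t, p (Γ t) = p (γ₀ t) := fun t => congrFun hΓ t
  have hloc : IsLocallyConstant fun t : unitInterval => dev (Γ t) - dev (γ₀ t) := by
    refine (IsLocallyConstant.iff_eventually_eq _).2 fun t => ?_
    obtain ⟨c₁, hc₁⟩ := hdev (Γ t)
    obtain ⟨c₂, hc₂⟩ := hdev (γ₀ t)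
    obtain ⟨d₁, hd₁⟩ := hpt (Γ t)
    obtain ⟨d₂, hd₂⟩ := hpt (γ₀ t)
    have hA := Γ.continuous.tendsto t
    have hB := γ₀.continuous.tendsto t
    filter_upwards [hA.eventually hc₁, hB.eventually hc₂, hA.eventually hd₁, hB.eventually hd₂]
      with s e₁ e₂ e₃ e₄
    have f₁ := hc₁.self_of_nhds
    have f₂ := hc₂.self_of_nhds
    have f₃ := hd₁.self_of_nhds
    have f₄ := hd₂.self_of_nhds
    rw [hpΓ t] at f₃ e₃
    rw [hpΓ s, e₄] at e₃
    rw [f₄] at f₃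
    rw [e₁, e₂, f₁, f₂]
    have e₅ : chartAt Plane (Γ t) (Γ s) = chartAt Plane (γ₀ t) (γ₀ s) + d₂ - d₁ := by
      rw [e₃]; abel
    have f₅ : chartAt Plane (Γ t) (Γ t) = chartAt Plane (γ₀ t) (γ₀ t) + d₂ - d₁ := by
      rw [f₃]; abel
    rw [e₅, f₅]; abel
  have hconst : ∀ t, dev (Γ t) = dev (γ₀ t) + (dev x' - dev x) := by
    intro t
    have := hloc.apply_eq_of_isPreconnected isPreconnected_univ (mem_univ t) (mem_univ 0)
    have h00 : γ₀ 0 = x := (congrArg γ (by simp)).trans h0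
    simp only [hΓ0, h00] at this
    rw [← this]; abel
  have := path_eq_sect hd (x := x') (w := w + (dev x' - dev x))
    (γ := fun t => Γ (projIcc 0 1 zero_le_one t))
      (Γ.continuous.comp continuous_projIcc).continuousOn (by simpa using hΓ0)
      (fun t ht => by
        rw [hconst, projIcc_of_mem zero_le_one ht]
        have h2 : dev (γ₀ ⟨t, ht⟩) = AffineMap.lineMap (dev x) w t := hγ t ht
        rw [h2]
        simp only [AffineMap.lineMap_apply_module']
        module) (t := 1) (by simp)
  simp only [AffineMap.lineMap_apply_one] at this
  refine ⟨this.1, ?_⟩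
  rw [this.2, hpΓ, ← h1]
  exact congrArg (fun t => p (γ t)) (by simp)

end Star

end TranslationConics
end

noncomputable section
namespace TranslationConics

section CompletionFacts

open UniformSpace

variable {X : Type*} [MetricSpace X]

theorem isOpenEmbedding_coe_completion [LocallyCompactSpace X] :
    IsOpenEmbedding ((↑) : X → Completion X) := by
  refine IsOpenEmbedding.of_isEmbedding_isOpenMap (Completion.isUniformEmbedding_coe X).isEmbedding
    fun W hW => isOpen_iff_mem_nhds.2 ?_
  rintro _ ⟨x, hx, rfl⟩
  obtain ⟨K, hKx, hKW, hK⟩ := local_compact_nhds (hW.mem_nhds hx)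
  obtain ⟨ε, hε, hball⟩ := Metric.mem_nhds_iff.1 hKx
  refine mem_of_superset (Metric.ball_mem_nhds _ hε) ?_
  have h1 : Metric.ball (x : Completion X) ε ⊆ closure (Metric.ball (x : Completion X) ε ∩
      range ((↑) : X → Completion X)) :=
    Completion.denseRange_coe.open_subset_closure_inter Metric.isOpen_ball
  have h2 : closure (Metric.ball (x : Completion X) ε ∩ range ((↑) : X → Completion X)) ⊆
      ((↑) : X → Completion X) '' K := by
    refine closure_minimal ?_ (hK.image (Completion.continuous_coe X)).isClosed
    rintro _ ⟨hy, ⟨y, rfl⟩⟩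
    refine ⟨y, hball ?_, rfl⟩
    rw [Metric.mem_ball] at hy ⊢
    rwa [Completion.dist_eq] at hy
  exact (h1.trans h2).trans (image_mono hKW)

end CompletionFacts

section Frontier

theorem continuous_devExt {X : Type*} [MetricSpace X] {dev : X → Plane} :
    Continuous (devExt dev) := UniformSpace.Completion.continuous_extension

/-- The points that are visible from `x`: the half-open segments to these points lift. -/
def visibleSet {X : Type*} [TopologicalSpace X] (dev : X → Plane) (x : X) : Set Plane :=
  {w | ∀ t ∈ Ico (0 : ℝ) 1, (AffineMap.lineMap (dev x) w t : Plane) ∈ starDomain dev x}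

/-- The visible points at which geodesics starting at `x` leave the surface. -/
def exitSet {X : Type*} [TopologicalSpace X] (dev : X → Plane) (x : X) : Set Plane :=
  visibleSet dev x \ starDomain dev x

/-- The point of the completion over a visible point. -/
def limitPoint {X : Type*} [MetricSpace X] (dev : X → Plane) (x : X) (w : Plane) :
    UniformSpace.Completion X :=
  @lim _ _ ⟨(x : UniformSpace.Completion X)⟩ (map (fun t : ℝ =>
    ((sect dev x (AffineMap.lineMap (dev x) w t) : X) : UniformSpace.Completion X)) (𝓝[<] 1))

theorem convex_lineMap_image {s : Set ℝ} (hs : Convex ℝ s) (a b : Plane) :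
    Convex ℝ ((fun t : ℝ => (AffineMap.lineMap a b t : Plane)) '' s) :=
  hs.affine_image (AffineMap.lineMap a b)

theorem lineMap_mem_of_closure {S : Set Plane} (hS : Convex ℝ S) (ho : IsOpen S) {p w : Plane}
    (hp : p ∈ S) (hw : w ∈ closure S) {t : ℝ} (ht : t ∈ Ico (0 : ℝ) 1) :
    (AffineMap.lineMap p w t : Plane) ∈ S := by
  rcases ht.1.eq_or_lt with rfl | h0
  · simpa using hp
  · have := hS.openSegment_interior_closure_subset_interior (by rwa [ho.interior_eq]) hw
    rw [ho.interior_eq, openSegment_eq_image_lineMap] at this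
    exact this ⟨t, ⟨h0, ht.2⟩, rfl⟩

theorem closure_subset_visibleSet {X : Type*} [TopologicalSpace X] {dev : X → Plane} {x : X} {S : Set Plane} (hS : Convex ℝ S) (ho : IsOpen S)
    (hx : dev x ∈ S) (hSx : S ⊆ starDomain dev x) : closure S ⊆ visibleSet dev x :=
  fun _ hw _ ht => hSx (lineMap_mem_of_closure hS ho hx hw ht)

theorem lineMap_lineMap_zero (a b : Plane) (s t : ℝ) :
    (AffineMap.lineMap a (AffineMap.lineMap a b t : Plane) s : Plane) =
      AffineMap.lineMap a b (s * t) := by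
  simp only [AffineMap.lineMap_apply_module']
  module

open UniformSpace

variable {X : Type*} [MetricSpace X] [ChartedSpace Plane X] [TranslationSurface X] {dev : X → Plane}
  (hdev : IsDevelopingMap dev)
include hdev

theorem devExt_coe (x : X) : devExt dev x = dev x :=
  Completion.extension_coe hdev.lipschitzWith.uniformContinuous x

theorem dist_sect {x : X} {S : Set Plane} (hS : Convex ℝ S) (hSx : S ⊆ starDomain dev x)
    {v w : Plane} (hv : v ∈ S) (hw : w ∈ S) :
    dist (sect dev x v) (sect dev x w) = dist v w := by
  apply le_antisymm
  · have hseg : ∀ t ∈ Icc (0 : ℝ) 1, (AffineMap.lineMap v w t : Plane) ∈ S := fun t ht => by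
      rw [AffineMap.lineMap_apply_module]
      exact hS hv hw (by linarith [ht.2]) ht.1 (by ring)
    have := hdev.dist_le_of_segment (γ := fun t => sect dev x (AffineMap.lineMap v w t))
      (a := v) (b := w)
      (((continuousOn_sect hdev.isLocalHomeomorph x).mono hSx).comp
        AffineMap.lineMap_continuous.continuousOn hseg)
      (fun t ht => dev_sect (hSx (hseg t ht)))
    simpa using this
  · have := hdev.lipschitzWith.dist_le_mul (sect dev x v) (sect dev x w)
    rwa [dev_sect (hSx hv), dev_sect (hSx hw), NNReal.coe_one, one_mul] at this

/-- Balls below an embedded disc are embedded discs. -/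
theorem eq_sect_of_dist_lt {x y : X} {r : ℝ} (hr : Metric.ball (dev x) r ⊆ starDomain dev x)
    (hxy : dist x y < r) : dev y ∈ Metric.ball (dev x) r ∧ sect dev x (dev y) = y := by
  have hr0 : 0 < r := dist_nonneg.trans_lt hxy
  have h' : flatEDist X x y < ENNReal.ofReal r := by
    rw [← TranslationSurface.edist_eq, edist_dist]
    exact (ENNReal.ofReal_lt_ofReal_iff hr0).2 hxy
  obtain ⟨γ, h0, h1, hγ, hl⟩ := exists_path_of_flatEDist_lt h'
  have hC := (hdev.isTranslationMap.isC1Path_comp_iff hdev.continuous hγ.continuousOn).2 hγ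
  rw [← hdev.isTranslationMap.flatLength_comp hγ.continuousOn] at hl
  have hball : ∀ t ∈ Icc (0 : ℝ) 1, dev (γ t) ∈ Metric.ball (dev x) r := by
    intro t ht
    have h2 := enorm_sub_le_lintegral_deriv_of_contDiffOn_Icc
      ((isC1Path_plane_iff.1 hC).mono (Icc_subset_Icc_right ht.2)) ht.1
    have h3 : flatLength (dev ∘ γ) = ∫⁻ t in Icc (0 : ℝ) 1, ‖deriv (dev ∘ γ) t‖ₑ := by
      simp only [flatLength, chartAt_self_eq, fderiv_apply_one_eq_deriv]
      rfl
    have h4 := h2.trans_lt ((MeasureTheory.lintegral_mono_set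
      (Icc_subset_Icc_right ht.2)).trans_lt (h3 ▸ hl))
    simp only [Function.comp_apply, h0] at h4
    rw [← edist_eq_enorm_sub, edist_dist, ENNReal.ofReal_lt_ofReal_iff hr0] at h4
    exact h4
  have heq := eqOn_of_section hdev.isLocalHomeomorph isPreconnected_Icc
    (s₁ := fun t => sect dev x (dev (γ t))) (s₂ := γ)
    (((continuousOn_sect hdev.isLocalHomeomorph x).mono hr).comp
      (hdev.continuous.comp_continuousOn hγ.continuousOn) hball) hγ.continuousOn
    (fun t ht => dev_sect (hr (hball t ht))) (a := 0) (by simp)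
    (by simp [h0, (self_mem_starDomain hdev.isLocalHomeomorph x).2])
  have := heq (by simp : (1 : ℝ) ∈ Icc (0 : ℝ) 1)
  simp only [h1] at this
  exact ⟨h1 ▸ hball 1 (by simp), this⟩


theorem tendsto_limitPoint {x : X} {w : Plane} (hw : w ∈ visibleSet dev x) :
    Tendsto (fun t : ℝ => ((sect dev x (AffineMap.lineMap (dev x) w t) : X) : Completion X)) (𝓝[<] 1)
      (𝓝 (limitPoint dev x w)) := by
  refine le_nhds_lim (CompleteSpace.complete ?_)
  have hl : Tendsto (fun t : ℝ => (AffineMap.lineMap (dev x) w t : Plane)) (𝓝[<] 1)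
      (𝓝 (AffineMap.lineMap (dev x) w (1 : ℝ))) :=
    (AffineMap.lineMap_continuous.tendsto 1).mono_left nhdsWithin_le_nhds
  have hc := hl.cauchy_map
  rw [cauchy_map_iff', Metric.uniformity_basis_dist.tendsto_right_iff] at hc ⊢
  intro ε hε
  have hI : Ico (0 : ℝ) 1 ∈ 𝓝[<] (1 : ℝ) := Ico_mem_nhdsLT zero_lt_one
  filter_upwards [hc ε hε, prod_mem_prod hI hI] with q hq hI
  change dist ((sect dev x (AffineMap.lineMap (dev x) w q.1) : X) : Completion X)
    ((sect dev x (AffineMap.lineMap (dev x) w q.2) : X) : Completion X) < ε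
  rw [Completion.dist_eq, dist_sect hdev (convex_lineMap_image (convex_Ico 0 1) (dev x) w) ?_
    ⟨q.1, hI.1, rfl⟩ ⟨q.2, hI.2, rfl⟩]
  · exact hq
  · rintro _ ⟨t, ht, rfl⟩
    exact hw t ht

theorem devExt_limitPoint {x : X} {w : Plane} (hw : w ∈ visibleSet dev x) :
    devExt dev (limitPoint dev x w) = w := by
  have h1 := (continuous_devExt (dev := dev)).continuousAt.tendsto.comp (tendsto_limitPoint hdev hw)
  have h2 : Tendsto (fun t : ℝ => (AffineMap.lineMap (dev x) w t : Plane)) (𝓝[<] 1)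
      (𝓝 (AffineMap.lineMap (dev x) w (1 : ℝ))) :=
    (AffineMap.lineMap_continuous.tendsto 1).mono_left nhdsWithin_le_nhds
  rw [AffineMap.lineMap_apply_one] at h2
  refine tendsto_nhds_unique h1 (h2.congr' ?_)
  filter_upwards [Ico_mem_nhdsLT (zero_lt_one (α := ℝ))] with t ht
  simp [devExt_coe hdev, dev_sect (hw t ht)]

theorem limitPoint_of_mem {x : X} {w : Plane} (hw : w ∈ starDomain dev x) :
    w ∈ visibleSet dev x ∧ limitPoint dev x w = ((sect dev x w : X) : Completion X) := by
  have hv : w ∈ visibleSet dev x := fun t ht =>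
    lineMap_mem_starDomain hdev.isLocalHomeomorph hw ⟨ht.1, ht.2.le⟩
  refine ⟨hv, tendsto_nhds_unique (tendsto_limitPoint hdev hv) ?_⟩
  refine ((Completion.continuous_coe X).tendsto _).comp ?_
  have h1 := (sect_nhds hdev.isLocalHomeomorph hw).self_of_nhds.2
  have h2 : Tendsto (fun t : ℝ => (AffineMap.lineMap (dev x) w t : Plane)) (𝓝[<] 1)
      (𝓝 (AffineMap.lineMap (dev x) w (1 : ℝ))) :=
    (AffineMap.lineMap_continuous.tendsto 1).mono_left nhdsWithin_le_nhds
  rw [AffineMap.lineMap_apply_one] at h2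
  exact h1.tendsto.comp h2

theorem mem_starDomain_of_limitPoint {x : X} {w : Plane} (hw : w ∈ visibleSet dev x) {y : X}
    (hy : limitPoint dev x w = (y : Completion X)) : w ∈ starDomain dev x := by
  classical
  have hyw : dev y = w := by rw [← devExt_coe hdev, ← hy, devExt_limitPoint hdev hw]
  have ht : Tendsto (fun t : ℝ => sect dev x (AffineMap.lineMap (dev x) w t)) (𝓝[<] 1) (𝓝 y) := by
    rw [(Completion.isUniformEmbedding_coe X).isEmbedding.isInducing.tendsto_nhds_iff, ← hy]
    exact tendsto_limitPoint hdev hw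
  let γ : ℝ → X := fun t => if t < 1 then sect dev x (AffineMap.lineMap (dev x) w t) else y
  refine ⟨γ, fun t h => ?_, ?_, fun t h => ?_⟩
  · rcases h.2.lt_or_eq with h1 | rfl
    · have hc : ContinuousAt (fun t : ℝ => sect dev x (AffineMap.lineMap (dev x) w t)) t :=
        ContinuousAt.comp (g := sect dev x) (f := fun t : ℝ => (AffineMap.lineMap (dev x) w t : Plane))
          (sect_nhds hdev.isLocalHomeomorph (hw t ⟨h.1, h1⟩)).self_of_nhds.2
          AffineMap.lineMap_continuous.continuousAt
      refine (hc.congr ?_).continuousWithinAt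
      filter_upwards [Iio_mem_nhds h1] with s hs
      exact (if_pos hs).symm
    · have : ContinuousWithinAt γ (Iio 1) 1 := by
        simp only [ContinuousWithinAt, γ, lt_irrefl, if_false]
        refine ht.congr' ?_
        filter_upwards [self_mem_nhdsWithin] with s hs
        exact (if_pos hs).symm
      have h2 := continuousWithinAt_insert_self.2 this
      exact h2.mono fun s hs => by
        rcases hs.2.lt_or_eq with h | h
        · exact Or.inr h
        · exact Or.inl h
  · simp [γ, (self_mem_starDomain hdev.isLocalHomeomorph x).2]
  · simp only [γ]
    split_ifs with h1
    · exact dev_sect (hw t ⟨h.1, h1⟩)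
    · rw [le_antisymm h.2 (not_lt.1 h1), hyw]; simp

theorem limitPoint_mem_metricFrontier {x : X} {w : Plane} (hw : w ∈ visibleSet dev x) :
    limitPoint dev x w ∈ metricFrontier X ↔ w ∉ starDomain dev x := by
  refine ⟨?_, fun h h' => ?_⟩
  · intro h h'
    rw [(limitPoint_of_mem hdev h').2] at h
    exact h ⟨_, rfl⟩
  · obtain ⟨y, hy⟩ := h'
    exact h (mem_starDomain_of_limitPoint hdev hw hy.symm)

theorem dist_limitPoint_sect {x : X} {w : Plane} (hw : w ∈ visibleSet dev x) {t : ℝ}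
    (ht : t ∈ Ico (0 : ℝ) 1) :
    dist (limitPoint dev x w) ((sect dev x (AffineMap.lineMap (dev x) w t) : X) : Completion X) =
      dist w (AffineMap.lineMap (dev x) w t) := by
  have h2 : Tendsto (fun t : ℝ => (AffineMap.lineMap (dev x) w t : Plane)) (𝓝[<] 1)
      (𝓝 (AffineMap.lineMap (dev x) w (1 : ℝ))) :=
    (AffineMap.lineMap_continuous.tendsto 1).mono_left nhdsWithin_le_nhds
  rw [AffineMap.lineMap_apply_one] at h2
  refine tendsto_nhds_unique ((tendsto_limitPoint hdev hw).dist tendsto_const_nhds)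
    ((h2.dist tendsto_const_nhds).congr' ?_)
  filter_upwards [Ico_mem_nhdsLT (zero_lt_one (α := ℝ))] with s hs
  rw [Completion.dist_eq, dist_sect hdev (convex_lineMap_image (convex_Ico 0 1) (dev x) w) ?_
    ⟨s, hs, rfl⟩ ⟨t, ht, rfl⟩]
  rintro _ ⟨t, ht, rfl⟩
  exact hw t ht

theorem dist_limitPoint {x : X} {S : Set Plane} (hS : Convex ℝ S) (ho : IsOpen S)
    (hx : dev x ∈ S) (hSx : S ⊆ starDomain dev x) {v w : Plane} (hv : v ∈ closure S)
    (hw : w ∈ closure S) :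
    dist (limitPoint dev x v) (limitPoint dev x w) = dist v w := by
  have hl : ∀ w : Plane, Tendsto (fun t : ℝ => (AffineMap.lineMap (dev x) w t : Plane)) (𝓝[<] 1)
      (𝓝 w) := fun w => by
    have := ((AffineMap.lineMap_continuous (R := ℝ) (p := dev x) (q := w)).tendsto 1).mono_left
      (nhdsWithin_le_nhds (s := Iio 1))
    rwa [AffineMap.lineMap_apply_one] at this
  have hvis := closure_subset_visibleSet hS ho hx hSx
  refine tendsto_nhds_unique ((tendsto_limitPoint hdev (hvis hv)).dist
    (tendsto_limitPoint hdev (hvis hw))) (((hl v).dist (hl w)).congr' ?_)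
  filter_upwards [Ico_mem_nhdsLT (zero_lt_one (α := ℝ))] with s hs
  rw [Completion.dist_eq, dist_sect hdev hS hSx (lineMap_mem_of_closure hS ho hx hv hs)
    (lineMap_mem_of_closure hS ho hx hw hs)]

/-- Exit points are isolated. -/
theorem exitSet_isolated (hX : DiscreteTopology (metricFrontier X)) {x : X} {z : Plane}
    (hz : z ∈ exitSet dev x) : ∀ᶠ w in 𝓝 z, w ∈ exitSet dev x → w = z := by
  have hzF : limitPoint dev x z ∈ metricFrontier X := (limitPoint_mem_metricFrontier hdev hz.1).2 hz.2
  obtain ⟨ρ, hρ, hball⟩ : ∃ ρ > 0, ∀ η ∈ metricFrontier X, dist η (limitPoint dev x z) < 4 * ρ →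
      η = limitPoint dev x z := by
    have h1 : ({⟨limitPoint dev x z, hzF⟩} : Set (metricFrontier X)) ∈ 𝓝 ⟨limitPoint dev x z, hzF⟩ :=
      (isOpen_discrete _).mem_nhds rfl
    obtain ⟨ε, hε, h⟩ := Metric.mem_nhds_iff.1 h1
    refine ⟨ε / 4, by positivity, fun η hη hd => ?_⟩
    have := @h ⟨η, hη⟩ (by rw [Metric.mem_ball, Subtype.dist_eq]; simp only; linarith)
    simpa using this
  have hl : ∀ w : Plane, Tendsto (fun t : ℝ => (AffineMap.lineMap (dev x) w t : Plane)) (𝓝[<] 1)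
      (𝓝 w) := fun w => by
    have := ((AffineMap.lineMap_continuous (R := ℝ) (p := dev x) (q := w)).tendsto 1).mono_left
      (nhdsWithin_le_nhds (s := Iio 1))
    rwa [AffineMap.lineMap_apply_one] at this
  obtain ⟨t, ht, hta⟩ : ∃ t ∈ Ico (0 : ℝ) 1,
      dist (AffineMap.lineMap (dev x) z t : Plane) z < ρ := by
    have := ((hl z).eventually (Metric.ball_mem_nhds z hρ)).and (Ico_mem_nhdsLT (zero_lt_one (α := ℝ)))
    obtain ⟨t, h1, h2⟩ := this.exists
    exact ⟨t, h2, h1⟩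
  have haD := hz.1 t ht
  have hca := (sect_nhds hdev.isLocalHomeomorph haD).self_of_nhds.2
  have hcw : ContinuousAt (fun w : Plane => (AffineMap.lineMap (dev x) w t : Plane)) z := by
    simp only [AffineMap.lineMap_apply_module]; fun_prop
  have hcs : ContinuousAt (fun w : Plane => sect dev x (AffineMap.lineMap (dev x) w t)) z :=
    ContinuousAt.comp (g := sect dev x) hca hcw
  have e1 := hcs.eventually (Metric.ball_mem_nhds _ hρ)
  have e2 : ∀ᶠ w in 𝓝 z, dist w (AffineMap.lineMap (dev x) w t : Plane) < ρ := by
    have : ContinuousAt (fun w : Plane => dist w (AffineMap.lineMap (dev x) w t : Plane)) z :=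
      continuousAt_id.dist hcw
    refine this.eventually (Iio_mem_nhds ?_)
    simpa only [dist_comm z] using hta
  filter_upwards [e1, e2] with w h1 h2 hw
  have hd1 := dist_limitPoint_sect hdev hw.1 ht
  have hd2 := dist_limitPoint_sect hdev hz.1 ht
  have hd3 : dist ((sect dev x (AffineMap.lineMap (dev x) w t) : X) : Completion X)
      ((sect dev x (AffineMap.lineMap (dev x) z t) : X) : Completion X) < ρ := by
    rw [Completion.dist_eq]; exact h1
  have key : dist (limitPoint dev x w) (limitPoint dev x z) < 4 * ρ := by
    have t1 := dist_triangle4 (limitPoint dev x w)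
      ((sect dev x (AffineMap.lineMap (dev x) w t) : X) : Completion X)
      ((sect dev x (AffineMap.lineMap (dev x) z t) : X) : Completion X) (limitPoint dev x z)
    have hd4 := (dist_comm _ _).trans (hd2.trans (dist_comm _ _))
    linarith
  have := hball _ ((limitPoint_mem_metricFrontier hdev hw.1).2 hw.2) key
  rw [← devExt_limitPoint hdev hw.1, this, devExt_limitPoint hdev hz.1]

/-- A star-shaped set without exit points lies in the star domain. -/
theorem subset_starDomain_of_disjoint {x : X} {S : Set Plane} (hS : StarConvex ℝ (dev x) S)
    (hd : Disjoint S (exitSet dev x)) : S ⊆ starDomain dev x := by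
  intro w hw
  by_contra hwD
  have hmem : ∀ t ∈ Icc (0 : ℝ) 1, (AffineMap.lineMap (dev x) w t : Plane) ∈ S := by
    intro t ht
    rw [AffineMap.lineMap_apply_module]
    exact hS hw (by linarith [ht.2]) ht.1 (by ring)
  let B : Set ℝ := {t | t ∈ Icc (0 : ℝ) 1 ∧ (AffineMap.lineMap (dev x) w t : Plane) ∉ starDomain dev x}
  have hBc : IsClosed B := by
    exact isClosed_Icc.inter ((isOpen_starDomain hdev.isLocalHomeomorph x).isClosed_compl.preimage
      (AffineMap.lineMap_continuous (R := ℝ) (p := dev x) (q := w)))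
  have hBne : B.Nonempty := ⟨1, by simp, by simpa using hwD⟩
  have hBb : BddBelow B := ⟨0, fun t ht => ht.1.1⟩
  have hm := hBc.csInf_mem hBne hBb
  refine disjoint_left.1 hd (hmem _ hm.1) ⟨?_, hm.2⟩
  intro s hs
  rw [lineMap_lineMap_zero]
  by_contra hcon
  have h0 : 0 < sInf B := by
    refine hm.1.1.lt_of_ne fun h => hm.2 ?_
    rw [← h]; simpa using (self_mem_starDomain hdev.isLocalHomeomorph x).1
  have h1 : s * sInf B < sInf B := by nlinarith [hs.2]
  exact absurd (csInf_le hBb ⟨⟨mul_nonneg hs.1 h0.le, h1.le.trans hm.1.2⟩, hcon⟩) (not_le.2 h1)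

end Frontier

end TranslationConics
end

noncomputable section
namespace TranslationConics

section SubconicStructure

/-- The polynomial function of degree at most `2` on the plane with the given coefficients. -/
def quadric (c : Fin 6 → ℝ) (v : Plane) : ℝ :=
  c 0 * v 0 ^ 2 + c 1 * (v 0 * v 1) + c 2 * v 1 ^ 2 + c 3 * v 0 + c 4 * v 1 + c 5

theorem exists_quadric_eq (q : QuadraticForm ℝ (Fin 3 → ℝ)) :
    ∃ c : Fin 6 → ℝ, ∀ x : Plane, q ![x 0, x 1, 1] = quadric c x := by
  let B := QuadraticMap.associated (R := ℝ) q
  let e : Fin 3 → Fin 3 → ℝ := fun i => Pi.single i 1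
  refine ⟨![B (e 0) (e 0), B (e 0) (e 1) + B (e 1) (e 0), B (e 1) (e 1),
    B (e 0) (e 2) + B (e 2) (e 0), B (e 1) (e 2) + B (e 2) (e 1), B (e 2) (e 2)], fun x => ?_⟩
  have h : ![x 0, x 1, 1] = x 0 • e 0 + x 1 • e 1 + e 2 := by
    ext i; fin_cases i <;> simp [e]
  rw [← QuadraticMap.associated_eq_self_apply ℝ q, h]
  simp only [map_add, LinearMap.add_apply, map_smul, LinearMap.smul_apply, smul_eq_mul, quadric]
  simp [B]
  ring

/-- The quadratic form whose restriction to the affine plane is a given quadric. -/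
def formOfCoeffs (c : Fin 6 → ℝ) : QuadraticForm ℝ (Fin 3 → ℝ) :=
  let π : Fin 3 → (Fin 3 → ℝ) →ₗ[ℝ] ℝ := LinearMap.proj
  c 0 • QuadraticMap.linMulLin (π 0) (π 0) + c 1 • QuadraticMap.linMulLin (π 0) (π 1) +
    c 2 • QuadraticMap.linMulLin (π 1) (π 1) + c 3 • QuadraticMap.linMulLin (π 0) (π 2) +
    c 4 • QuadraticMap.linMulLin (π 1) (π 2) + c 5 • QuadraticMap.linMulLin (π 2) (π 2)

theorem formOfCoeffs_apply (c : Fin 6 → ℝ) (v : Fin 3 → ℝ) :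
    formOfCoeffs c v = c 0 * (v 0 * v 0) + c 1 * (v 0 * v 1) + c 2 * (v 1 * v 1) +
      c 3 * (v 0 * v 2) + c 4 * (v 1 * v 2) + c 5 * (v 2 * v 2) := by
  simp [formOfCoeffs]

theorem planarSubconic_formOfCoeffs (c : Fin 6 → ℝ) :
    planarSubconic (formOfCoeffs c) = {x | quadric c x < 0} := by
  ext x
  simp only [planarSubconic, mem_ofPred_eq, formOfCoeffs_apply, quadric]
  simp [pow_two]

@[fun_prop]
theorem continuous_quadric (c : Fin 6 → ℝ) : Continuous (quadric c) := by
  unfold quadric; fun_prop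

theorem exists_planarSubconic_eq (q : QuadraticForm ℝ (Fin 3 → ℝ)) :
    ∃ c : Fin 6 → ℝ, planarSubconic q = {x | quadric c x < 0} := by
  obtain ⟨c, hc⟩ := exists_quadric_eq q
  exact ⟨c, by ext x; simp [planarSubconic, hc]⟩

theorem isOpen_planarSubconic (q : QuadraticForm ℝ (Fin 3 → ℝ)) : IsOpen (planarSubconic q) := by
  obtain ⟨c, hc⟩ := exists_planarSubconic_eq q
  exact hc ▸ isOpen_lt (continuous_quadric c) continuous_const

open UniformSpace

variable {X : Type*} [MetricSpace X] {dev : X → Plane}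

theorem Subconic.nonempty_of_mem_boundary {U : Subconic dev} {ξ : Completion X}
    (h : ξ ∈ U.boundary) : U.1.Nonempty := by
  by_contra hU
  rw [not_nonempty_iff_eq_empty] at hU
  simp [Subconic.boundary, hU] at h

theorem Subconic.isOpen_image (U : Subconic dev) : IsOpen (dev '' U.1) := by
  obtain ⟨q, hq, -⟩ := U.2.2
  exact hq ▸ isOpen_planarSubconic q

theorem Subconic.convex_image (U : Subconic dev) : Convex ℝ (dev '' U.1) := by
  rintro _ ⟨y, hy, rfl⟩ _ ⟨z, hz, rfl⟩ a b ha hb hab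
  obtain ⟨γ, hγ⟩ := U.2.1 y hy z hz
  refine ⟨γ ⟨b, hb, by linarith⟩, (hγ _).1, ?_⟩
  obtain rfl : a = 1 - b := by linarith
  rw [(hγ _).2, AffineMap.lineMap_apply_module]

variable [ChartedSpace Plane X] [TranslationSurface X] (hdev : IsDevelopingMap dev)
include hdev

theorem Subconic.sect_dev (U : Subconic dev) {x y : X} (hx : x ∈ U.1) (hy : y ∈ U.1) :
    dev y ∈ starDomain dev x ∧ sect dev x (dev y) = y := by
  obtain ⟨γ, hγ⟩ := U.2.1 x hx y hy
  have := path_eq_sect hdev.isLocalHomeomorph (x := x) (w := dev y)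
    (γ := fun t => γ (projIcc 0 1 zero_le_one t)) (γ.continuous.comp continuous_projIcc).continuousOn
    (by simp) (fun t ht => by rw [(hγ _).2, projIcc_of_mem zero_le_one ht]) (t := 1) (by simp)
  simpa using this

theorem Subconic.image_subset (U : Subconic dev) {x : X} (hx : x ∈ U.1) :
    dev '' U.1 ⊆ starDomain dev x := by
  rintro _ ⟨y, hy, rfl⟩
  exact (U.sect_dev hdev hx hy).1

theorem Subconic.eq_image (U : Subconic dev) {x : X} (hx : x ∈ U.1) :
    U.1 = sect dev x '' (dev '' U.1) := by
  ext y
  constructor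
  · exact fun hy => ⟨dev y, ⟨y, hy, rfl⟩, (U.sect_dev hdev hx hy).2⟩
  · rintro ⟨_, ⟨z, hz, rfl⟩, rfl⟩
    rwa [(U.sect_dev hdev hx hz).2]

theorem exists_subconic {x : X} {V : Set Plane} (hV : Convex ℝ V) (hx : dev x ∈ V)
    (hVx : V ⊆ starDomain dev x) (hq : ∃ q, V = planarSubconic q ∧ V ≠ univ) :
    ∃ U : Subconic dev, x ∈ U.1 ∧ dev '' U.1 = V := by
  have himg : dev '' (sect dev x '' V) = V := by
    ext w
    constructor
    · rintro ⟨_, ⟨v, hv, rfl⟩, rfl⟩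
      rwa [dev_sect (hVx hv)]
    · exact fun hw => ⟨_, ⟨w, hw, rfl⟩, dev_sect (hVx hw)⟩
  refine ⟨⟨sect dev x '' V, ?_, ?_⟩, ⟨dev x, hx, (self_mem_starDomain hdev.isLocalHomeomorph x).2⟩,
    himg⟩
  · rintro _ ⟨v, hv, rfl⟩ _ ⟨w, hw, rfl⟩
    have hseg : ∀ t : unitInterval, (AffineMap.lineMap v w (t : ℝ) : Plane) ∈ V := fun t => by
      rw [AffineMap.lineMap_apply_module]
      exact hV hv hw (by linarith [t.2.2]) t.2.1 (by ring)
    refine ⟨⟨⟨fun t => sect dev x (AffineMap.lineMap v w (t : ℝ)), ?_⟩, by simp, by simp⟩,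
      fun t => ⟨⟨_, hseg t, rfl⟩, ?_⟩⟩
    · exact ((continuousOn_sect hdev.isLocalHomeomorph x).mono hVx).comp_continuous
        (AffineMap.lineMap_continuous.comp continuous_subtype_val) hseg
    · rw [dev_sect (hVx hv), dev_sect (hVx hw)]
      exact dev_sect (hVx (hseg t))
  · rw [himg]; exact hq

theorem Subconic.isOpen (U : Subconic dev) : IsOpen U.1 := by
  refine isOpen_iff_mem_nhds.2 fun y hy => ?_
  obtain ⟨W, hW, hinj⟩ := isLocallyInjective_iff_nhds.1 hdev.isLocalHomeomorph.isLocallyInjective y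
  have hyV : dev y ∈ dev '' U.1 := ⟨y, hy, rfl⟩
  have h1 : ContinuousAt (fun z => sect dev y (dev z)) y :=
    ContinuousAt.comp (g := sect dev y) (sect_nhds hdev.isLocalHomeomorph
      (U.image_subset hdev hy hyV)).self_of_nhds.2 hdev.continuous.continuousAt
  have h2 := h1.eventually (by
    simp only [(self_mem_starDomain hdev.isLocalHomeomorph y).2]
    exact hW : W ∈ 𝓝 (sect dev y (dev y)))
  filter_upwards [h2, hW, hdev.continuous.continuousAt.eventually (U.isOpen_image.mem_nhds hyV)]
    with z hz1 hz2 hz3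
  obtain ⟨z', hz', hzz'⟩ := hz3
  have h3 := (U.sect_dev hdev hy hz')
  rw [hzz'] at h3
  have : sect dev y (dev z) = z := hinj hz1 hz2 (dev_sect h3.1)
  rw [← this, h3.2]
  exact hz'

theorem Subconic.closure_subset (U : Subconic dev) {x : X} (hx : x ∈ U.1) :
    closure (dev '' U.1) ⊆ visibleSet dev x :=
  closure_subset_visibleSet U.convex_image U.isOpen_image ⟨x, hx, rfl⟩ (U.image_subset hdev hx)

theorem Subconic.dist_limitPoint (U : Subconic dev) {x : X} (hx : x ∈ U.1) {v w : Plane}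
    (hv : v ∈ closure (dev '' U.1)) (hw : w ∈ closure (dev '' U.1)) :
    dist (limitPoint dev x v) (limitPoint dev x w) = dist v w :=
  TranslationConics.dist_limitPoint hdev U.convex_image U.isOpen_image ⟨x, hx, rfl⟩
    (U.image_subset hdev hx) hv hw

theorem Subconic.continuousOn_limitPoint (U : Subconic dev) {x : X} (hx : x ∈ U.1) :
    ContinuousOn (limitPoint dev x) (closure (dev '' U.1)) := by
  have : LipschitzOnWith 1 (limitPoint dev x) (closure (dev '' U.1)) :=
    LipschitzOnWith.of_dist_le_mul fun v hv w hw => by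
      rw [U.dist_limitPoint hdev hx hv hw]; simp
  exact this.continuousOn

theorem Subconic.injOn_limitPoint (U : Subconic dev) {x : X} (hx : x ∈ U.1) :
    InjOn (limitPoint dev x) (closure (dev '' U.1)) := fun v hv w hw h => by
  rw [← devExt_limitPoint hdev (U.closure_subset hdev hx hv), h,
    devExt_limitPoint hdev (U.closure_subset hdev hx hw)]

theorem Subconic.closure_eq (U : Subconic dev) {x : X} (hx : x ∈ U.1) :
    closure (((↑) : X → Completion X) '' U.1) = limitPoint dev x '' closure (dev '' U.1) := by
  have hcoe : ((↑) : X → Completion X) '' U.1 = limitPoint dev x '' (dev '' U.1) := by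
    rw [image_image]
    refine image_congr fun y hy => ?_
    rw [(limitPoint_of_mem hdev (U.sect_dev hdev hx hy).1).2, (U.sect_dev hdev hx hy).2]
  apply subset_antisymm
  · refine closure_minimal (hcoe.subset.trans (image_mono subset_closure)) ?_
    have hi : Isometry fun v : closure (dev '' U.1) => limitPoint dev x v :=
      Isometry.of_dist_eq fun v w => U.dist_limitPoint hdev hx v.2 w.2
    have : CompleteSpace (closure (dev '' U.1)) := isClosed_closure.completeSpace_coe
    have := hi.isClosedEmbedding.isClosed_range
    rwa [image_eq_range]
  · rw [hcoe]
    exact (U.continuousOn_limitPoint hdev hx).image_closure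

theorem Subconic.boundary_eq (U : Subconic dev) {x : X} (hx : x ∈ U.1) :
    U.boundary = limitPoint dev x '' frontier (dev '' U.1) := by
  have : LocallyCompactSpace X := ChartedSpace.locallyCompactSpace Plane X
  have hcoe : ((↑) : X → Completion X) '' U.1 = limitPoint dev x '' (dev '' U.1) := by
    rw [image_image]
    refine image_congr fun y hy => ?_
    rw [(limitPoint_of_mem hdev (U.sect_dev hdev hx hy).1).2, (U.sect_dev hdev hx hy).2]
  rw [Subconic.boundary, frontier,
    (isOpenEmbedding_coe_completion.isOpenMap _ (U.isOpen hdev)).interior_eq, U.closure_eq hdev hx,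
    hcoe, frontier, U.isOpen_image.interior_eq,
    ← (U.injOn_limitPoint hdev hx).image_diff_subset subset_closure]

theorem Subconic.frontier_subset_visibleSet (U : Subconic dev) {x : X} (hx : x ∈ U.1) :
    frontier (dev '' U.1) ⊆ visibleSet dev x :=
  frontier_subset_closure.trans (U.closure_subset hdev hx)

theorem Subconic.conePoints_eq (U : Subconic dev) {x : X} (hx : x ∈ U.1) :
    U.conePoints = limitPoint dev x '' (frontier (dev '' U.1) \ starDomain dev x) := by
  ext ξ
  rw [Subconic.conePoints, U.boundary_eq hdev hx]
  constructor
  · rintro ⟨⟨w, hw, rfl⟩, h⟩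
    exact ⟨w, ⟨hw, (limitPoint_mem_metricFrontier hdev
      (U.frontier_subset_visibleSet hdev hx hw)).1 h⟩, rfl⟩
  · rintro ⟨w, ⟨hw, h⟩, rfl⟩
    exact ⟨⟨w, hw, rfl⟩, (limitPoint_mem_metricFrontier hdev
      (U.frontier_subset_visibleSet hdev hx hw)).2 h⟩

theorem Subconic.devExt_image_boundary (U : Subconic dev) {x : X} (hx : x ∈ U.1) :
    devExt dev '' U.boundary = frontier (dev '' U.1) := by
  rw [U.boundary_eq hdev hx, image_image]
  refine (image_congr fun w hw => ?_).trans (image_id _)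
  exact devExt_limitPoint hdev (U.frontier_subset_visibleSet hdev hx hw)

theorem Subconic.devExt_image_conePoints (U : Subconic dev) {x : X} (hx : x ∈ U.1) :
    devExt dev '' U.conePoints = frontier (dev '' U.1) \ starDomain dev x := by
  rw [U.conePoints_eq hdev hx, image_image]
  refine (image_congr fun w hw => ?_).trans (image_id _)
  exact devExt_limitPoint hdev (U.frontier_subset_visibleSet hdev hx hw.1)

theorem Subconic.limitPoint_devExt (U : Subconic dev) {x : X} (hx : x ∈ U.1) {ξ : Completion X}
    (hξ : ξ ∈ U.boundary) : limitPoint dev x (devExt dev ξ) = ξ := by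
  rw [U.boundary_eq hdev hx] at hξ
  obtain ⟨w, hw, rfl⟩ := hξ
  rw [devExt_limitPoint hdev (U.frontier_subset_visibleSet hdev hx hw)]

end SubconicStructure

end TranslationConics
end

noncomputable section
namespace TranslationConics

section Quadrics

/-- The homogeneous part of degree `2` of a quadric. -/
def quadPart (c : Fin 6 → ℝ) (v : Plane) : ℝ :=
  c 0 * v 0 ^ 2 + c 1 * (v 0 * v 1) + c 2 * v 1 ^ 2

theorem quadric_lineMap (c : Fin 6 → ℝ) (p w : Plane) (t : ℝ) :
    quadric c (AffineMap.lineMap p w t) =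
      (1 - t) * quadric c p + t * quadric c w - t * (1 - t) * quadPart c (w - p) := by
  simp [quadric, quadPart, AffineMap.lineMap_apply_module]
  ring

theorem mem_closure_quadric_iff {c : Fin 6 → ℝ} {p w : Plane} (hp : quadric c p < 0) :
    w ∈ closure {x | quadric c x < 0} ↔ quadric c w ≤ 0 := by
  constructor
  · intro h
    have hsub : {x | quadric c x < 0} ⊆ {x | quadric c x ≤ 0} := 
      fun x (hx : quadric c x < 0) => show quadric c x ≤ 0 from hx.le
    exact closure_minimal hsub (isClosed_le (continuous_quadric c) continuous_const) h
  · intro h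
    rcases h.lt_or_eq with h | h
    · exact subset_closure h
    have key : ∀ t, quadric c (AffineMap.lineMap p w t) =
        (1 - t) * (quadric c p - t * quadPart c (w - p)) := fun t => by
      rw [quadric_lineMap, h]; ring
    have hl : Tendsto (fun t : ℝ => (AffineMap.lineMap p w t : Plane)) (𝓝 1) (𝓝 w) := by
      have := (AffineMap.lineMap_continuous (R := ℝ) (p := p) (q := w)).tendsto 1
      rwa [AffineMap.lineMap_apply_one] at this
    by_cases hQ : quadric c p - quadPart c (w - p) ≤ 0
    · refine mem_closure_of_tendsto (hl.mono_left (nhdsWithin_le_nhds (s := Iio 1))) ?_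
      filter_upwards [Ioo_mem_nhdsLT (zero_lt_one (α := ℝ))] with t ht
      refine (key t).trans_lt (mul_neg_of_pos_of_neg (by linarith [ht.2]) ?_)
      by_cases hq : 0 ≤ quadPart c (w - p)
      · nlinarith [ht.1]
      · nlinarith [ht.1, ht.2]
    · refine mem_closure_of_tendsto (hl.mono_left (nhdsWithin_le_nhds (s := Ioi 1))) ?_
      filter_upwards [self_mem_nhdsWithin] with t ht
      rw [mem_Ioi] at ht
      refine (key t).trans_lt (mul_neg_of_neg_of_pos (by linarith) ?_)
      nlinarith

end Quadrics

section SubconicTopology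

open UniformSpace

theorem isOpen_planarSubconic_exterior (p w : Plane) :
    IsOpen {W : PlanarSubconic | p ∈ W.1 ∧ w ∉ closure W.1} := by
  rw [isOpen_coinduced]
  have : NontrivialForm.toSubconic ⁻¹' {W : PlanarSubconic | p ∈ W.1 ∧ w ∉ closure W.1} =
      {q : NontrivialForm | q.1 ![p 0, p 1, 1] < 0 ∧ 0 < q.1 ![w 0, w 1, 1]} := by
    ext q
    obtain ⟨c, hc⟩ := exists_quadric_eq q.1
    have hq : planarSubconic q.1 = {x | quadric c x < 0} := by ext x; simp [planarSubconic, hc]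
    simp only [mem_preimage, mem_ofPred_eq, NontrivialForm.toSubconic, hq, hc]
    refine and_congr_right fun hp => ?_
    rw [mem_closure_quadric_iff hp, not_le]
  rw [this]
  have hcont : ∀ v : Fin 3 → ℝ, Continuous fun q : NontrivialForm => q.1 v := fun v =>
    (continuous_apply v).comp continuous_induced_dom
  exact (isOpen_lt (hcont _) continuous_const).inter (isOpen_lt continuous_const (hcont _))

variable {X : Type*} [MetricSpace X] {dev : X → Plane}

theorem isOpen_subconic_mem (x : X) : IsOpen {U : Subconic dev | x ∈ U.1} := by
  have h : IsOpen[TopologicalSpace.generateFrom {O | ∃ x : X, O = {U : Subconic dev | x ∈ U.1}}]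
      {U : Subconic dev | x ∈ U.1} := TopologicalSpace.isOpen_generateFrom_of_mem ⟨x, rfl⟩
  exact h.mono inf_le_right

theorem continuous_develop : Continuous (Subconic.develop : Subconic dev → PlanarSubconic) :=
  continuous_iff_le_induced.2 inf_le_left

theorem tendsto_subconic {W : ℝ → Subconic dev} {U : Subconic dev} {c h : Fin 6 → ℝ} {x : X}
    (hsect : ∀ y ∈ U.1, sect dev x (dev y) = y) (hU : dev '' U.1 = {v | quadric c v < 0})
    (hW : ∀ᶠ ε in 𝓝[>] (0 : ℝ), dev '' (W ε).1 = {v | quadric (c + ε • h) v < 0} ∧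
      ∀ y ∈ (W ε).1, sect dev x (dev y) = y) :
    Tendsto W (𝓝[>] 0) (𝓝 U) := by
  have hε : Tendsto (fun ε : ℝ => ε) (𝓝[>] 0) (𝓝 0) := tendsto_id.mono_left nhdsWithin_le_nhds
  have hnhds : 𝓝 U = @nhds _ (TopologicalSpace.induced Subconic.develop inferInstance) U ⊓
      @nhds _ (TopologicalSpace.generateFrom {O | ∃ x : X, O = {U : Subconic dev | x ∈ U.1}}) U :=
    nhds_inf (t₁ := TopologicalSpace.induced Subconic.develop inferInstance)
      (t₂ := TopologicalSpace.generateFrom {O | ∃ x : X, O = {U : Subconic dev | x ∈ U.1}}) (a := U)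
  rw [hnhds, tendsto_inf]
  constructor
  · classical
    rw [nhds_induced, tendsto_comap_iff]
    have hne : planarSubconic (formOfCoeffs c) ≠ univ := by
      rw [planarSubconic_formOfCoeffs, ← hU]
      obtain ⟨q, -, hq⟩ := U.2.2
      exact hq
    let q₀ : NontrivialForm := ⟨formOfCoeffs c, hne⟩
    have hind : IsInducing (fun (q : NontrivialForm) (v : Fin 3 → ℝ) => q.1 v) := ⟨rfl⟩
    let F : ℝ → NontrivialForm := fun ε =>
      if hh : planarSubconic (formOfCoeffs (c + ε • h)) ≠ univ then ⟨formOfCoeffs (c + ε • h), hh⟩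
      else q₀
    have hF : ∀ᶠ ε in 𝓝[>] (0 : ℝ), (F ε).1 = formOfCoeffs (c + ε • h) ∧
        NontrivialForm.toSubconic (F ε) = (W ε).develop := by
      filter_upwards [hW] with ε hε
      have h1 : planarSubconic (formOfCoeffs (c + ε • h)) ≠ univ := by
        rw [planarSubconic_formOfCoeffs, ← hε.1]
        obtain ⟨q, -, hq⟩ := (W ε).2.2
        exact hq
      have h2 : F ε = ⟨formOfCoeffs (c + ε • h), h1⟩ := dif_pos h1
      refine ⟨by rw [h2], ?_⟩
      rw [h2]
      apply Subtype.ext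
      change planarSubconic (formOfCoeffs (c + ε • h)) = dev '' (W ε).1
      rw [planarSubconic_formOfCoeffs, hε.1]
    have hlim : Tendsto F (𝓝[>] 0) (𝓝 q₀) := by
      rw [hind.tendsto_nhds_iff, tendsto_pi_nhds]
      intro v
      have : Tendsto (fun ε : ℝ => formOfCoeffs (c + ε • h) v) (𝓝[>] 0) (𝓝 (formOfCoeffs c v)) := by
        have hc : Continuous fun ε : ℝ => formOfCoeffs (c + ε • h) v := by
          simp only [formOfCoeffs_apply, Pi.add_apply, Pi.smul_apply, smul_eq_mul]
          fun_prop
        have := hc.tendsto 0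
        simp only [zero_smul, add_zero] at this
        exact this.mono_left nhdsWithin_le_nhds
      refine this.congr' ?_
      filter_upwards [hF] with ε hε
      simp [hε.1]
    have htc : Continuous NontrivialForm.toSubconic := continuous_coinduced_rng
    have h0 : NontrivialForm.toSubconic q₀ = U.develop := by
      apply Subtype.ext
      change planarSubconic (formOfCoeffs c) = dev '' U.1
      rw [planarSubconic_formOfCoeffs, hU]
    rw [← h0]
    refine ((htc.tendsto _).comp hlim).congr' ?_
    filter_upwards [hF] with ε hε using hε.2
  · rw [TopologicalSpace.tendsto_nhds_generateFrom_iff]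
    rintro _ ⟨y, rfl⟩ hy
    have hyV : quadric c (dev y) < 0 := hU.subset ⟨y, hy, rfl⟩
    have hc : Tendsto (fun ε : ℝ => quadric (c + ε • h) (dev y)) (𝓝[>] 0) (𝓝 (quadric c (dev y))) := by
      have hc : Continuous fun ε : ℝ => quadric (c + ε • h) (dev y) := by
        simp only [quadric, Pi.add_apply, Pi.smul_apply, smul_eq_mul]
        fun_prop
      have := hc.tendsto 0
      simp only [zero_smul, add_zero] at this
      exact this.mono_left nhdsWithin_le_nhds
    filter_upwards [hW, hc.eventually (Iio_mem_nhds hyV)] with ε h1 h2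
    have h3 : dev y ∈ dev '' (W ε).1 := by rw [h1.1]; exact h2
    obtain ⟨z, hz, hzy⟩ := h3
    have := h1.2 z hz
    rw [hzy, hsect y hy] at this
    change y ∈ (W ε).1
    rwa [this]

/-- A subconic in the closure of a cell meets all the points that define this cell. -/
theorem subset_conePoints_of_mem_closure [ChartedSpace Plane X] [TranslationSurface X]
    (hdev : IsDevelopingMap dev) {U : Subconic dev} (hU : U.1.Nonempty) {Z : Set (Completion X)}
    (h : U ∈ closure (cell dev Z)) : Z ⊆ U.conePoints := by
  obtain ⟨x, hx⟩ := hU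
  have hVD := U.image_subset hdev hx
  intro z hz
  rw [mem_closure_iff] at h
  obtain ⟨U', hxU', hU'⟩ := h _ (isOpen_subconic_mem x) hx
  have hz' : z ∈ U'.conePoints := by rw [hU'.1]; exact hz
  rw [U'.conePoints_eq hdev hxU'] at hz'
  obtain ⟨w, ⟨hw, hwD⟩, rfl⟩ := hz'
  have hwvis := U'.frontier_subset_visibleSet hdev hxU' hw
  rw [U.conePoints_eq hdev hx]
  refine ⟨w, ⟨?_, hwD⟩, rfl⟩
  rw [frontier, U.isOpen_image.interior_eq]
  refine ⟨?_, fun h => hwD (hVD h)⟩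
  by_contra hcl
  obtain ⟨U'', ⟨hU''1, hU''2⟩, hU''x⟩ := h _ (((isOpen_planarSubconic_exterior (dev x) w).preimage
    continuous_develop).inter (isOpen_subconic_mem x)) ⟨⟨⟨x, hx, rfl⟩, hcl⟩, hx⟩ |>.imp
      fun U'' h => (⟨⟨h.1.1, h.2⟩, h.1.2⟩ : (_ ∧ U'' ∈ cell dev Z) ∧ x ∈ U''.1)
  have hz'' : limitPoint dev x w ∈ U''.conePoints := by rw [hU''2.1]; exact hz
  have hf : devExt dev (limitPoint dev x w) ∈ frontier (dev '' U''.1) := by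
    rw [← U''.devExt_image_boundary hdev hU''x]
    exact ⟨_, hz''.1, rfl⟩
  rw [devExt_limitPoint hdev hwvis] at hf
  exact hU''1.2 (frontier_subset_closure hf)

end SubconicTopology

end TranslationConics
end

noncomputable section
namespace TranslationConics

section PositiveQuadrics

/-- The homogeneous part of degree `2` is positive definite. -/
def PosCoeffs (c : Fin 6 → ℝ) : Prop := 0 < c 0 ∧ c 1 ^ 2 < 4 * c 0 * c 2

theorem PosCoeffs.exists_le {c : Fin 6 → ℝ} (hc : PosCoeffs c) :
    ∃ μ > 0, ∀ v : Plane, μ * (v 0 ^ 2 + v 1 ^ 2) ≤ quadPart c v := by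
  obtain ⟨h0, h1⟩ := hc
  have h2 : 0 < c 2 := by
    by_contra h; nlinarith [sq_nonneg (c 1)]
  set δ := 4 * c 0 * c 2 - c 1 ^ 2 with hδ
  have hδ0 : 0 < δ := by linarith
  refine ⟨δ / (4 * (c 0 + c 2)), by positivity, fun v => ?_⟩
  rw [div_mul_eq_mul_div, div_le_iff₀ (by positivity)]
  simp only [quadPart]
  nlinarith [sq_nonneg (2 * c 0 * v 0 + c 1 * v 1), sq_nonneg (c 1 * v 0 + 2 * c 2 * v 1)]

theorem PosCoeffs.quadPart_nonneg {c : Fin 6 → ℝ} (hc : PosCoeffs c) (v : Plane) :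
    0 ≤ quadPart c v := by
  obtain ⟨μ, hμ, h⟩ := hc.exists_le
  exact le_trans (by positivity) (h v)

theorem PosCoeffs.exists_norm_le {c : Fin 6 → ℝ} (hc : PosCoeffs c) :
    ∃ R : ℝ, ∀ v : Plane, quadric c v ≤ 0 → ‖v‖ ≤ R := by
  obtain ⟨μ, hμ, h⟩ := hc.exists_le
  refine ⟨max 1 ((|c 3| + |c 4| + |c 5|) / μ), fun v hv => ?_⟩
  by_contra! hR
  rw [max_lt_iff, div_lt_iff₀ hμ] at hR
  have hn : ‖v‖ ^ 2 = v 0 ^ 2 + v 1 ^ 2 := by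
    rw [EuclideanSpace.norm_sq_eq]; simp
  have h0 : |v 0| ≤ ‖v‖ := abs_le_of_sq_le_sq (by nlinarith [sq_nonneg (v 1)]) (norm_nonneg v)
  have h1 : |v 1| ≤ ‖v‖ := abs_le_of_sq_le_sq (by nlinarith [sq_nonneg (v 0)]) (norm_nonneg v)
  have hq : quadric c v = quadPart c v + c 3 * v 0 + c 4 * v 1 + c 5 := rfl
  have h3 : -(|c 3| * ‖v‖) ≤ c 3 * v 0 := by
    have := neg_abs_le (c 3 * v 0)
    rw [abs_mul] at this
    nlinarith [mul_le_mul_of_nonneg_left h0 (abs_nonneg (c 3))]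
  have h4 : -(|c 4| * ‖v‖) ≤ c 4 * v 1 := by
    have := neg_abs_le (c 4 * v 1)
    rw [abs_mul] at this
    nlinarith [mul_le_mul_of_nonneg_left h1 (abs_nonneg (c 4))]
  have h5 := neg_abs_le (c 5)
  have h6 := h v
  rw [← hn] at h6
  nlinarith [mul_pos (sub_pos.2 hR.1) (norm_nonneg v |>.lt_of_ne (by linarith : (0:ℝ) ≠ ‖v‖)), abs_nonneg (c 5),
    mul_le_mul_of_nonneg_left hR.1.le (abs_nonneg (c 5))]

theorem PosCoeffs.isCompact {c : Fin 6 → ℝ} (hc : PosCoeffs c) :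
    IsCompact {v | quadric c v ≤ 0} := by
  obtain ⟨R, hR⟩ := hc.exists_norm_le
  refine Metric.isCompact_of_isClosed_isBounded (isClosed_le (continuous_quadric c) continuous_const) ?_
  refine (Metric.isBounded_closedBall (x := 0) (r := R)).subset fun v hv => ?_
  simpa using hR v hv

theorem PosCoeffs.ne_univ {c : Fin 6 → ℝ} (hc : PosCoeffs c) : {v | quadric c v < 0} ≠ univ := by
  obtain ⟨R, hR⟩ := hc.exists_norm_le
  intro h
  obtain ⟨v, hv⟩ := NormedSpace.exists_lt_norm ℝ Plane R
  have h1 : quadric c v < 0 := h.symm.subset (mem_univ v)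
  exact absurd (hR v h1.le) (not_le.2 hv)

theorem convex_quadric {c : Fin 6 → ℝ} (hc : ∀ v, 0 ≤ quadPart c v) :
    Convex ℝ {v | quadric c v < 0} := by
  intro p hp w hw a b ha hb hab
  obtain rfl : a = 1 - b := by linarith
  have := quadric_lineMap c p w b
  rw [AffineMap.lineMap_apply_module] at this
  simp only [mem_ofPred_eq] at *
  rw [this]
  have h1 : 0 ≤ b * (1 - b) * quadPart c (w - p) := mul_nonneg (mul_nonneg hb ha) (hc _)
  rcases hb.eq_or_lt with rfl | hb'
  · simpa using hp
  · nlinarith [mul_nonneg ha (neg_nonneg.2 hp.le), mul_pos hb' (neg_pos.2 hw)]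

theorem frontier_quadric {c : Fin 6 → ℝ} {p : Plane} (hp : quadric c p < 0) :
    frontier {v | quadric c v < 0} = {v | quadric c v = 0} := by
  ext w
  rw [frontier, (isOpen_lt (continuous_quadric c) continuous_const).interior_eq]
  exact ⟨fun h => le_antisymm ((mem_closure_quadric_iff hp).1 h.1) (not_lt.1 h.2),
    fun h => ⟨(mem_closure_quadric_iff hp).2 (le_of_eq h), fun h' => (ne_of_lt h') h⟩⟩

theorem quadric_add_smul (c h : Fin 6 → ℝ) (ε : ℝ) (v : Plane) :
    quadric (c + ε • h) v = quadric c v + ε * quadric h v := by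
  simp [quadric]; ring

end PositiveQuadrics

section Perturbation

open UniformSpace

variable {X : Type*} [MetricSpace X] [ChartedSpace Plane X] [TranslationSurface X] {dev : X → Plane}
  (hdev : IsDevelopingMap dev) (hX : DiscreteTopology (metricFrontier X))
include hdev hX

theorem eventually_exitSet_frontier {U : Subconic dev} {x : X} (hx : x ∈ U.1) {w : Plane}
    (hw : w ∈ frontier (dev '' U.1)) :
    ∀ᶠ v in 𝓝 w, v ∈ exitSet dev x → v ∈ frontier (dev '' U.1) := by
  by_cases hD : w ∈ starDomain dev x
  · filter_upwards [(isOpen_starDomain hdev.isLocalHomeomorph x).mem_nhds hD] with v hv h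
    exact absurd hv h.2
  · filter_upwards [exitSet_isolated hdev hX (x := x)
      ⟨U.frontier_subset_visibleSet hdev hx hw, hD⟩] with v hv h
    rwa [hv h]

/-- Deformations of a subconic in a pencil, towards ellipses that avoid its cone points. -/
theorem exists_perturbation {U : Subconic dev} {x : X} (hx : x ∈ U.1) {c h : Fin 6 → ℝ}
    (hU : dev '' U.1 = {v | quadric c v < 0})
    (hpos : ∀ᶠ ε in 𝓝[>] (0 : ℝ), PosCoeffs (c + ε • h))
    (hA : ∀ ξ ∈ U.conePoints, 0 ≤ quadric h (devExt dev ξ)) :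
    ∃ W : ℝ → Subconic dev, Tendsto W (𝓝[>] 0) (𝓝 U) ∧ ∀ᶠ ε in 𝓝[>] (0 : ℝ),
      dev '' (W ε).1 = {v | quadric (c + ε • h) v < 0} ∧ PosCoeffs (c + ε • h) ∧
      (W ε).1.Nonempty ∧ (W ε).conePoints = {ξ ∈ U.conePoints | quadric h (devExt dev ξ) = 0} := by
  classical
  set D := starDomain dev x with hD
  have hxV : quadric c (dev x) < 0 := hU.subset ⟨x, hx, rfl⟩
  have hVD : {v | quadric c v < 0} ⊆ D := hU ▸ U.image_subset hdev hx
  have hfr : frontier (dev '' U.1) = {v | quadric c v = 0} := by rw [hU, frontier_quadric hxV]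
  have hA' : ∀ w, quadric c w = 0 → w ∉ D → 0 ≤ quadric h w := by
    intro w hw hwD
    have : w ∈ devExt dev '' U.conePoints := by
      rw [U.devExt_image_conePoints hdev hx, hfr]; exact ⟨hw, hwD⟩
    obtain ⟨ξ, hξ, rfl⟩ := this
    exact hA ξ hξ
  obtain ⟨ε₀, hε₀, hpos₀⟩ : ∃ ε₀ > (0 : ℝ), ∀ ε : ℝ, 0 < ε → ε ≤ ε₀ → PosCoeffs (c + ε • h) := by
    obtain ⟨u, hu, h1⟩ := mem_nhdsGT_iff_exists_Ioc_subset.1 hpos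
    exact ⟨u, hu, fun ε h2 h3 => h1 ⟨h2, h3⟩⟩
  let O : Set Plane := {v | ∀ᶠ u in 𝓝 v, u ∈ exitSet dev x → quadric c u = 0}
  have hO : IsOpen O := isOpen_setOfPred_eventually_nhds
  have hfO : ∀ w, quadric c w = 0 → w ∈ O := by
    intro w hw
    have := eventually_exitSet_frontier hdev hX hx (w := w) (by rw [hfr]; exact hw)
    rw [hfr] at this
    exact this
  let F : Ioc (0 : ℝ) ε₀ → Set Plane := fun ε => {v | 0 ≤ quadric c v ∧ quadric (c + ε.1 • h) v ≤ 0}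
  have hFmono : ∀ ε ε' : Ioc (0 : ℝ) ε₀, ε.1 ≤ ε'.1 → F ε ⊆ F ε' := by
    rintro ε ε' hle v ⟨h1, h2⟩
    refine ⟨h1, ?_⟩
    rw [quadric_add_smul] at h2 ⊢
    have h3 : quadric h v ≤ 0 := by
      by_contra! hcon; nlinarith [mul_pos ε.2.1 hcon]
    nlinarith
  have hFclosed : ∀ ε, IsClosed (F ε) := fun ε =>
    (isClosed_le continuous_const (continuous_quadric c)).inter
      (isClosed_le (continuous_quadric _) continuous_const)
  have hFcompact : ∀ ε, IsCompact (F ε) := fun ε =>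
    (hpos₀ ε.1 ε.2.1 ε.2.2).isCompact.of_isClosed_subset (hFclosed ε) fun v hv => hv.2
  have : Nonempty (Ioc (0 : ℝ) ε₀) := ⟨⟨ε₀, hε₀, le_rfl⟩⟩
  obtain ⟨ε₁, hε₁⟩ : ∃ ε, F ε ⊆ O := by
    refine exists_subset_nhds_of_isCompact' ?_ hFcompact hFclosed fun v hv => hO.mem_nhds (hfO v ?_)
    · intro ε ε'
      rcases le_total ε.1 ε'.1 with hle | hle
      · exact ⟨ε, subset_rfl, hFmono _ _ hle⟩
      · exact ⟨ε', hFmono _ _ hle, subset_rfl⟩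
    · rw [mem_iInter] at hv
      have h1 : 0 ≤ quadric c v := (hv ⟨ε₀, hε₀, le_rfl⟩).1
      have hc : Tendsto (fun ε : ℝ => quadric c v + ε * quadric h v) (𝓝[>] 0)
          (𝓝 (quadric c v + 0 * quadric h v)) :=
        ((continuous_const.add (continuous_id.mul continuous_const)).tendsto 0).mono_left
          nhdsWithin_le_nhds
      have h2 := le_of_tendsto hc (b := 0) (by
        filter_upwards [Ioc_mem_nhdsGT hε₀] with ε hε
        rw [← quadric_add_smul]
        exact (hv ⟨ε, hε⟩).2)
      linarith
  have hexit : ∀ ε, 0 < ε → ε ≤ ε₁.1 → ∀ w ∈ exitSet dev x, quadric (c + ε • h) w ≤ 0 →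
      quadric c w = 0 := by
    intro ε h1 h2 w hw h3
    have h4 : 0 ≤ quadric c w := by
      by_contra! hcon; exact hw.2 (hVD hcon)
    have h5 : w ∈ O := hε₁ (hFmono ⟨ε, h1, h2.trans ε₁.2.2⟩ ε₁ h2 ⟨h4, h3⟩)
    exact h5.self_of_nhds hw
  have hex : ∀ᶠ ε in 𝓝[>] (0 : ℝ), ∃ W : Subconic dev, (x ∈ W.1 ∧
      dev '' W.1 = {v | quadric (c + ε • h) v < 0}) ∧ PosCoeffs (c + ε • h) ∧
      W.conePoints = {ξ ∈ U.conePoints | quadric h (devExt dev ξ) = 0} := by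
    have hcx : Tendsto (fun ε : ℝ => quadric c (dev x) + ε * quadric h (dev x)) (𝓝[>] 0)
          (𝓝 (quadric c (dev x) + 0 * quadric h (dev x))) :=
        ((continuous_const.add (continuous_id.mul continuous_const)).tendsto 0).mono_left
          nhdsWithin_le_nhds
    filter_upwards [Ioc_mem_nhdsGT ε₁.2.1, hcx.eventually (Iio_mem_nhds (by simpa using hxV))]
      with ε hε hxε
    rw [← quadric_add_smul] at hxε
    have hp := hpos₀ ε hε.1 (hε.2.trans ε₁.2.2)
    have hconv := convex_quadric hp.quadPart_nonneg
    have hsub : {v | quadric (c + ε • h) v < 0} ⊆ D := by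
      refine subset_starDomain_of_disjoint hdev (hconv.starConvex hxε) ?_
      rw [Set.disjoint_left]
      intro w hw hwe
      have hw' : quadric (c + ε • h) w < 0 := hw
      have h1 := hexit ε hε.1 hε.2 w hwe hw'.le
      have h2 := hA' w h1 hwe.2
      rw [quadric_add_smul, h1] at hw'
      nlinarith [mul_nonneg hε.1.le h2]
    obtain ⟨W, hxW, hW⟩ := exists_subconic hdev hconv hxε hsub
      ⟨formOfCoeffs (c + ε • h), (planarSubconic_formOfCoeffs _).symm, hp.ne_univ⟩
    refine ⟨W, ⟨hxW, hW⟩, hp, ?_⟩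
    have hWf : frontier (dev '' W.1) = {v | quadric (c + ε • h) v = 0} := by
      rw [hW, frontier_quadric hxε]
    ext ξ
    constructor
    · intro hξ
      rw [W.conePoints_eq hdev hxW] at hξ
      obtain ⟨w, ⟨hwf, hwD⟩, rfl⟩ := hξ
      have hwv := W.frontier_subset_visibleSet hdev hxW hwf
      rw [hWf] at hwf
      have h1 := hexit ε hε.1 hε.2 w ⟨hwv, hwD⟩ (le_of_eq hwf)
      refine ⟨?_, ?_⟩
      · rw [U.conePoints_eq hdev hx, hfr]
        exact ⟨w, ⟨h1, hwD⟩, rfl⟩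
      · rw [devExt_limitPoint hdev hwv]
        have h2 : quadric (c + ε • h) w = 0 := hwf
        rw [quadric_add_smul, h1, zero_add] at h2
        exact (mul_eq_zero.1 h2).resolve_left hε.1.ne'
    · rintro ⟨hξ, h0⟩
      rw [U.conePoints_eq hdev hx] at hξ
      obtain ⟨w, ⟨hwf, hwD⟩, rfl⟩ := hξ
      have hwv := U.frontier_subset_visibleSet hdev hx hwf
      rw [devExt_limitPoint hdev hwv] at h0
      rw [hfr] at hwf
      have h1 : quadric c w = 0 := hwf
      rw [W.conePoints_eq hdev hxW, hWf]
      refine ⟨w, ⟨?_, hwD⟩, rfl⟩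
      change quadric (c + ε • h) w = 0
      rw [quadric_add_smul, h1, h0]; ring
  let W : ℝ → Subconic dev := fun ε => if hh : ∃ W : Subconic dev, (x ∈ W.1 ∧
      dev '' W.1 = {v | quadric (c + ε • h) v < 0}) ∧ PosCoeffs (c + ε • h) ∧
      W.conePoints = {ξ ∈ U.conePoints | quadric h (devExt dev ξ) = 0} then hh.choose else U
  have hW : ∀ᶠ ε in 𝓝[>] (0 : ℝ), (x ∈ (W ε).1 ∧
      dev '' (W ε).1 = {v | quadric (c + ε • h) v < 0}) ∧ PosCoeffs (c + ε • h) ∧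
      (W ε).conePoints = {ξ ∈ U.conePoints | quadric h (devExt dev ξ) = 0} := by
    filter_upwards [hex] with ε hε
    have : W ε = hε.choose := dif_pos hε
    rw [this]
    exact hε.choose_spec
  refine ⟨W, tendsto_subconic (h := h) (fun y hy => (U.sect_dev hdev hx hy).2) hU ?_, ?_⟩
  · filter_upwards [hW] with ε hε
    exact ⟨hε.1.2, fun y hy => ((W ε).sect_dev hdev hε.1.1 hy).2⟩
  · filter_upwards [hW] with ε hε
    exact ⟨hε.1.2, hε.2.1, ⟨x, hε.1.1⟩, hε.2.2⟩

end Perturbation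

end TranslationConics
end

noncomputable section
namespace TranslationConics

section Frames

/-- The determinant of two vectors of the plane. -/
def cross (u v : Plane) : ℝ := u 0 * v 1 - u 1 * v 0

/-- An oriented affine frame of the plane. -/
structure Frame where
  /-- the origin -/
  o : Plane
  /-- the first vector -/
  a : Plane
  /-- the second vector -/
  b : Plane
  cross_pos : 0 < cross a b

namespace Frame

variable (F : Frame)

/-- The point with given coordinates. -/
def map (X Y : ℝ) : Plane := F.o + X • F.a + Y • F.b

/-- The first coordinate. -/
def fst (v : Plane) : ℝ := cross (v - F.o) F.b / cross F.a F.b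

/-- The second coordinate. -/
def snd (v : Plane) : ℝ := cross F.a (v - F.o) / cross F.a F.b

@[simp] theorem fst_map (X Y : ℝ) : F.fst (F.map X Y) = X := by
  have := F.cross_pos.ne'
  rw [fst, div_eq_iff this]
  simp [cross, map]; ring

@[simp] theorem snd_map (X Y : ℝ) : F.snd (F.map X Y) = Y := by
  have := F.cross_pos.ne'
  rw [snd, div_eq_iff this]
  simp [cross, map]; ring

@[simp] theorem map_coords (v : Plane) : F.map (F.fst v) (F.snd v) = v := by
  have := F.cross_pos.ne'
  ext i
  simp only [map, fst, snd, PiLp.add_apply, PiLp.smul_apply, smul_eq_mul]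
  rw [div_mul_eq_mul_div, div_mul_eq_mul_div, add_assoc, ← add_div, ← eq_sub_iff_add_eq', div_eq_iff this]
  fin_cases i <;> simp [cross] <;> ring

theorem exists_map (v : Plane) : ∃ X Y, F.map X Y = v := ⟨_, _, F.map_coords v⟩

theorem map_inj {X Y X' Y' : ℝ} : F.map X Y = F.map X' Y' ↔ X = X' ∧ Y = Y' := by
  constructor
  · intro h
    exact ⟨by simpa using congrArg F.fst h, by simpa using congrArg F.snd h⟩
  · rintro ⟨rfl, rfl⟩; rfl

theorem continuous_fst : Continuous F.fst := by
  unfold fst cross; fun_prop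

theorem continuous_snd : Continuous F.snd := by
  unfold snd cross; fun_prop

theorem continuous_map : Continuous fun q : ℝ × ℝ => F.map q.1 q.2 := by
  unfold map; fun_prop

theorem lineMap_map (X Y X' Y' t : ℝ) : AffineMap.lineMap (F.map X Y) (F.map X' Y') t =
    F.map ((1 - t) * X + t * X') ((1 - t) * Y + t * Y') := by
  rw [AffineMap.lineMap_apply_module]
  ext i; simp [map]; ring

theorem convex_setOf {S : ℝ → ℝ → Prop}
    (h : ∀ X Y X' Y' t, S X Y → S X' Y' → 0 ≤ t → t ≤ 1 →
      S ((1 - t) * X + t * X') ((1 - t) * Y + t * Y')) :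
    Convex ℝ {v | S (F.fst v) (F.snd v)} := by
  intro v hv w hw s t hs ht hst
  obtain rfl : s = 1 - t := by linarith
  have := F.lineMap_map (F.fst v) (F.snd v) (F.fst w) (F.snd w) t
  rw [map_coords, map_coords, AffineMap.lineMap_apply_module] at this
  rw [this]
  simpa using h _ _ _ _ t hv hw ht (by linarith)

/-- The frame that is rotated by a half turn. -/
def neg : Frame := ⟨F.o, -F.a, -F.b, by simpa [cross] using F.cross_pos⟩

theorem neg_map (X Y : ℝ) : F.neg.map X Y = F.map (-X) (-Y) := by simp [neg, map]

theorem exists_quadric (h : Fin 6 → ℝ) : ∃ c, ∀ X Y, quadric c (F.map X Y) = quadric h !₂[X, Y] := by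
  obtain ⟨p, p₀, p₁, hp⟩ : ∃ p p₀ p₁ : ℝ, ∀ v, F.fst v = p + p₀ * v 0 + p₁ * v 1 :=
    ⟨(F.o 1 * F.b 0 - F.o 0 * F.b 1) / cross F.a F.b, F.b 1 / cross F.a F.b,
      - F.b 0 / cross F.a F.b, fun v => by simp [fst, cross]; ring⟩
  obtain ⟨q, q₀, q₁, hq⟩ : ∃ p p₀ p₁ : ℝ, ∀ v, F.snd v = p + p₀ * v 0 + p₁ * v 1 :=
    ⟨(F.o 0 * F.a 1 - F.o 1 * F.a 0) / cross F.a F.b, - F.a 1 / cross F.a F.b,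
      F.a 0 / cross F.a F.b, fun v => by simp [snd, cross]; ring⟩
  refine ⟨![h 0 * p₀ ^ 2 + h 1 * p₀ * q₀ + h 2 * q₀ ^ 2,
    2 * h 0 * p₀ * p₁ + h 1 * (p₀ * q₁ + p₁ * q₀) + 2 * h 2 * q₀ * q₁,
    h 0 * p₁ ^ 2 + h 1 * p₁ * q₁ + h 2 * q₁ ^ 2,
    2 * h 0 * p * p₀ + h 1 * (p * q₀ + p₀ * q) + 2 * h 2 * q * q₀ + h 3 * p₀ + h 4 * q₀,
    2 * h 0 * p * p₁ + h 1 * (p * q₁ + p₁ * q) + 2 * h 2 * q * q₁ + h 3 * p₁ + h 4 * q₁,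
    h 0 * p ^ 2 + h 1 * p * q + h 2 * q ^ 2 + h 3 * p + h 4 * q + h 5], fun X Y => ?_⟩
  have h1 := hp (F.map X Y)
  have h2 := hq (F.map X Y)
  rw [fst_map] at h1
  rw [snd_map] at h2
  have h3 : quadric h !₂[X, Y] =
    h 0 * X ^ 2 + h 1 * (X * Y) + h 2 * Y ^ 2 + h 3 * X + h 4 * Y + h 5 := by simp [quadric]
  rw [h3]
  generalize F.map X Y = v at h1 h2
  rw [h1, h2]
  simp [quadric]
  ring

theorem exists_quadric_map (c : Fin 6 → ℝ) :
    ∃ h : Fin 6 → ℝ, (∀ X Y, quadric c (F.map X Y) = quadric h !₂[X, Y]) ∧ h 0 = quadPart c F.a := by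
  refine ⟨![quadPart c F.a, 2 * c 0 * F.a 0 * F.b 0 + c 1 * (F.a 0 * F.b 1 + F.a 1 * F.b 0) +
    2 * c 2 * F.a 1 * F.b 1, quadPart c F.b,
    2 * c 0 * F.o 0 * F.a 0 + c 1 * (F.o 0 * F.a 1 + F.o 1 * F.a 0) + 2 * c 2 * F.o 1 * F.a 1 +
      c 3 * F.a 0 + c 4 * F.a 1,
    2 * c 0 * F.o 0 * F.b 0 + c 1 * (F.o 0 * F.b 1 + F.o 1 * F.b 0) + 2 * c 2 * F.o 1 * F.b 1 +
      c 3 * F.b 0 + c 4 * F.b 1, quadric c F.o], fun X Y => ?_, rfl⟩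
  simp [quadric, quadPart, map]
  ring

end Frame

theorem posCoeffs_iff {c : Fin 6 → ℝ} : PosCoeffs c ↔ ∀ v : Plane, v ≠ 0 → 0 < quadPart c v := by
  constructor
  · intro hc v hv
    obtain ⟨μ, hμ, h⟩ := hc.exists_le
    refine lt_of_lt_of_le (mul_pos hμ ?_) (h v)
    rw [← Fin.sum_univ_two (fun i => v i ^ 2), ← EuclideanSpace.real_norm_sq_eq]
    positivity
  · intro h
    have h0 : 0 < c 0 := by
      have := h !₂[1, 0] (fun h => by simpa using congrArg (fun v : Plane => v 0) h)
      simpa [quadPart] using this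
    refine ⟨h0, ?_⟩
    have := h !₂[-c 1, 2 * c 0] (fun h => by
      have := congrArg (fun v : Plane => v 1) h
      simp at this; exact h0.ne' this)
    simp [quadPart] at this
    nlinarith

theorem quadPart_eq (c : Fin 6 → ℝ) (o v : Plane) :
    quadPart c v = (quadric c (o + v) + quadric c (o - v)) / 2 - quadric c o := by
  simp [quadric, quadPart]; ring

theorem Frame.posCoeffs (F : Frame) {c h : Fin 6 → ℝ}
    (hF : ∀ X Y, quadric c (F.map X Y) = quadric h !₂[X, Y]) (hh : PosCoeffs h) : PosCoeffs c := by
  rw [posCoeffs_iff] at *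
  intro v hv
  obtain ⟨X, Y, h1⟩ := F.exists_map (F.o + v)
  have h2 : F.o - v = F.map (-X) (-Y) := by
    rw [sub_eq_iff_eq_add', ← sub_eq_iff_eq_add, ← add_sub_cancel_left F.o v, ← h1]
    simp [Frame.map]; abel
  have h3 : F.o = F.map 0 0 := by simp [Frame.map]
  have h4 : !₂[X, Y] ≠ (0 : Plane) := by
    intro h
    have hX : X = 0 := by simpa using congrArg (fun v : Plane => v 0) h
    have hY : Y = 0 := by simpa using congrArg (fun v : Plane => v 1) h
    apply hv
    rw [hX, hY, ← h3] at h1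
    simpa using h1.symm
  have h5 := hh _ h4
  rw [quadPart_eq c F.o, ← h1, h2, h3, hF, hF, hF]
  refine h5.trans_eq ?_
  simp [quadric, quadPart]; ring

theorem Frame.quadPart_pos (F : Frame) {c : Fin 6 → ℝ} (hc : PosCoeffs c) : 0 < quadPart c F.a := by
  refine posCoeffs_iff.1 hc _ fun h => ?_
  have := F.cross_pos
  simp [cross, h] at this

end Frames

section LargeDiscs

/-- A quadric that tends to `-∞` in some direction bounds arbitrarily large discs. -/
theorem exists_ball_subset_quadric {c : Fin 6 → ℝ} {e : Plane}
    (he : quadPart c e < 0 ∨ (quadPart c e = 0 ∧ (∀ w, quadPart c (w + e) = quadPart c w) ∧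
      c 3 * e 0 + c 4 * e 1 < 0)) (R : ℝ) :
    ∃ w, Metric.ball w R ⊆ {v | quadric c v < 0} := by
  obtain ⟨B, hBc, hB⟩ : ∃ B : Plane → ℝ, Continuous B ∧ ∀ (t : ℝ) (v : Plane), quadric c (t • e + v) =
      t ^ 2 * quadPart c e + t * B v + quadric c v :=
    ⟨fun v => quadPart c (v + e) - quadPart c v - quadPart c e + (c 3 * e 0 + c 4 * e 1), by
      unfold quadPart; fun_prop, fun t v => by simp [quadric, quadPart]; ring⟩
  obtain ⟨M, hM⟩ := (isCompact_closedBall (0 : Plane) R).exists_bound_of_continuousOn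
    (continuous_quadric c).continuousOn
  obtain ⟨N, hN⟩ := (isCompact_closedBall (0 : Plane) R).exists_bound_of_continuousOn
    hBc.continuousOn
  have key : ∃ t : ℝ, ∀ v ∈ Metric.closedBall (0 : Plane) R, quadric c (t • e + v) < 0 := by
    rcases he with he | ⟨h0, h1, h2⟩
    · refine ⟨1 + (|N| + |M|) / (- quadPart c e), fun v hv => ?_⟩
      rw [hB]
      have h1 := (abs_le.1 (hM v hv)).2
      have h2 := (abs_le.1 (hN v hv)).2
      set k := (|N| + |M|) / (- quadPart c e) with hk
      have hk0 : 0 ≤ k := div_nonneg (by positivity) (by linarith)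
      have hk1 : k * quadPart c e = -(|N| + |M|) := by
        have := he.ne
        rw [hk]; field_simp
      have h3 := le_abs_self N
      have h4 := le_abs_self M
      have h5 : (1 + k) ^ 2 * quadPart c e = (1 + k) * (quadPart c e - (|N| + |M|)) := by
        linear_combination (1 + k) * hk1
      rw [h5]
      nlinarith [mul_nonneg hk0 (abs_nonneg M)]
    · set l := c 3 * e 0 + c 4 * e 1 with hl
      have hBl : ∀ v, B v = l := by
        intro v
        have h3 := hB 1 v
        have h4 : quadric c ((1 : ℝ) • e + v) = quadPart c (v + e) + (l + c 3 * v 0 + c 4 * v 1 + c 5) := by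
          simp [quadric, quadPart, hl]; ring
        rw [h4, h1, h0] at h3
        have h5 : quadric c v = quadPart c v + (c 3 * v 0 + c 4 * v 1 + c 5) := by
          simp [quadric, quadPart]; ring
        linarith
      refine ⟨(|M| + 1) / (-l), fun v hv => ?_⟩
      rw [hB, h0, hBl]
      have h3 := (abs_le.1 (hM v hv)).2
      have h4 := le_abs_self M
      have h5 : (|M| + 1) / (-l) * l = -(|M| + 1) := by
        have := h2.ne
        field_simp
      rw [h5]
      linarith
  obtain ⟨t, ht⟩ := key
  refine ⟨t • e, fun v hv => ?_⟩
  have := ht (v - t • e) (by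
    rw [mem_closedBall_zero_iff, ← dist_eq_norm]; exact (Metric.mem_ball.1 hv).le)
  simpa using this

/-- The nontrivial conic regions without large discs are the ellipses and the strips. -/
theorem exists_frame {c : Fin 6 → ℝ} {p : Plane} (hp : quadric c p < 0)
    (hne : {v | quadric c v < 0} ≠ univ) {R : ℝ}
    (hR : ∀ w r, Metric.ball w r ⊆ {v | quadric c v < 0} → r ≤ R) :
    ∃ (F : Frame) (k : ℝ), 0 < k ∧ ((∀ X Y, quadric c (F.map X Y) = k * (X ^ 2 + Y ^ 2 - 1)) ∨
      ∀ X Y, quadric c (F.map X Y) = k * (Y ^ 2 - 1)) := by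
  have hno : ∀ e : Plane, ¬ (quadPart c e < 0 ∨ (quadPart c e = 0 ∧
      (∀ w, quadPart c (w + e) = quadPart c w) ∧ c 3 * e 0 + c 4 * e 1 < 0)) := by
    intro e he
    obtain ⟨w, hw⟩ := exists_ball_subset_quadric he (R + 1)
    linarith [hR w _ hw]
  have hpsd : ∀ e, 0 ≤ quadPart c e := fun e => not_lt.1 fun h => hno e (Or.inl h)
  have hc0 : 0 ≤ c 0 := by simpa [quadPart] using hpsd !₂[1, 0]
  have hc2 : 0 ≤ c 2 := by simpa [quadPart] using hpsd !₂[0, 1]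
  by_cases hpos : PosCoeffs c
  · obtain ⟨h0, h1⟩ := hpos
    set d := (4 * c 0 * c 2 - c 1 ^ 2) / (4 * c 0) with hd
    have hd0 : 0 < d := div_pos (by linarith) (by linarith)
    have hd1 : d * (4 * c 0) = 4 * c 0 * c 2 - c 1 ^ 2 := by rw [hd]; field_simp
    set γ := (c 4 - c 1 * c 3 / (2 * c 0)) / (2 * d) with hγ
    have hγ1 : 2 * d * γ = c 4 - c 1 * c 3 / (2 * c 0) := by rw [hγ]; field_simp
    set α := c 1 / (2 * c 0) with hα
    set β := c 3 / (2 * c 0) with hβ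
    have hα1 : c 1 = α * (2 * c 0) := by rw [hα]; field_simp
    have hβ1 : c 3 = β * (2 * c 0) := by rw [hβ]; field_simp
    set e := c 5 - c 0 * β ^ 2 - d * γ ^ 2 with he
    have hc2' : c 2 = d + c 0 * α ^ 2 := by
      rw [hα1] at hd1
      have : 4 * c 0 * (c 2 - d - c 0 * α ^ 2) = 0 := by linear_combination -hd1
      rcases mul_eq_zero.1 this with h | h <;> linarith
    have hc4' : c 4 = 2 * d * γ + 2 * c 0 * α * β := by
      rw [hγ1, hα1, hβ1]; field_simp; ring
    have hquad : ∀ v : Plane, quadric c v = c 0 * (v 0 + α * v 1 + β) ^ 2 + d * (v 1 + γ) ^ 2 + e := by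
      intro v
      have h5 : c 5 = e + c 0 * β ^ 2 + d * γ ^ 2 := by rw [he]; ring
      simp only [quadric]
      rw [hc2', hc4', h5, hα1, hβ1]; ring
    have he0 : e < 0 := by
      have := hquad p
      nlinarith [mul_nonneg hc0 (sq_nonneg (p 0 + α * p 1 + β)), mul_nonneg hd0.le (sq_nonneg (p 1 + γ))]
    have hr0 : 0 < √(-e / c 0) := Real.sqrt_pos.2 (div_pos (by linarith) h0)
    have hr1 : 0 < √(-e / d) := Real.sqrt_pos.2 (div_pos (by linarith) hd0)
    have hs0 : c 0 * √(-e / c 0) ^ 2 = -e := by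
      rw [Real.sq_sqrt (div_pos (by linarith) h0).le]; field_simp
    have hs1 : d * √(-e / d) ^ 2 = -e := by
      rw [Real.sq_sqrt (div_pos (by linarith) hd0).le]; field_simp
    refine ⟨⟨!₂[α * γ - β, -γ], !₂[√(-e / c 0), 0], !₂[-α * √(-e / d), √(-e / d)], ?_⟩, -e,
      by linarith, Or.inl fun X Y => ?_⟩
    · simpa [cross] using mul_pos hr0 hr1
    · rw [hquad]
      simp [Frame.map]
      linear_combination X ^ 2 * hs0 + Y ^ 2 * hs1
  · obtain ⟨α, β, h⟩ : ∃ α β : ℝ, ∀ v : Plane, quadPart c v = (α * v 0 + β * v 1) ^ 2 := by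
      rcases hc0.eq_or_lt with h0 | h0
      · have h1 : c 1 = 0 := by
          by_contra h1
          have h2 := hpsd !₂[-(c 2 + 1) / c 1, 1]
          have h3 : c 1 * (-(c 2 + 1) / c 1) = -(c 2 + 1) := by field_simp
          have h4 : quadPart c !₂[-(c 2 + 1) / c 1, 1] = c 1 * (-(c 2 + 1) / c 1) + c 2 := by
            simp [quadPart, ← h0]
          linarith
        refine ⟨0, √(c 2), fun v => ?_⟩
        simp only [quadPart]
        rw [← h0, h1]
        linear_combination (-v 1 ^ 2) * Real.sq_sqrt hc2
      · have h1 : c 1 ^ 2 = 4 * c 0 * c 2 := by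
          refine le_antisymm ?_ (not_lt.1 fun h => hpos ⟨h0, h⟩)
          have := hpsd !₂[-c 1, 2 * c 0]
          simp [quadPart] at this
          nlinarith
        have hs := Real.sq_sqrt hc0
        have hs0 := Real.sqrt_pos.2 h0
        refine ⟨√(c 0), c 1 / (2 * √(c 0)), fun v => ?_⟩
        have h2 : √(c 0) * (c 1 / (2 * √(c 0))) = c 1 / 2 := by field_simp
        have h3 : (c 1 / (2 * √(c 0))) ^ 2 = c 2 := by
          rw [div_pow, mul_pow, hs, h1]; field_simp; ring
        simp only [quadPart]
        linear_combination (-v 0 ^ 2) * hs - 2 * v 0 * v 1 * h2 - v 1 ^ 2 * h3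
    have hker : ∀ e : Plane, α * e 0 + β * e 1 = 0 → c 3 * e 0 + c 4 * e 1 = 0 := by
      intro e he
      have key : ∀ e : Plane, α * e 0 + β * e 1 = 0 → 0 ≤ c 3 * e 0 + c 4 * e 1 := by
        intro e he
        refine not_lt.1 fun hlt => hno e (Or.inr ⟨by rw [h, he]; ring, fun w => ?_, hlt⟩)
        rw [h, h]
        simp only [PiLp.add_apply]
        congr 1
        linear_combination he
      refine le_antisymm ?_ (key e he)
      have := key (-e) (by simp; linarith)
      simp at this; linarith
    by_cases hn : α ^ 2 + β ^ 2 = 0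
    · exfalso
      have hα : α = 0 := by nlinarith [sq_nonneg α, sq_nonneg β]
      have hβ : β = 0 := by nlinarith [sq_nonneg α, sq_nonneg β]
      have h3 : c 3 = 0 := by simpa using hker !₂[1, 0] (by simp [hα])
      have h4 : c 4 = 0 := by simpa using hker !₂[0, 1] (by simp [hβ])
      have hconst : ∀ v, quadric c v = c 5 := by
        intro v
        have : quadric c v = quadPart c v + c 3 * v 0 + c 4 * v 1 + c 5 := rfl
        rw [this, h, hα, hβ, h3, h4]; ring
      refine hne (eq_univ_of_forall fun v => ?_)
      change quadric c v < 0
      rw [hconst] at hp ⊢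
      exact hp
    · have hn0 : 0 < α ^ 2 + β ^ 2 := lt_of_le_of_ne (by positivity) (Ne.symm hn)
      set N := α ^ 2 + β ^ 2 with hN
      set μ := (c 3 * α + c 4 * β) / (2 * N) with hμ
      have hμN : 2 * N * μ = c 3 * α + c 4 * β := by rw [hμ]; field_simp
      have hk := hker !₂[-β, α] (by simp; ring)
      simp at hk
      have h3 : c 3 = 2 * μ * α := by
        have : N * (c 3 - 2 * μ * α) = 0 := by
          rw [hN] at hμN ⊢; linear_combination -α * hμN - β * hk
        have := (mul_eq_zero.1 this).resolve_left hn0.ne'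
        linarith
      have h4 : c 4 = 2 * μ * β := by
        have : N * (c 4 - 2 * μ * β) = 0 := by
          rw [hN] at hμN ⊢; linear_combination -β * hμN + α * hk
        have := (mul_eq_zero.1 this).resolve_left hn0.ne'
        linarith
      set s := μ ^ 2 - c 5 with hs
      have hquad : ∀ v : Plane, quadric c v = (α * v 0 + β * v 1 + μ) ^ 2 - s := by
        intro v
        have : quadric c v = quadPart c v + c 3 * v 0 + c 4 * v 1 + c 5 := rfl
        rw [this, h, h3, h4, hs]; ring
      have hs0 : 0 < s := by
        have := hquad p
        nlinarith [sq_nonneg (α * p 0 + β * p 1 + μ)]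
      have hr := Real.sqrt_pos.2 hs0
      have hr2 := Real.sq_sqrt hs0.le
      refine ⟨⟨!₂[-μ * α / N, -μ * β / N], !₂[β, -α], !₂[√s * α / N, √s * β / N], ?_⟩, s, hs0,
        Or.inr fun X Y => ?_⟩
      · have : cross !₂[β, -α] !₂[√s * α / N, √s * β / N] = √s := by
          simp [cross]; field_simp; rw [hN]; ring
        rw [this]; exact hr
      · rw [hquad]
        simp [Frame.map]
        have h5 : α * (-(μ * α) / N + X * β + Y * (√s * α / N)) +
            β * (-(μ * β) / N + -(X * α) + Y * (√s * β / N)) + μ = Y * √s := by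
          field_simp; rw [hN]; ring
        rw [h5, mul_pow, hr2]; ring

end LargeDiscs

end TranslationConics
end

noncomputable section
namespace TranslationConics

section Bands

namespace Frame

variable (F : Frame)

/-- The strip between two lines that are parallel to the first axis. -/
def band (s t : ℝ) : Set Plane := {v | s < F.snd v ∧ F.snd v < t}

theorem convex_band (s t : ℝ) : Convex ℝ (F.band s t) := by
  refine F.convex_setOf (S := fun _ Y => s < Y ∧ Y < t) fun X Y X' Y' r h h' h0 h1 => ⟨?_, ?_⟩
  · rcases h0.eq_or_lt with rfl | h0
    · simpa using h.1
    · nlinarith [mul_nonneg (sub_nonneg.2 h1) (sub_nonneg.2 h.1.le), mul_pos h0 (sub_pos.2 h'.1)]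
  · rcases h0.eq_or_lt with rfl | h0
    · simpa using h.2
    · nlinarith [mul_nonneg (sub_nonneg.2 h1) (sub_nonneg.2 h.2.le), mul_pos h0 (sub_pos.2 h'.2)]

theorem map_mem_band {s t X Y : ℝ} : F.map X Y ∈ F.band s t ↔ s < Y ∧ Y < t := by
  simp [band]

theorem band_eq_planarSubconic {s t : ℝ} (hst : s < t) :
    ∃ q, F.band s t = planarSubconic q ∧ F.band s t ≠ univ := by
  obtain ⟨c, hc⟩ := F.exists_quadric ![0, 0, 1, 0, -(s + t), s * t]
  refine ⟨formOfCoeffs c, ?_, fun h => ?_⟩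
  · rw [planarSubconic_formOfCoeffs]
    ext v
    obtain ⟨X, Y, rfl⟩ := F.exists_map v
    rw [map_mem_band, mem_ofPred_eq, hc]
    have : quadric ![0, 0, 1, 0, -(s + t), s * t] !₂[X, Y] = (Y - s) * (Y - t) := by
      simp [quadric]; ring
    rw [this, mul_neg_iff]
    constructor
    · rintro ⟨h1, h2⟩
      exact Or.inl ⟨by linarith, by linarith⟩
    · rintro (⟨h1, h2⟩ | ⟨h1, h2⟩)
      · exact ⟨by linarith, by linarith⟩
      · linarith
  · have := h.symm.subset (mem_univ (F.map 0 t))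
    rw [map_mem_band] at this
    exact lt_irrefl _ this.2

theorem isPlanarStrip_band {s t : ℝ} (hst : s < t) : IsPlanarStrip (F.band s t) := by
  have hD := F.cross_pos
  refine ⟨!₂[-F.a 1, F.a 0], s * cross F.a F.b + cross F.a F.o, t * cross F.a F.b + cross F.a F.o,
    fun h => ?_, by nlinarith, ?_⟩
  · have h1 : F.a 1 = 0 := by simpa using congrArg (fun v : Plane => v 0) h
    have h0 : F.a 0 = 0 := by simpa using congrArg (fun v : Plane => v 1) h
    simp [cross, h0, h1] at hD
  · ext v
    have h1 : F.snd v * cross F.a F.b = cross F.a (v - F.o) := by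
      rw [snd]; field_simp
    have h2 : inner ℝ !₂[-F.a 1, F.a 0] v = F.snd v * cross F.a F.b + cross F.a F.o := by
      rw [h1]; simp [PiLp.inner_apply, cross]; ring
    simp only [band, mem_ofPred_eq, h2]
    rw [add_lt_add_iff_right, add_lt_add_iff_right, mul_lt_mul_iff_left₀ hD, mul_lt_mul_iff_left₀ hD]

theorem exists_delta {ε : ℝ} (hε : 0 < ε) :
    ∃ δ > (0 : ℝ), ∀ v w, dist v w < δ → |F.fst v - F.fst w| < ε ∧ |F.snd v - F.snd w| < ε := by
  have h1 : Tendsto (fun u : Plane => cross u F.b / cross F.a F.b) (𝓝 0) (𝓝 0) := by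
    have : Continuous (fun u : Plane => cross u F.b / cross F.a F.b) := by unfold cross; fun_prop
    have h := this.tendsto 0
    simpa [cross] using h
  have h2 : Tendsto (fun u : Plane => cross F.a u / cross F.a F.b) (𝓝 0) (𝓝 0) := by
    have : Continuous (fun u : Plane => cross F.a u / cross F.a F.b) := by unfold cross; fun_prop
    have h := this.tendsto 0
    simpa [cross] using h
  obtain ⟨δ, hδ, h⟩ := Metric.eventually_nhds_iff.1
    ((h1.eventually (Metric.ball_mem_nhds 0 hε)).and (h2.eventually (Metric.ball_mem_nhds 0 hε)))
  refine ⟨δ, hδ, fun v w hvw => ?_⟩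
  have h3 := h (y := v - w) (by rwa [dist_zero_right, ← dist_eq_norm])
  simp only [Real.dist_eq, sub_zero] at h3
  have h4 : F.fst v - F.fst w = cross (v - w) F.b / cross F.a F.b := by
    simp [fst, cross]; ring
  have h5 : F.snd v - F.snd w = cross F.a (v - w) / cross F.a F.b := by
    simp [snd, cross]; ring
  rw [h4, h5]; exact h3

end Frame

theorem IsPlanarStrip.exists_frame {V : Set Plane} (hV : IsPlanarStrip V) :
    ∃ F : Frame, V = F.band (-1) 1 := by
  obtain ⟨u, s, t, hu, hst, rfl⟩ := hV
  set N := u 0 ^ 2 + u 1 ^ 2 with hN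
  have hN0 : 0 < N := by
    rw [hN, ← Fin.sum_univ_two (fun i => u i ^ 2), ← EuclideanSpace.real_norm_sq_eq]
    positivity
  have hst' : 0 < (t - s) / 2 := by linarith
  have hcr : cross !₂[u 1, -u 0] (((t - s) / 2 / N) • u) = (t - s) / 2 := by
    simp [cross]; field_simp; rw [hN]; ring
  refine ⟨⟨((s + t) / 2 / N) • u, !₂[u 1, -u 0], ((t - s) / 2 / N) • u, by rw [hcr]; exact hst'⟩, ?_⟩
  ext v
  have h1 : inner ℝ u v = u 0 * v 0 + u 1 * v 1 := by simp [PiLp.inner_apply]; ring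
  have h2 : cross !₂[u 1, -u 0] (v - ((s + t) / 2 / N) • u) = u 0 * v 0 + u 1 * v 1 - (s + t) / 2 := by
    simp [cross]; field_simp; rw [hN]; ring
  simp only [Frame.band, Frame.snd, mem_ofPred_eq, hcr, h2, h1]
  rw [lt_div_iff₀ hst', div_lt_iff₀ hst']
  constructor <;> rintro ⟨h3, h4⟩ <;> constructor <;> linarith

end Bands

open UniformSpace

/-- `U` develops onto the ellipse that is the unit disc in the frame `F`. -/
def Subconic.IsEllipseIn {X : Type*} [MetricSpace X] {dev : X → Plane} (U : Subconic dev)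
    (c : Fin 6 → ℝ) (F : Frame) : Prop :=
  dev '' U.1 = {v | quadric c v < 0} ∧ ∀ X Y, quadric c (F.map X Y) = X ^ 2 + Y ^ 2 - 1

/-- `U` develops onto the standard strip in the frame `F`. -/
def Subconic.IsBandIn {X : Type*} [MetricSpace X] {dev : X → Plane} (U : Subconic dev)
    (c : Fin 6 → ℝ) (F : Frame) : Prop :=
  dev '' U.1 = {v | quadric c v < 0} ∧ ∀ X Y, quadric c (F.map X Y) = Y ^ 2 - 1

/-- The set of developed images of cone points on the boundary. -/
def Subconic.marks {X : Type*} [MetricSpace X] {dev : X → Plane} (U : Subconic dev) : Set Plane :=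
  devExt dev '' U.conePoints

section Surface

variable {Y X : Type*} [MetricSpace Y] [ChartedSpace Plane Y] [TranslationSurface Y]
  [MetricSpace X] [ChartedSpace Plane X] [TranslationSurface X]

theorem exists_ball_bound (hY : TotallyBounded (Set.univ : Set Y))
    (hYne : (metricFrontier Y).Nonempty) {p : X → Y} (hp : IsCoveringMap p) (hpt : IsTranslationMap p)
    {dev : X → Plane} (hdev : IsDevelopingMap dev) :
    ∃ R : ℝ, ∀ x r, Metric.ball (dev x) r ⊆ starDomain dev x → r ≤ R := by
  obtain ⟨R, hR⟩ := Metric.isBounded_iff.1 hY.isBounded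
  refine ⟨R, fun x r hr => ?_⟩
  by_contra! hlt
  obtain ⟨r', hr', hr'r⟩ := exists_between hlt
  have hK : IsCompact (Metric.closedBall (dev x) r') := isCompact_closedBall _ _
  have hsub : Metric.closedBall (dev x) r' ⊆ starDomain dev x :=
    (Metric.closedBall_subset_ball hr'r).trans hr
  have himg := hK.image_of_continuousOn
    (hp.continuous.comp_continuousOn ((continuousOn_sect hdev.isLocalHomeomorph x).mono hsub))
  have huniv : (p ∘ sect dev x) '' Metric.closedBall (dev x) r' = univ := by
    refine eq_univ_of_forall fun y => ?_
    obtain ⟨x', h1, h2⟩ := exists_lift_of_dist_lt hp hpt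
      ((hR (mem_univ (p x)) (mem_univ y)).trans_lt hr')
    obtain ⟨h3, h4⟩ := eq_sect_of_dist_lt hdev ((Metric.ball_subset_ball hr'r.le).trans hr) h1
    exact ⟨dev x', Metric.ball_subset_closedBall h3, by simp [h4, h2]⟩
  rw [huniv] at himg
  have hcl : IsClosed (range ((↑) : Y → Completion Y)) := by
    rw [← image_univ]
    exact (himg.image (Completion.continuous_coe Y)).isClosed
  obtain ⟨ξ, hξ⟩ := hYne
  refine hξ ?_
  rw [← hcl.closure_eq]
  exact Completion.denseRange_coe ξ

variable {dev : X → Plane} (hdev : IsDevelopingMap dev)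
include hdev

theorem Subconic.exists_frame (hY : TotallyBounded (Set.univ : Set Y))
    (hYne : (metricFrontier Y).Nonempty) {p : X → Y} (hp : IsCoveringMap p) (hpt : IsTranslationMap p)
    (U : Subconic dev) (hU : U.1.Nonempty) :
    ∃ c F, U.IsEllipseIn c F ∨ U.IsBandIn c F := by
  obtain ⟨q, hq, hne⟩ := U.2.2
  obtain ⟨c, hc⟩ := exists_planarSubconic_eq q
  rw [hc] at hq
  obtain ⟨R, hR⟩ := exists_ball_bound hY hYne hp hpt hdev
  obtain ⟨x, hx⟩ := hU
  have hxV : quadric c (dev x) < 0 := hq.subset ⟨x, hx, rfl⟩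
  obtain ⟨F, k, hk, h⟩ := TranslationConics.exists_frame (c := c) hxV (hq ▸ hne) (R := R) fun w r hw => by
    rcases le_or_gt r 0 with h | h
    · refine h.trans ?_
      by_contra! hcon
      have := hR x 0 (by simp)
      linarith
    · obtain ⟨y, hy, rfl⟩ := hq.symm.subset (hw (Metric.mem_ball_self h))
      exact hR y r (hw.trans (hq ▸ U.image_subset hdev hy))
  have hq' : dev '' U.1 = {v | quadric (k⁻¹ • c) v < 0} := by
    rw [hq]
    ext v
    have : quadric (k⁻¹ • c) v = k⁻¹ * quadric c v := by simp [quadric]; ring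
    simp only [mem_ofPred_eq, this, mul_neg_iff, inv_pos, hk, true_and, inv_lt_zero, hk.not_gt, false_and,
      or_false]
  have hs : ∀ v, quadric (k⁻¹ • c) v = k⁻¹ * quadric c v := fun v => by simp [quadric]; ring
  refine ⟨k⁻¹ • c, F, h.imp (fun h => ⟨hq', fun X Y => ?_⟩) fun h => ⟨hq', fun X Y => ?_⟩⟩ <;>
  · rw [hs, h]; field_simp

omit [ChartedSpace Plane X] [TranslationSurface X] hdev in
theorem Subconic.IsBandIn.image_eq {U : Subconic dev} {c : Fin 6 → ℝ} {F : Frame}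
    (h : U.IsBandIn c F) : dev '' U.1 = F.band (-1) 1 := by
  rw [h.1]
  ext v
  obtain ⟨X, Y, rfl⟩ := F.exists_map v
  rw [mem_ofPred_eq, h.2, F.map_mem_band, ← abs_lt, sub_neg, sq_lt_one_iff_abs_lt_one]

omit [ChartedSpace Plane X] [TranslationSurface X] hdev in
theorem Subconic.IsBandIn.neg {U : Subconic dev} {c : Fin 6 → ℝ} {F : Frame}
    (h : U.IsBandIn c F) : U.IsBandIn c F.neg :=
  ⟨h.1, fun X Y => by rw [F.neg_map, h.2]; ring⟩

omit [ChartedSpace Plane X] [TranslationSurface X] hdev in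
theorem Subconic.IsBandIn.frontier_eq {U : Subconic dev} {c : Fin 6 → ℝ} {F : Frame}
    (h : U.IsBandIn c F) : frontier (dev '' U.1) = {v | F.snd v = 1 ∨ F.snd v = -1} := by
  rw [h.1, frontier_quadric (p := F.map 0 0) (by rw [h.2]; norm_num)]
  ext v
  obtain ⟨X, Y, rfl⟩ := F.exists_map v
  rw [mem_ofPred_eq, mem_ofPred_eq, h.2, F.snd_map]
  constructor
  · intro h
    have : (Y - 1) * (Y + 1) = 0 := by linear_combination h
    rcases mul_eq_zero.1 this with h | h
    · exact Or.inl (by linarith)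
    · exact Or.inr (by linarith)
  · rintro (rfl | rfl) <;> norm_num

omit [ChartedSpace Plane X] [TranslationSurface X] hdev in
theorem Subconic.IsStrip.exists_band {U : Subconic dev} (h : U.IsStrip) :
    ∃ c F, U.IsBandIn c F := by
  obtain ⟨F, hF⟩ := IsPlanarStrip.exists_frame h
  obtain ⟨c, hc⟩ := F.exists_quadric ![0, 0, 1, 0, 0, -1]
  have hc' : ∀ X Y, quadric c (F.map X Y) = Y ^ 2 - 1 := fun X Y => by
    rw [hc]; simp [quadric]; ring
  refine ⟨c, F, ?_, hc'⟩
  rw [hF]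
  ext v
  obtain ⟨X, Y, rfl⟩ := F.exists_map v
  rw [mem_ofPred_eq, hc', F.map_mem_band, ← abs_lt, sub_neg, sq_lt_one_iff_abs_lt_one]

theorem Subconic.mem_marks {U : Subconic dev} {x : X} (hx : x ∈ U.1) {v : Plane} :
    v ∈ U.marks ↔ v ∈ frontier (dev '' U.1) ∧ v ∉ starDomain dev x := by
  rw [marks, U.devExt_image_conePoints hdev hx]; rfl

/-- Translation along the first axis by `Q` maps `U` to itself, over the identity of `Y`. -/
def Subconic.HasPeriod (U : Subconic dev) (p : X → Y) (F : Frame) (Q : ℝ) : Prop :=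
  ∀ z ∈ U.1, (∃ z' ∈ U.1, p z = p z' ∧ dev z' = dev z + Q • F.a) ∧
    ∃ z' ∈ U.1, p z = p z' ∧ dev z' = dev z - Q • F.a

section Strip

variable {U : Subconic dev} {c : Fin 6 → ℝ} {F : Frame} (hU : U.IsBandIn c F)
include hU

/-- The strip is not contained in a larger star-shaped strip. -/
def Subconic.IsTight (U : Subconic dev) (F : Frame) : Prop :=
  ∀ y ∈ U.1, ∀ s t, s ≤ -1 → 1 ≤ t → F.band s t ⊆ starDomain dev y → s = -1 ∧ t = 1

omit [ChartedSpace Plane X] [TranslationSurface X] hdev hU in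
theorem Subconic.IsTight.neg (h : U.IsTight F) : U.IsTight F.neg := by
  intro y hy s t hs ht hst
  have hsnd : ∀ v, F.neg.snd v = - F.snd v := by
    intro v
    obtain ⟨X, Y, rfl⟩ := F.neg.exists_map v
    rw [F.neg.snd_map, F.neg_map, F.snd_map, neg_neg]
  have := h y hy (-t) (-s) (by linarith) (by linarith) (Subset.trans (fun v hv => ?_) hst)
  · exact ⟨by linarith [this.2], by linarith [this.1]⟩
  · refine ⟨?_, ?_⟩ <;> rw [hsnd] <;> linarith [hv.1, hv.2]

theorem Subconic.isTight_of_isMaximalStrip (hm : U.IsMaximalStrip) : U.IsTight F := by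
  intro y hy s t hs ht hst
  have hyb : dev y ∈ F.band (-1) 1 := hU.image_eq ▸ ⟨y, hy, rfl⟩
  obtain ⟨W, hyW, hW⟩ := exists_subconic hdev (F.convex_band s t)
    ⟨by linarith [hyb.1], by linarith [hyb.2]⟩ hst (F.band_eq_planarSubconic (by linarith))
  have h1 : W = U := by
    refine hm.2 W (by rw [IsStrip, hW]; exact F.isPlanarStrip_band (by linarith)) ?_
    rw [U.eq_image hdev hy, W.eq_image hdev hyW]
    refine image_mono ?_
    rw [hU.image_eq, hW]
    exact fun v hv => ⟨by linarith [hv.1], by linarith [hv.2]⟩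
  rw [h1, hU.image_eq] at hW
  constructor
  · by_contra hne
    have : F.map 0 (-1) ∈ F.band (-1) 1 := hW ▸ (F.map_mem_band).2 ⟨lt_of_le_of_ne hs hne, by linarith⟩
    exact lt_irrefl _ (F.map_mem_band.1 this).1
  · by_contra hne
    have : F.map 0 1 ∈ F.band (-1) 1 :=
      hW ▸ (F.map_mem_band).2 ⟨by linarith, lt_of_le_of_ne ht (Ne.symm hne)⟩
    exact lt_irrefl _ (F.map_mem_band.1 this).2

omit hU in
theorem Subconic.isTight_of_marks (h1 : ∃ X, F.map X 1 ∈ U.marks) (h2 : ∃ X, F.map X (-1) ∈ U.marks) :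
    U.IsTight F := by
  intro y hy s t hs ht hst
  obtain ⟨X₁, h1⟩ := h1
  obtain ⟨X₂, h2⟩ := h2
  rw [mem_marks hdev hy] at h1 h2
  constructor
  · by_contra hne
    exact h2.2 (hst (F.map_mem_band.2 ⟨lt_of_le_of_ne hs hne, by linarith⟩))
  · by_contra hne
    exact h1.2 (hst (F.map_mem_band.2 ⟨by linarith, lt_of_le_of_ne ht (Ne.symm hne)⟩))

variable (hY : TotallyBounded (Set.univ : Set Y)) {p : X → Y} (hp : IsCoveringMap p)
  (hpt : IsTranslationMap p)
include hY hp hpt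

theorem Subconic.exists_almost_period : ∃ y ∈ U.1, ∃ y' ∈ U.1, p y = p y' ∧
    F.fst (dev y) < F.fst (dev y') ∧ |F.snd (dev y) - F.snd (dev y')| < 1 := by
  obtain ⟨δ, hδ, h⟩ := F.exists_delta (ε := 1 / 2) (by norm_num)
  have hn : ∀ n : ℕ, ∃ y ∈ U.1, dev y = F.map n 0 := by
    intro n
    have : F.map n 0 ∈ dev '' U.1 := by
      rw [hU.image_eq, F.map_mem_band]; norm_num
    exact this
  choose y hyU hy using hn
  obtain ⟨t, ht, hcov⟩ := Metric.totallyBounded_iff.1 hY (δ / 2) (by linarith)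
  have hc : ∀ n, ∃ z : t, dist (p (y n)) z < δ / 2 := by
    intro n
    obtain ⟨z, hz, h1⟩ := mem_iUnion₂.1 (hcov (mem_univ (p (y n))))
    exact ⟨⟨z, hz⟩, h1⟩
  choose z hz using hc
  have := ht.to_subtype
  obtain ⟨m, n, hmn, hzmn⟩ : ∃ m n, m < n ∧ z m = z n := by
    obtain ⟨m, n, hne, he⟩ := Finite.exists_ne_map_eq_of_infinite z
    rcases lt_or_gt_of_ne hne with h | h
    · exact ⟨m, n, h, he⟩
    · exact ⟨n, m, h, he.symm⟩
  have hd : dist (p (y m)) (p (y n)) < δ := by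
    have h1 := hz m
    have h2 := hz n
    rw [← hzmn] at h2
    linarith [dist_triangle_right (p (y m)) (p (y n)) (z m)]
  obtain ⟨y', h1, h2⟩ := exists_lift_of_dist_lt hp hpt hd
  have hball : Metric.ball (dev (y m)) δ ⊆ dev '' U.1 := by
    intro v hv
    have := (h v _ (Metric.mem_ball.1 hv)).2
    rw [hy, F.snd_map, sub_zero, abs_lt] at this
    rw [hU.image_eq]
    exact ⟨by linarith [this.1], by linarith [this.2]⟩
  obtain ⟨h3, h4⟩ := eq_sect_of_dist_lt hdev (hball.trans (U.image_subset hdev (hyU m))) h1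
  refine ⟨y', ?_, y n, hyU n, h2, ?_⟩
  · rw [U.eq_image hdev (hyU m)]
    exact ⟨dev y', hball h3, h4⟩
  · have h5 := h _ _ (Metric.mem_ball.1 h3)
    rw [hy] at h5 ⊢
    simp only [F.fst_map, F.snd_map] at h5 ⊢
    have h6 : (m : ℝ) + 1 ≤ n := by exact_mod_cast hmn
    exact ⟨by linarith [(abs_lt.1 h5.1).2], h5.2.trans (by norm_num)⟩

/-- A tight strip is invariant under a translation that lifts the identity. -/
theorem Subconic.exists_period (ht : U.IsTight F) : ∃ Q > (0 : ℝ), U.HasPeriod p F Q := by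
  obtain ⟨y, hy, y', hy', hpy, h1, h2⟩ := exists_almost_period hdev hU hY hp hpt
  set Q := F.fst (dev y') - F.fst (dev y) with hQ
  set k := F.snd (dev y') - F.snd (dev y) with hk
  have hk1 : |k| < 1 := by rwa [hk, abs_sub_comm]
  rw [abs_lt] at hk1
  have hdiff : dev y' - dev y = Q • F.a + k • F.b := by
    rw [← F.map_coords (dev y), ← F.map_coords (dev y')]
    simp only [Frame.map, hQ, hk]
    module
  have hsnd : ∀ v, F.snd (v - (dev y' - dev y)) = F.snd v - k := by
    intro v
    obtain ⟨A, B, rfl⟩ := F.exists_map v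
    have : F.map A B - (dev y' - dev y) = F.map (A - Q) (B - k) := by
      rw [hdiff]; simp only [Frame.map]; module
    rw [this, F.snd_map, F.snd_map]
  have hband : ∀ y ∈ U.1, F.band (-1) 1 ⊆ starDomain dev y := fun y hy =>
    hU.image_eq ▸ U.image_subset hdev hy
  have h3 := ht y' hy' (min (-1) (-1 + k)) (max 1 (1 + k)) (min_le_left _ _) (le_max_left _ _) (by
    rintro v ⟨hv1, hv2⟩
    by_cases hv : v ∈ F.band (-1) 1
    · exact hband y' hy' hv
    · have h4 : v - (dev y' - dev y) ∈ F.band (-1) 1 := by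
        rw [Frame.band, mem_ofPred_eq, hsnd]
        rw [Frame.band, mem_ofPred_eq, not_and_or, not_lt, not_lt] at hv
        rcases hv with hv | hv
        · rcases min_lt_iff.1 hv1 with h | h <;> constructor <;> linarith
        · rcases lt_max_iff.1 hv2 with h | h <;> constructor <;> linarith
      have := (starDomain_of_covering hdev.isLocalHomeomorph hp hpt hdev hpy (hband y hy h4)).1
      simpa using this)
  have hk0 : k = 0 := by
    have h4 := h3.1 ▸ min_le_right (-1) (-1 + k)
    have h5 := h3.2 ▸ le_max_right 1 (1 + k)
    linarith
  rw [hk0, zero_smul, add_zero] at hdiff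
  have key : ∀ y ∈ U.1, ∀ y' ∈ U.1, p y = p y' → F.snd (dev y') = F.snd (dev y) →
      ∀ z ∈ U.1, ∃ z' ∈ U.1, p z = p z' ∧ dev z' = dev z + (dev y' - dev y) := by
    intro y hy y' hy' hpy hs z hz
    obtain ⟨h4, h5⟩ := U.sect_dev hdev hy hz
    obtain ⟨h6, h7⟩ := starDomain_of_covering hdev.isLocalHomeomorph hp hpt hdev hpy h4
    refine ⟨_, ?_, (h7.trans (congrArg p h5)).symm, dev_sect h6⟩
    rw [U.eq_image hdev hy']
    refine ⟨_, ?_, rfl⟩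
    have h8 : dev z ∈ F.band (-1) 1 := hU.image_eq ▸ ⟨z, hz, rfl⟩
    rw [hU.image_eq]
    have h9 : F.snd (dev z + (dev y' - dev y)) = F.snd (dev z) + (F.snd (dev y') - F.snd (dev y)) := by
      simp [Frame.snd, cross]; ring
    rw [Frame.band, mem_ofPred_eq, h9, hs, sub_self, add_zero]
    exact h8
  refine ⟨Q, by linarith, fun z hz => ⟨?_, ?_⟩⟩
  · rw [← hdiff]; exact key y hy y' hy' hpy (by linarith) z hz
  · rw [← hdiff, ← sub_add_cancel (dev z) (dev y' - dev y), add_sub_cancel_right, sub_eq_add_neg, neg_sub]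
    exact key y' hy' y hy hpy.symm (by linarith) z hz

end Strip

end Surface

end TranslationConics
end

noncomputable section
namespace TranslationConics

section Gluing

open UniformSpace

variable {Y X : Type*} [MetricSpace Y] [ChartedSpace Plane Y] [TranslationSurface Y]
  [MetricSpace X] [ChartedSpace Plane X] [TranslationSurface X] {dev : X → Plane}

omit [ChartedSpace Plane Y] [TranslationSurface Y] [ChartedSpace Plane X] [TranslationSurface X] in
theorem Subconic.HasPeriod.neg {U : Subconic dev} {F : Frame} {Q : ℝ} {p : X → Y}
    (h : U.HasPeriod p F Q) : U.HasPeriod p F.neg Q := by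
  intro z hz
  obtain ⟨h1, h2⟩ := h z hz
  refine ⟨?_, ?_⟩
  · simpa [Frame.neg, sub_eq_add_neg] using h2
  · simpa [Frame.neg, sub_eq_add_neg] using h1

theorem Frame.map_add_smul (F : Frame) (A B Q : ℝ) : F.map A B + Q • F.a = F.map (A + Q) B := by
  simp only [Frame.map]; module

variable (hdev : IsDevelopingMap dev) {U : Subconic dev} {c : Fin 6 → ℝ} {F : Frame}
  (hU : U.IsBandIn c F) {p : X → Y} (hp : IsCoveringMap p) (hpt : IsTranslationMap p)
  {Q : ℝ} (hQ : U.HasPeriod p F Q)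
include hdev hU hp hpt hQ

theorem Subconic.HasPeriod.marks_iff {A B : ℝ} :
    F.map (A + Q) B ∈ U.marks ↔ F.map A B ∈ U.marks := by
  obtain ⟨x, hx, -⟩ : ∃ x ∈ U.1, dev x = F.map 0 0 := by
    change F.map 0 0 ∈ dev '' U.1
    rw [hU.image_eq, F.map_mem_band]; norm_num
  obtain ⟨x', hx', hpx, h1⟩ := (hQ x hx).1
  rw [mem_marks hdev hx', mem_marks hdev hx, hU.frontier_eq]
  simp only [mem_ofPred_eq, F.snd_map]
  refine and_congr Iff.rfl (not_congr ⟨fun h => ?_, fun h => ?_⟩)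
  · have := (starDomain_of_covering hdev.isLocalHomeomorph hp hpt hdev hpx.symm h).1
    rwa [h1, ← F.map_add_smul, sub_add_cancel_left, add_neg_cancel_right] at this
  · have := (starDomain_of_covering hdev.isLocalHomeomorph hp hpt hdev hpx h).1
    rwa [h1, add_sub_cancel_left, F.map_add_smul] at this

/-- A strip that is periodic can be enlarged across a boundary line without marks. -/
theorem Subconic.HasPeriod.exists_band_subset (hQ0 : 0 < Q) (hm : ∀ A, F.map A 1 ∉ U.marks) {x : X}
    (hx : x ∈ U.1) : ∃ η > (0 : ℝ), F.band (-1) (1 + η) ⊆ starDomain dev x := by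
  have hd := hdev.isLocalHomeomorph
  let S : Set Plane := {v | -1 < F.snd v ∧ F.snd v ≤ 1}
  have hSmap : ∀ A B, F.map A B ∈ S ↔ -1 < B ∧ B ≤ 1 := fun A B => by simp [S]
  have hS : Convex ℝ S := by
    refine F.convex_setOf (S := fun _ Y => -1 < Y ∧ Y ≤ 1) fun X Y X' Y' r h h' h0 h1 => ⟨?_, ?_⟩
    · rcases h0.eq_or_lt with rfl | h0
      · simpa using h.1
      · nlinarith [mul_nonneg (sub_nonneg.2 h1) (sub_nonneg.2 h.1.le), mul_pos h0 (sub_pos.2 h'.1)]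
    · nlinarith [mul_nonneg (sub_nonneg.2 h1) (sub_nonneg.2 h.2), mul_nonneg h0 (sub_nonneg.2 h'.2)]
  have hSD : ∀ y ∈ U.1, S ⊆ starDomain dev y := by
    intro y hy v hv
    rcases hv.2.eq_or_lt with h1 | h1
    · have h2 := hm (F.fst v)
      rw [← h1, F.map_coords, mem_marks hdev hy, hU.frontier_eq] at h2
      by_contra hcon
      exact h2 ⟨Or.inl h1, hcon⟩
    · exact U.image_subset hdev hy (hU.image_eq ▸ ⟨hv.1, h1⟩)
  have hxS : dev x ∈ S := by
    have : dev x ∈ F.band (-1) 1 := hU.image_eq ▸ ⟨x, hx, rfl⟩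
    exact ⟨this.1, this.2.le⟩
  let ξ : ℝ → X := fun A => sect dev x (F.map A 1)
  have h1S : ∀ A, F.map A 1 ∈ S := fun A => by rw [hSmap]; norm_num
  have hξ : ∀ A v, v ∈ S → v ∈ starDomain dev (ξ A) ∧ sect dev (ξ A) v = sect dev x v := fun A v hv =>
    sect_sect hd hS (hSD x hx) (h1S A) hv
  have hdξ : ∀ A, dev (ξ A) = F.map A 1 := fun A => dev_sect (hSD x hx (h1S A))
  let R : ℝ → ℝ → Set Plane := fun A η => {v | |F.fst v - A| < η ∧ |F.snd v - 1| < η}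
  have hRo : ∀ A η, IsOpen (R A η) := fun A η =>
    (isOpen_lt (F.continuous_fst.sub continuous_const).abs continuous_const).inter
      (isOpen_lt (F.continuous_snd.sub continuous_const).abs continuous_const)
  have hRc : ∀ A η, Convex ℝ (R A η) := by
    intro A η
    refine F.convex_setOf (S := fun X Y => |X - A| < η ∧ |Y - 1| < η)
      fun X Y X' Y' r h h' h0 h1 => ?_
    rw [abs_lt, abs_lt] at *
    rcases h0.eq_or_lt with rfl | h0
    · simpa using h
    · have h2 : 0 ≤ 1 - r := by linarith
      refine ⟨⟨?_, ?_⟩, ?_, ?_⟩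
      · nlinarith [mul_nonneg h2 (sub_nonneg.2 h.1.1.le), mul_pos h0 (sub_pos.2 h'.1.1)]
      · nlinarith [mul_nonneg h2 (sub_nonneg.2 h.1.2.le), mul_pos h0 (sub_pos.2 h'.1.2)]
      · nlinarith [mul_nonneg h2 (sub_nonneg.2 h.2.1.le), mul_pos h0 (sub_pos.2 h'.2.1)]
      · nlinarith [mul_nonneg h2 (sub_nonneg.2 h.2.2.le), mul_pos h0 (sub_pos.2 h'.2.2)]
  have hRmono : ∀ A {η η'}, η ≤ η' → R A η ⊆ R A η' := fun A η η' h v hv =>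
    ⟨hv.1.trans_le h, hv.2.trans_le h⟩
  have hloc : ∀ A, ∃ η > (0 : ℝ), R A η ⊆ starDomain dev (ξ A) := by
    intro A
    have h1 : starDomain dev (ξ A) ∈ 𝓝 (F.map A 1) :=
      (isOpen_starDomain hd _).mem_nhds (hξ A _ (h1S A)).1
    have h2 := (F.continuous_map.tendsto (A, 1)) h1
    obtain ⟨η, hη, h3⟩ := Metric.mem_nhds_iff.1 h2
    refine ⟨η, hη, fun v hv => ?_⟩
    have h4 : (F.fst v, F.snd v) ∈ Metric.ball (A, (1 : ℝ)) η := by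
      rw [Metric.mem_ball, Prod.dist_eq]
      exact max_lt hv.1 hv.2
    simpa using h3 h4
  have hcpt : ∃ η > (0 : ℝ), ∀ A ∈ Icc 0 Q, R A η ⊆ starDomain dev (ξ A) := by
    refine isCompact_Icc.induction_on (p := fun s => ∃ η > (0 : ℝ), ∀ A ∈ s, R A η ⊆ starDomain dev (ξ A))
      ⟨1, one_pos, fun A hA => hA.elim⟩ (fun s t hst ⟨η, h1, h2⟩ => ⟨η, h1, fun A hA => h2 A (hst hA)⟩)
      ?_ ?_
    · rintro s t ⟨η, h1, h2⟩ ⟨η', h3, h4⟩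
      refine ⟨min η η', lt_min h1 h3, fun A hA => ?_⟩
      rcases hA with hA | hA
      · exact (hRmono A (min_le_left _ _)).trans (h2 A hA)
      · exact (hRmono A (min_le_right _ _)).trans (h4 A hA)
    · intro A _
      obtain ⟨η, hη, h⟩ := hloc A
      refine ⟨Metric.ball A (η / 2), mem_nhdsWithin_of_mem_nhds (Metric.ball_mem_nhds _ (by linarith)),
        η / 2, by linarith, fun B hB v hv => ?_⟩
      have hB' : |B - A| < η / 2 := hB
      have h1 : F.map B 1 ∈ R A η := by
        change |F.fst _ - A| < η ∧ |F.snd _ - 1| < η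
        rw [F.fst_map, F.snd_map, sub_self, abs_zero]
        exact ⟨by linarith, hη⟩
      have h2 : v ∈ R A η := by
        refine ⟨?_, hv.2.trans (by linarith)⟩
        have h3 := abs_sub_le (F.fst v) B A
        linarith [hv.1]
      have h3 := (sect_sect hd (hRc A η) h h1 h2).1
      rwa [(hξ A _ (h1S B)).2] at h3
  obtain ⟨η, hη, hcpt⟩ := hcpt
  have hper : Function.Periodic (fun A => R A η ⊆ starDomain dev (ξ A)) Q := by
    intro A
    obtain ⟨x', hx', hpx, hdx⟩ := (hQ x hx).1
    have hx'' : x' = sect dev x (dev x') := ((U.sect_dev hdev hx hx').2).symm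
    have hdx' : dev x' ∈ S := by
      have : dev x' ∈ F.band (-1) 1 := hU.image_eq ▸ ⟨x', hx', rfl⟩
      exact ⟨this.1, this.2.le⟩
    have hpξ : p (ξ A) = p (ξ (A + Q)) := by
      have h1 := (starDomain_of_covering hd hp hpt hdev hpx (hSD x hx (h1S A))).2
      rw [hdx, add_sub_cancel_left, F.map_add_smul, hx'',
        (sect_sect hd hS (hSD x hx) hdx' (h1S (A + Q))).2] at h1
      exact h1.symm
    have hdd : dev (ξ (A + Q)) - dev (ξ A) = Q • F.a := by
      rw [hdξ, hdξ, ← F.map_add_smul, add_sub_cancel_left]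
    have hfst : ∀ v, F.fst (v + Q • F.a) = F.fst v + Q ∧ F.snd (v + Q • F.a) = F.snd v := by
      intro v
      obtain ⟨B, C, rfl⟩ := F.exists_map v
      rw [F.map_add_smul, F.fst_map, F.fst_map, F.snd_map, F.snd_map]
      exact ⟨rfl, rfl⟩
    refine propext ⟨fun h v hv => ?_, fun h v hv => ?_⟩
    · have h1 := h (a := v + Q • F.a) (by
        change |F.fst _ - _| < η ∧ |F.snd _ - 1| < η
        rw [(hfst v).1, (hfst v).2, add_sub_add_right_eq_sub]
        exact hv)
      have h2 := (starDomain_of_covering hd hp hpt hdev hpξ.symm h1).1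
      rwa [← neg_sub, hdd, add_neg_cancel_right] at h2
    · have h1 := h (a := v - Q • F.a) (by
        have h3 := hfst (v - Q • F.a)
        rw [sub_add_cancel] at h3
        change |F.fst _ - _| < η ∧ |F.snd _ - 1| < η
        rw [← h3.2, ← add_sub_add_right_eq_sub _ A Q, ← h3.1]
        exact hv)
      have h2 := (starDomain_of_covering hd hp hpt hdev hpξ h1).1
      rwa [hdd, sub_add_cancel] at h2
  have hall : ∀ A, R A η ⊆ starDomain dev (ξ A) := by
    intro A
    obtain ⟨B, hB, h⟩ := hper.exists_mem_Ico₀ hQ0 A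
    exact h.symm ▸ hcpt B ⟨hB.1, hB.2.le⟩
  refine ⟨η, hη, fun v hv => (subset_starDomain hd (S := F.band (-1) (1 + η))
    ((F.convex_band _ _).starConvex ⟨hxS.1, by linarith [hxS.2]⟩)
    (s := fun v => sect dev (ξ (F.fst v)) v) ?_ ?_ ?_ hv).1⟩
  · intro v hv
    refine ContinuousAt.continuousWithinAt ?_
    set A := F.fst v with hA
    let T : Set Plane := {w | |F.fst w - A| < η ∧ (-1 < F.snd w ∧ F.snd w < 1 + η)}
    have hTo : IsOpen T := (isOpen_lt (F.continuous_fst.sub continuous_const).abs continuous_const).inter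
      ((isOpen_lt continuous_const F.continuous_snd).inter
        (isOpen_lt F.continuous_snd continuous_const))
    have hTc : Convex ℝ T := by
      refine F.convex_setOf (S := fun X Y => |X - A| < η ∧ (-1 < Y ∧ Y < 1 + η))
        fun X Y X' Y' r h h' h0 h1 => ?_
      rw [abs_lt] at *
      rcases h0.eq_or_lt with rfl | h0
      · simpa using h
      · have h2 : 0 ≤ 1 - r := by linarith
        refine ⟨⟨?_, ?_⟩, ?_, ?_⟩
        · nlinarith [mul_nonneg h2 (sub_nonneg.2 h.1.1.le), mul_pos h0 (sub_pos.2 h'.1.1)]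
        · nlinarith [mul_nonneg h2 (sub_nonneg.2 h.1.2.le), mul_pos h0 (sub_pos.2 h'.1.2)]
        · nlinarith [mul_nonneg h2 (sub_nonneg.2 h.2.1.le), mul_pos h0 (sub_pos.2 h'.2.1)]
        · nlinarith [mul_nonneg h2 (sub_nonneg.2 h.2.2.le), mul_pos h0 (sub_pos.2 h'.2.2)]
    have hTD : T ⊆ starDomain dev (ξ A) := by
      intro w hw
      rcases le_or_gt (F.snd w) 1 with h | h
      · exact (hξ A w ⟨hw.2.1, h⟩).1
      · refine hall A ⟨hw.1, ?_⟩
        rw [abs_lt]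
        constructor <;> linarith [hw.2.2]
    have hvT : v ∈ T := ⟨by rw [hA, sub_self, abs_zero]; exact hη, hv.1, hv.2⟩
    have heq : (fun w => sect dev (ξ (F.fst w)) w) =ᶠ[𝓝 v] sect dev (ξ A) := by
      filter_upwards [hTo.mem_nhds hvT] with w hw
      have h1 : F.map (F.fst w) 1 ∈ T := by
        change |F.fst _ - A| < η ∧ (-1 < F.snd _ ∧ F.snd _ < 1 + η)
        rw [F.fst_map, F.snd_map]
        exact ⟨hw.1, by norm_num, by linarith⟩
      have h2 := (sect_sect hd hTc hTD h1 hw).2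
      rwa [(hξ A _ (h1S _)).2] at h2
    refine ContinuousAt.congr ?_ heq.symm
    exact (continuousOn_sect hd _).continuousAt ((isOpen_starDomain hd _).mem_nhds (hTD hvT))
  · intro w hw
    refine dev_sect ?_
    rcases le_or_gt (F.snd w) 1 with h | h
    · exact (hξ _ w ⟨hw.1, h⟩).1
    · refine hall _ ⟨by rw [sub_self, abs_zero]; exact hη, ?_⟩
      rw [abs_lt]
      constructor <;> linarith [hw.2]
  · rw [(hξ _ _ hxS).2]
    exact (self_mem_starDomain hd x).2

theorem Subconic.HasPeriod.exists_mark (hQ0 : 0 < Q) (ht : U.IsTight F) : ∃ A, F.map A 1 ∈ U.marks := by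
  by_contra! hm
  obtain ⟨x, hx, -⟩ : ∃ x ∈ U.1, dev x = F.map 0 0 := by
    change F.map 0 0 ∈ dev '' U.1
    rw [hU.image_eq, F.map_mem_band]; norm_num
  obtain ⟨η, hη, h⟩ := hQ.exists_band_subset hdev hU hp hpt hQ0 hm hx
  have := (ht x hx (-1) (1 + η) le_rfl (by linarith) h).2
  linarith

omit hp hpt hQ
/-- The marks of a tight strip: they are periodic, and there are some on each line. -/
theorem Subconic.IsBandIn.exists_period (hp : IsCoveringMap p) (hpt : IsTranslationMap p)
    (hY : TotallyBounded (Set.univ : Set Y)) (ht : U.IsTight F) :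
    (∃ Q > (0 : ℝ), ∀ A B, F.map (A + Q) B ∈ U.marks ↔ F.map A B ∈ U.marks) ∧
      (∃ A, F.map A 1 ∈ U.marks) ∧ ∃ A, F.map A (-1) ∈ U.marks := by
  obtain ⟨Q, hQ0, hQ⟩ := Subconic.exists_period hdev hU hY hp hpt ht
  refine ⟨⟨Q, hQ0, fun A B => hQ.marks_iff hdev hU hp hpt⟩,
    hQ.exists_mark hdev hU hp hpt hQ0 ht, ?_⟩
  obtain ⟨A, hA⟩ := hQ.neg.exists_mark hdev hU.neg hp hpt hQ0 ht.neg
  exact ⟨-A, by rwa [F.neg_map] at hA⟩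

end Gluing

end TranslationConics
end

noncomputable section
namespace TranslationConics

/-- A positively oriented parametrization of the boundary of a plane region by the lines `ι × ℝ`,
with period `P` (injective for `P = 0`). -/
structure BoundaryParam (V : Set Plane) (ι : Type) where
  /-- the parametrization -/
  E : ι → ℝ → Plane
  /-- its derivative -/
  E' : ι → ℝ → Plane
  /-- the period -/
  P : ℝ
  P_nonneg : 0 ≤ P
  hasDerivAt : ∀ i t, HasDerivAt (E i) (E' i t) t
  mem_frontier : ∀ v, v ∈ frontier V ↔ ∃ i t, E i t = v
  eq_iff : ∀ i j s t, E i s = E j t ↔ i = j ∧ ∃ m : ℤ, t = s + m * P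
  isClosed : ∀ i a b, (P = 0 ∨ b ≤ a + P) → IsClosed (frontier V \ E i '' Ioo a b)
  left : ∀ i t, ∀ p ∈ V, 0 < cross (E' i t) (p - E i t)
  center : ∀ i t, ∃ p ∈ V, ∃ δ > (0 : ℝ), ∀ s, |s - t| < δ → 0 < cross (E i s - E i t) (p - E i t) → t < s

namespace BoundaryParam

variable {V : Set Plane} {ι : Type} (B : BoundaryParam V ι)

theorem continuous (i : ι) : Continuous (B.E i) :=
  continuous_iff_continuousAt.2 fun t => (B.hasDerivAt i t).continuousAt

theorem E_mem (i : ι) (t : ℝ) : B.E i t ∈ frontier V := (B.mem_frontier _).2 ⟨i, t, rfl⟩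

theorem eq_of_abs_lt {i : ι} {s t : ℝ} (h : B.E i s = B.E i t) (hst : B.P = 0 ∨ |t - s| < B.P) : s = t := by
  obtain ⟨-, m, hm⟩ := (B.eq_iff _ _ _ _).1 h
  rcases hst with h0 | h0
  · rw [hm, h0, mul_zero, add_zero]
  · have hP : 0 < B.P := (abs_nonneg _).trans_lt h0
    rw [hm, add_sub_cancel_left, abs_mul, abs_of_pos hP, mul_lt_iff_lt_one_left hP] at h0
    have : m = 0 := Int.abs_lt_one_iff.1 (by exact_mod_cast h0)
    rw [hm, this]; simp

theorem injOn (i : ι) {a b : ℝ} (h : B.P = 0 ∨ b < a + B.P) : InjOn (B.E i) (Icc a b) := by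
  intro s hs t ht hst
  refine B.eq_of_abs_lt hst (h.imp_right fun h => ?_)
  rw [abs_lt]
  constructor <;> linarith [hs.1, hs.2, ht.1, ht.2]

theorem eventually_eq (i : ι) (t : ℝ) : ∀ᶠ s in 𝓝 t, B.E i s = B.E i t → s = t := by
  rcases B.P_nonneg.eq_or_lt with h | h
  · exact Eventually.of_forall fun s hs => B.eq_of_abs_lt hs (Or.inl h.symm)
  · filter_upwards [Metric.ball_mem_nhds t h] with s hs hst
    refine (B.eq_of_abs_lt hst.symm (Or.inr ?_)).symm
    rwa [Metric.mem_ball, Real.dist_eq] at hs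

end BoundaryParam

section Successor

open UniformSpace

variable {X : Type*} [MetricSpace X] [ChartedSpace Plane X] [TranslationSurface X]
  {dev : X → Plane} (hdev : IsDevelopingMap dev) {U : Subconic dev} {x : X} (hx : x ∈ U.1)
  {ι : Type} (B : BoundaryParam (dev '' U.1) ι)
include hdev hx

theorem Subconic.devExt_mem_frontier {ξ : Completion X} (hξ : ξ ∈ U.boundary) :
    devExt dev ξ ∈ frontier (dev '' U.1) := by
  rw [← U.devExt_image_boundary hdev hx]; exact ⟨ξ, hξ, rfl⟩

theorem Subconic.limitPoint_mem_boundary {v : Plane} (hv : v ∈ frontier (dev '' U.1)) :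
    limitPoint dev x v ∈ U.boundary := by
  rw [U.boundary_eq hdev hx]; exact ⟨v, hv, rfl⟩

theorem Subconic.devExt_limitPoint {v : Plane} (hv : v ∈ frontier (dev '' U.1)) :
    devExt dev (limitPoint dev x v) = v :=
  TranslationConics.devExt_limitPoint hdev (U.frontier_subset_visibleSet hdev hx hv)

theorem Subconic.devExt_mem_marks {ξ : Completion X} (hξ : ξ ∈ U.boundary) :
    devExt dev ξ ∈ U.marks ↔ ξ ∈ metricFrontier X := by
  constructor
  · rintro ⟨ξ', hξ', h⟩
    rw [← U.limitPoint_devExt hdev hx hξ, ← h, U.limitPoint_devExt hdev hx hξ'.1]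
    exact hξ'.2
  · intro h; exact ⟨ξ, ⟨hξ, h⟩, rfl⟩

theorem Subconic.limitPoint_mem_conePoints {v : Plane} (hv : v ∈ U.marks) :
    limitPoint dev x v ∈ U.conePoints := by
  obtain ⟨ξ, hξ, rfl⟩ := hv
  rwa [U.limitPoint_devExt hdev hx hξ.1]

/-- The component of a point of an arc is contained in the arc when the end points are removed. -/
theorem Subconic.devExt_connectedComponentIn {i : ι} {a b : ℝ} (hab : B.P = 0 ∨ b ≤ a + B.P)
    {S : Set (Completion X)} (hS : S ⊆ U.boundary) (ha : limitPoint dev x (B.E i a) ∉ S)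
    (hb : limitPoint dev x (B.E i b) ∉ S) {ξ : Completion X} (hξS : ξ ∈ S)
    (hξ : devExt dev ξ ∈ B.E i '' Ioo a b) {ζ : Completion X} (hζ : ζ ∈ connectedComponentIn S ξ) :
    devExt dev ζ ∈ B.E i '' Ioo a b := by
  set C := connectedComponentIn S ξ with hC
  have hCS : C ⊆ S := connectedComponentIn_subset S ξ
  have hpre : IsPreconnected (devExt dev '' C) :=
    isPreconnected_connectedComponentIn.image _ continuous_devExt.continuousOn
  have hfr : devExt dev '' C ⊆ frontier (dev '' U.1) := by
    rintro _ ⟨η, hη, rfl⟩; exact U.devExt_mem_frontier hdev hx (hS (hCS hη))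
  have hK1 : IsClosed (B.E i '' Icc a b) := (isCompact_Icc.image (B.continuous i)).isClosed
  have hdisj : devExt dev '' C ∩ (B.E i '' Icc a b ∩ (frontier (dev '' U.1) \ B.E i '' Ioo a b)) = ∅ := by
    rw [eq_empty_iff_forall_notMem]
    rintro _ ⟨⟨η, hη, rfl⟩, ⟨t, ht, hte⟩, h2⟩
    have hη' := U.limitPoint_devExt hdev hx (hS (hCS hη))
    have h3 : t = a ∨ t = b := by
      by_contra! hcon
      exact h2.2 ⟨t, ⟨lt_of_le_of_ne ht.1 (Ne.symm hcon.1), lt_of_le_of_ne ht.2 hcon.2⟩, hte⟩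
    rcases h3 with rfl | rfl
    · rw [hte, hη'] at ha; exact ha (hCS hη)
    · rw [hte, hη'] at hb; exact hb (hCS hη)
  have hcov : devExt dev '' C ⊆ B.E i '' Icc a b ∪ (frontier (dev '' U.1) \ B.E i '' Ioo a b) := by
    intro v hv
    by_cases h : v ∈ B.E i '' Ioo a b
    · exact Or.inl (image_mono Ioo_subset_Icc_self h)
    · exact Or.inr ⟨hfr hv, h⟩
  rcases isPreconnected_iff_subset_of_disjoint_closed.1 hpre _ _ hK1 (B.isClosed i a b hab) hcov hdisj
    with h | h
  · by_contra hcon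
    have h1 : devExt dev ζ ∈ devExt dev '' C := ⟨ζ, hζ, rfl⟩
    exact hdisj.subset ⟨h1, h h1, hfr h1, hcon⟩
  · exact absurd hξ (h ⟨ξ, mem_connectedComponentIn hξS, rfl⟩).2

variable {B} {i : ι} {a b : ℝ} (hlt : a < b) (hab : B.P = 0 ∨ b < a + B.P)
  (ham : B.E i a ∈ U.marks) (hbm : B.E i b ∈ U.marks) (hm : ∀ t ∈ Ioo a b, B.E i t ∉ U.marks)
include hlt hab ham hbm hm

omit ham hbm in
theorem Subconic.isSuccessor_of_arc :
    U.IsSuccessor (limitPoint dev x (B.E i a)) (limitPoint dev x (B.E i b)) := by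
  have hab' : B.P = 0 ∨ b ≤ a + B.P := hab.imp_right le_of_lt
  have hmid : (a + b) / 2 ∈ Ioo a b := ⟨by linarith, by linarith⟩
  set ξ := limitPoint dev x (B.E i ((a + b) / 2)) with hξ
  have hξU : ξ ∈ U.boundary := U.limitPoint_mem_boundary hdev hx (B.E_mem i _)
  have hdξ : devExt dev ξ = B.E i ((a + b) / 2) := U.devExt_limitPoint hdev hx (B.E_mem i _)
  have hinj := B.injOn i hab
  have hcc := U.continuousOn_limitPoint hdev hx
  have hmaps : ∀ t, B.E i t ∈ closure (dev '' U.1) := fun t => frontier_subset_closure (B.E_mem i t)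
  have hne : ∀ t ∈ Icc a b, t ≠ (a + b) / 2 → ξ ≠ limitPoint dev x (B.E i t) := by
    intro t ht hne h
    rw [h, U.devExt_limitPoint hdev hx (B.E_mem i _)] at hdξ
    exact hne (hinj ht (Ioo_subset_Icc_self hmid) hdξ)
  refine ⟨⟨ξ, ⟨hξU, ?_⟩, ?_⟩, ξ, ⟨hξU, ?_⟩,
    fun t => limitPoint dev x (B.E i (a + (t + 1) / 2 * (b - a))), ⟨?_, ?_, ?_⟩, ?_, ?_, ?_⟩
  · rintro (h | h)
    · exact hne a ⟨le_rfl, hlt.le⟩ (by linarith) h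
    · exact hne b ⟨hlt.le, le_rfl⟩ (by linarith) h
  · rw [Set.disjoint_left]
    intro ζ hζ hζ'
    obtain ⟨t, ht, h⟩ := U.devExt_connectedComponentIn hdev hx B hab' sdiff_subset (by simp) (by simp)
      ⟨hξU, by
        rintro (h | h)
        · exact hne a ⟨le_rfl, hlt.le⟩ (by linarith) h
        · exact hne b ⟨hlt.le, le_rfl⟩ (by linarith) h⟩ ⟨_, hmid, hdξ.symm⟩ hζ
    refine hm t ht (h ▸ (U.devExt_mem_marks hdev hx ?_).2 hζ')
    exact (connectedComponentIn_subset _ _ hζ).1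
  · rw [← U.devExt_mem_marks hdev hx hξU, hdξ]
    exact hm _ hmid
  · refine Continuous.continuousOn ?_
    exact hcc.comp_continuous ((B.continuous i).comp (by fun_prop)) fun t => hmaps _
  · exact fun t _ => U.limitPoint_mem_boundary hdev hx (B.E_mem i _)
  · intro t _
    have h1 : (fun s => devExt dev (limitPoint dev x (B.E i (a + (s + 1) / 2 * (b - a))))) =
        fun s => B.E i (a + (s + 1) / 2 * (b - a)) :=
      funext fun s => U.devExt_limitPoint hdev hx (B.E_mem i _)
    have h2 : HasDerivAt (fun s : ℝ => a + (s + 1) / 2 * (b - a)) ((b - a) / 2) t := by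
      have := ((((hasDerivAt_id t).add_const 1).div_const 2).mul_const (b - a)).const_add a
      refine this.congr_deriv ?_
      ring
    refine ⟨((b - a) / 2) • B.E' i (a + (t + 1) / 2 * (b - a)), ?_, fun p hp => ?_⟩
    · rw [h1]
      exact ((B.hasDerivAt i _).scomp t h2).hasDerivWithinAt
    · have h3 := B.left i (a + (t + 1) / 2 * (b - a)) (dev p) ⟨p, hp, rfl⟩
      rw [U.devExt_limitPoint hdev hx (B.E_mem i _)]
      have h4 : 0 < (b - a) / 2 := by linarith
      have h5 := mul_pos h4 h3
      simp only [cross] at h5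
      simp only [PiLp.smul_apply, smul_eq_mul]
      linarith
  · have hcont : Continuous fun t : ℝ => limitPoint dev x (B.E i (a + (t + 1) / 2 * (b - a))) :=
      hcc.comp_continuous ((B.continuous i).comp (by fun_prop)) fun t => hmaps _
    have himg : (fun t : ℝ => limitPoint dev x (B.E i (a + (t + 1) / 2 * (b - a)))) '' Ioo (-1) 1 ⊆
        connectedComponentIn (U.boundary \ metricFrontier X) ξ := by
      have hmem : ξ ∈ (fun t : ℝ => limitPoint dev x (B.E i (a + (t + 1) / 2 * (b - a)))) '' Ioo (-1) 1 :=
        ⟨0, ⟨by norm_num, by norm_num⟩,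
          congrArg (fun u => limitPoint dev x (B.E i u)) (by ring : a + (0 + 1) / 2 * (b - a) = (a + b) / 2)⟩
      refine IsPreconnected.subset_connectedComponentIn (isPreconnected_Ioo.image _ hcont.continuousOn)
        hmem ?_
      · rintro _ ⟨t, ht, rfl⟩
        have h1 := U.limitPoint_mem_boundary hdev hx (B.E_mem i (a + (t + 1) / 2 * (b - a)))
        refine ⟨h1, ?_⟩
        rw [← U.devExt_mem_marks hdev hx h1, U.devExt_limitPoint hdev hx (B.E_mem i _)]
        refine hm _ ⟨?_, ?_⟩ <;> nlinarith [ht.1, ht.2]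
    intro t ht
    rw [← closure_Ioo (by norm_num)] at ht
    exact closure_mono himg (hcont.continuousOn.image_closure ⟨t, ht, rfl⟩)
  · norm_num
  · norm_num

theorem Subconic.eq_of_orientedPath {ξ : Completion X} (hξ : ξ ∈ U.boundary \ metricFrontier X)
    (hξa : devExt dev ξ ∈ B.E i '' Ioo a b) {α : ℝ → Completion X} (hα : U.IsOrientedPath α)
    (hαc : ∀ t ∈ Icc (-1 : ℝ) 1,
      α t ∈ closure (connectedComponentIn (U.boundary \ metricFrontier X) ξ))
    (h0 : α (-1) ∈ metricFrontier X) (h1 : α 1 ∈ metricFrontier X) :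
    α (-1) = limitPoint dev x (B.E i a) ∧ α 1 = limitPoint dev x (B.E i b) := by
  have hab' : B.P = 0 ∨ b ≤ a + B.P := hab.imp_right le_of_lt
  obtain ⟨hαcont, hαU, hαd⟩ := hα
  have hnot : ∀ t, B.E i t ∈ U.marks → limitPoint dev x (B.E i t) ∉ U.boundary \ metricFrontier X :=
    fun t ht h => h.2 (U.limitPoint_mem_conePoints hdev hx ht).2
  have hcl : IsClosed (B.E i '' Icc a b) := (isCompact_Icc.image (B.continuous i)).isClosed
  have hβ : ∀ t : Icc (-1 : ℝ) 1, ∃ τ : Icc a b, B.E i τ = devExt dev (α t) := by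
    intro t
    have h2 : closure (connectedComponentIn (U.boundary \ metricFrontier X) ξ) ⊆
        devExt dev ⁻¹' (B.E i '' Icc a b) := by
      refine closure_minimal (fun ζ hζ => ?_) (hcl.preimage continuous_devExt)
      exact image_mono Ioo_subset_Icc_self
        (U.devExt_connectedComponentIn hdev hx B hab' sdiff_subset (hnot a ham) (hnot b hbm) hξ hξa hζ)
    obtain ⟨τ, hτ, h3⟩ := h2 (hαc t t.2)
    exact ⟨⟨τ, hτ⟩, h3⟩
  choose τ hτ using hβ
  have hemb : IsClosedEmbedding fun τ : Icc a b => B.E i τ :=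
    ((B.continuous i).comp continuous_subtype_val).isClosedEmbedding fun s t h =>
      Subtype.ext (B.injOn i hab s.2 t.2 h)
  have hτc : Continuous τ := by
    rw [hemb.isInducing.continuous_iff]
    have : (fun τ : Icc a b => B.E i τ) ∘ τ = fun t : Icc (-1 : ℝ) 1 => devExt dev (α t) := funext hτ
    rw [this]
    exact continuous_devExt.comp (continuousOn_iff_continuous_domRestrict.1 hαcont)
  have hinc : ∀ t : Icc (-1 : ℝ) 1, (t : ℝ) < 1 → ∃ t', τ t < τ t' := by
    intro t ht
    obtain ⟨v, hv, hleft⟩ := hαd t t.2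
    obtain ⟨p, ⟨y, hy, rfl⟩, δ, hδ, hc⟩ := B.center i (τ t)
    have hl := hleft y hy
    rw [← hτ] at hl
    set q := dev y - B.E i (τ t) with hq
    have hd : HasDerivWithinAt (fun s => cross (devExt dev (α s)) q) (cross v q) (Icc (-1 : ℝ) 1) (t : ℝ) := by
      have h0 := ((EuclideanSpace.proj (𝕜 := ℝ) (0 : Fin 2)).hasFDerivAt.comp_hasDerivWithinAt
        (t : ℝ) hv).mul_const (q 1)
      have h1 := ((EuclideanSpace.proj (𝕜 := ℝ) (1 : Fin 2)).hasFDerivAt.comp_hasDerivWithinAt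
        (t : ℝ) hv).mul_const (q 0)
      exact h0.sub h1
    have hs := (hasDerivWithinAt_iff_tendsto_slope.1 hd).eventually (Ioi_mem_nhds hl)
    have hle : 𝓝[>] (t : ℝ) ≤ 𝓝[Icc (-1 : ℝ) 1 \ {(t : ℝ)}] (t : ℝ) := by
      refine nhdsWithin_le_iff.2 ?_
      filter_upwards [Ioc_mem_nhdsGT ht] with s hs
      exact ⟨⟨t.2.1.trans hs.1.le, hs.2⟩, hs.1.ne'⟩
    have hτ0 : ∀ᶠ t' in 𝓝 t, |(τ t' : ℝ) - τ t| < δ := by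
      have := (continuous_subtype_val.comp hτc).tendsto t
      filter_upwards [this (Metric.ball_mem_nhds _ hδ)] with t' ht'
      exact ht'
    have hτ1 : ∀ᶠ s in 𝓝[>] (t : ℝ), ∀ hs : s ∈ Icc (-1 : ℝ) 1, |(τ ⟨s, hs⟩ : ℝ) - τ t| < δ := by
      rw [nhds_subtype_eq_comap, eventually_comap] at hτ0
      filter_upwards [nhdsWithin_le_nhds hτ0] with s hs hs'
      exact hs ⟨s, hs'⟩ rfl
    obtain ⟨s, h1, h2, h3⟩ := ((hs.filter_mono hle).and (hτ1.and (Ioc_mem_nhdsGT ht))).exists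
    have hsI : s ∈ Icc (-1 : ℝ) 1 := ⟨t.2.1.trans h3.1.le, h3.2⟩
    refine ⟨⟨s, hsI⟩, ?_⟩
    refine hc _ (h2 hsI) ?_
    rw [hτ]
    have h4 : 0 < slope (fun s => cross (devExt dev (α s)) q) t s := h1
    rw [slope_def_field] at h4
    have h5 := (div_pos_iff_of_pos_right (sub_pos.2 h3.1)).1 h4
    rw [← hτ t] at h5
    have h6 : cross (devExt dev (α s) - B.E i (τ t)) q =
        cross (devExt dev (α s)) q - cross (B.E i (τ t)) q := by simp [cross]; ring
    rw [h6]; exact h5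
  have hm1 : (-1 : ℝ) ∈ Icc (-1 : ℝ) 1 := by norm_num
  have hp1 : (1 : ℝ) ∈ Icc (-1 : ℝ) 1 := by norm_num
  obtain ⟨t₀, -, ht₀⟩ := isCompact_univ.exists_isMaxOn ⟨⟨1, hp1⟩, mem_univ _⟩ hτc.continuousOn
  have ht₀1 : t₀ = ⟨1, hp1⟩ := by
    by_contra hne
    obtain ⟨t', ht'⟩ := hinc t₀ (lt_of_le_of_ne t₀.2.2 fun h => hne (Subtype.ext h))
    exact absurd (ht₀ (mem_univ t')) (not_le.2 ht')
  have hlt' : τ ⟨-1, hm1⟩ < τ ⟨1, hp1⟩ := by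
    obtain ⟨t', ht'⟩ := hinc ⟨-1, hm1⟩ (by norm_num)
    exact ht'.trans_le (ht₀1 ▸ ht₀ (mem_univ t'))
  have hend : ∀ t : Icc (-1 : ℝ) 1, α t ∈ metricFrontier X → (τ t : ℝ) = a ∨ (τ t : ℝ) = b := by
    intro t ht
    rw [← U.devExt_mem_marks hdev hx (hαU t t.2), ← hτ] at ht
    by_contra! hcon
    exact hm _ ⟨lt_of_le_of_ne (τ t).2.1 (Ne.symm hcon.1), lt_of_le_of_ne (τ t).2.2 hcon.2⟩ ht
  have hlt'' : (τ ⟨-1, hm1⟩ : ℝ) < τ ⟨1, hp1⟩ := hlt'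
  have hτa : (τ ⟨-1, hm1⟩ : ℝ) = a := by
    rcases hend ⟨-1, hm1⟩ h0 with h | h
    · exact h
    · linarith [(τ ⟨1, hp1⟩).2.2]
  have hτb : (τ ⟨1, hp1⟩ : ℝ) = b := by
    rcases hend ⟨1, hp1⟩ h1 with h | h
    · linarith
    · exact h
  refine ⟨?_, ?_⟩
  · rw [← hτa, hτ, U.limitPoint_devExt hdev hx (hαU _ hm1)]
  · rw [← hτb, hτ, U.limitPoint_devExt hdev hx (hαU _ hp1)]

end Successor

end TranslationConics
end

noncomputable section
namespace TranslationConics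

section Enumeration

/-- Increasing enumeration of a locally finite set of reals that is unbounded in both directions. -/
theorem exists_enumeration {T : Set ℝ} (hfin : ∀ a b, (T ∩ Icc a b).Finite)
    (hup : ∀ a, ∃ t ∈ T, a < t) (hdown : ∀ a, ∃ t ∈ T, t < a) :
    ∃ θ : ℤ → ℝ, StrictMono θ ∧ range θ = T := by
  classical
  have hfin' : ∀ a b : T, (Icc a b).Finite := by
    intro a b
    refine Finite.of_finite_image ((hfin a b).subset ?_) (Subtype.val_injective.injOn)
    rintro _ ⟨t, ht, rfl⟩
    exact ⟨t.2, ht⟩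
  let _ : LocallyFiniteOrder T := LocallyFiniteOrder.ofFiniteIcc hfin'
  let _ : SuccOrder T := LinearLocallyFiniteOrder.succOrder T
  let _ : PredOrder T := LinearLocallyFiniteOrder.predOrder T
  have : Nonempty T := by
    obtain ⟨t, ht, -⟩ := hup 0
    exact ⟨⟨t, ht⟩⟩
  have : NoMaxOrder T := ⟨fun a => by
    obtain ⟨t, ht, h⟩ := hup a
    exact ⟨⟨t, ht⟩, h⟩⟩
  have : NoMinOrder T := ⟨fun a => by
    obtain ⟨t, ht, h⟩ := hdown a
    exact ⟨⟨t, ht⟩, h⟩⟩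
  let e : T ≃o ℤ := orderIsoIntOfLinearSuccPredArch
  refine ⟨fun k => e.symm k, fun a b hab => e.symm.strictMono hab, ?_⟩
  ext t
  constructor
  · rintro ⟨k, rfl⟩; exact (e.symm k).2
  · intro ht; exact ⟨e ⟨t, ht⟩, by simp⟩

theorem exists_between_enumeration {θ : ℤ → ℝ} (hθ : StrictMono θ)
    (hup : ∀ a, ∃ k, a < θ k) (hdown : ∀ a, ∃ k, θ k < a) (t : ℝ) :
    ∃ k, θ k ≤ t ∧ t < θ (k + 1) := by
  obtain ⟨b, hb⟩ := hup t
  obtain ⟨a, ha⟩ := hdown t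
  obtain ⟨k, hk, hmax⟩ := Int.exists_greatest_of_bdd (P := fun k => θ k ≤ t)
    ⟨b, fun z hz => (hθ.lt_iff_lt.1 (lt_of_le_of_lt hz hb)).le⟩ ⟨a, ha.le⟩
  refine ⟨k, hk, ?_⟩
  by_contra! h
  have := hmax _ h
  linarith

theorem exists_mem_lt_of_periodic {T : Set ℝ} {Q : ℝ} (hQ : 0 < Q) (hT : ∀ t, t + Q ∈ T ↔ t ∈ T)
    (hne : T.Nonempty) (a : ℝ) : (∃ t ∈ T, a < t) ∧ ∃ t ∈ T, t < a := by
  obtain ⟨t, ht⟩ := hne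
  have h1 : ∀ n : ℕ, t + n * Q ∈ T := by
    intro n
    induction n with
    | zero => simpa using ht
    | succ n ih =>
      rw [← hT] at ih
      convert ih using 1
      push_cast; ring
  have h2 : ∀ n : ℕ, t - n * Q ∈ T := by
    intro n
    induction n with
    | zero => simpa using ht
    | succ n ih =>
      rw [← hT]
      convert ih using 1
      push_cast; ring
  obtain ⟨n, hn⟩ := exists_nat_gt ((a - t) / Q)
  obtain ⟨m, hm⟩ := exists_nat_gt ((t - a) / Q)
  rw [div_lt_iff₀ hQ] at hn hm
  exact ⟨⟨_, h1 n, by linarith⟩, ⟨_, h2 m, by linarith⟩⟩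

theorem finite_inter_Icc {T : Set ℝ} (h : ∀ t, ∀ᶠ s in 𝓝 t, s ∈ T → s = t) (a b : ℝ) :
    (T ∩ Icc a b).Finite := by
  refine isCompact_Icc.induction_on (p := fun s => (T ∩ s).Finite) (by simp)
    (fun s t hst ht => ht.subset (inter_subset_inter_right _ hst))
    (fun s t hs ht => by rw [inter_union_distrib_left]; exact hs.union ht) fun t _ => ?_
  refine ⟨_, mem_nhdsWithin_of_mem_nhds (h t), (finite_singleton t).subset ?_⟩
  rintro s ⟨h1, h2⟩
  exact h2 h1

end Enumeration

section Marking

open UniformSpace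

variable {X : Type*} [MetricSpace X] [ChartedSpace Plane X] [TranslationSurface X]
  {dev : X → Plane}

/-- A boundary parametrization of a subconic, and an increasing enumeration of the parameters
of the marks. -/
structure Marking (U : Subconic dev) (ι : Type) extends BoundaryParam (dev '' U.1) ι where
  /-- the parameters of the marks -/
  θ : ι → ℤ → ℝ
  strictMono : ∀ i, StrictMono (θ i)
  mem_marks : ∀ i t, E i t ∈ U.marks ↔ ∃ k, θ i k = t
  exists_between : ∀ i t, ∃ k, θ i k ≤ t ∧ t < θ i (k + 1)
  lt_add : P = 0 ∨ ∀ i k, θ i (k + 1) < θ i k + P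

theorem exists_marking (hdev : IsDevelopingMap dev) (hX : DiscreteTopology (metricFrontier X))
    {U : Subconic dev} {x : X} (hx : x ∈ U.1) {ι : Type} (B : BoundaryParam (dev '' U.1) ι)
    (hne : ∀ i, ∃ t, B.E i t ∈ U.marks)
    (hper : ∀ i, ∃ Q > (0 : ℝ), ∀ t, B.E i (t + Q) ∈ U.marks ↔ B.E i t ∈ U.marks)
    (hP : B.P = 0 ∨ ∀ i t, ∃ s ∈ Ioo t (t + B.P), B.E i s ∈ U.marks) :
    ∃ M : Marking U ι, M.toBoundaryParam = B := by
  have hiso : ∀ v ∈ frontier (dev '' U.1), ∀ᶠ u in 𝓝 v, u ∈ U.marks → u = v := by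
    intro v hv
    by_cases hD : v ∈ starDomain dev x
    · filter_upwards [(isOpen_starDomain hdev.isLocalHomeomorph x).mem_nhds hD] with u hu h
      exact absurd hu ((U.mem_marks hdev hx).1 h).2
    · filter_upwards [exitSet_isolated hdev hX (x := x)
        ⟨U.frontier_subset_visibleSet hdev hx hv, hD⟩] with u hu h
      rw [U.mem_marks hdev hx] at h
      exact hu ⟨U.frontier_subset_visibleSet hdev hx h.1, h.2⟩
  have hfin : ∀ i a b, ({t | B.E i t ∈ U.marks} ∩ Icc a b).Finite := by
    intro i
    refine finite_inter_Icc fun t => ?_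
    filter_upwards [(B.continuous i).tendsto t |>.eventually (hiso _ (B.E_mem i t)),
      B.eventually_eq i t] with s hs h h'
    exact h (hs h')
  have hunb : ∀ i a, (∃ t ∈ {t | B.E i t ∈ U.marks}, a < t) ∧ ∃ t ∈ {t | B.E i t ∈ U.marks}, t < a := by
    intro i a
    obtain ⟨Q, hQ, h⟩ := hper i
    exact exists_mem_lt_of_periodic hQ h (hne i) a
  choose θ hθ hr using fun i => exists_enumeration (hfin i) (fun a => (hunb i a).1) fun a => (hunb i a).2
  have hmem : ∀ i t, B.E i t ∈ U.marks ↔ ∃ k, θ i k = t := fun i t =>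
    (Set.ext_iff.1 (hr i) t).symm
  refine ⟨⟨B, θ, hθ, hmem, fun i t => ?_, hP.imp_right fun hP i k => ?_⟩, rfl⟩
  · refine exists_between_enumeration (hθ i) (fun a => ?_) (fun a => ?_) t
    · obtain ⟨s, hs, h⟩ := (hunb i a).1
      obtain ⟨k, rfl⟩ := (hmem i s).1 hs
      exact ⟨k, h⟩
    · obtain ⟨s, hs, h⟩ := (hunb i a).2
      obtain ⟨k, rfl⟩ := (hmem i s).1 hs
      exact ⟨k, h⟩
  · obtain ⟨s, hs, h⟩ := hP i (θ i k)
    obtain ⟨l, rfl⟩ := (hmem i s).1 h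
    have h1 : k < l := (hθ i).lt_iff_lt.1 hs.1
    exact ((hθ i).monotone (by omega : k + 1 ≤ l)).trans_lt hs.2

namespace Marking

variable {U : Subconic dev} {ι : Type} (M : Marking U ι)

omit [ChartedSpace Plane X] [TranslationSurface X] in
theorem notMem_marks {i : ι} {k : ℤ} {t : ℝ} (ht : t ∈ Ioo (M.θ i k) (M.θ i (k + 1))) :
    M.E i t ∉ U.marks := by
  rw [M.mem_marks]
  rintro ⟨l, rfl⟩
  have h1 := (M.strictMono i).lt_iff_lt.1 ht.1
  have h2 := (M.strictMono i).lt_iff_lt.1 ht.2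
  omega

omit [ChartedSpace Plane X] [TranslationSurface X] in
theorem E_add (i : ι) (t : ℝ) (m : ℤ) : M.E i (t + m * M.P) = M.E i t :=
  ((M.eq_iff _ _ _ _).2 ⟨rfl, m, rfl⟩).symm

omit [ChartedSpace Plane X] [TranslationSurface X] in
theorem shift_le {i : ι} {k l m : ℤ} (h : M.θ i l = M.θ i k + m * M.P) :
    M.θ i (l + 1) ≤ M.θ i (k + 1) + m * M.P := by
  obtain ⟨n, hn⟩ := (M.mem_marks i (M.θ i (k + 1) + m * M.P)).1
    (by rw [M.E_add]; exact (M.mem_marks _ _).2 ⟨_, rfl⟩)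
  rw [← hn]
  refine (M.strictMono i).monotone ?_
  have : M.θ i l < M.θ i n := by
    rw [h, hn]; linarith [M.strictMono i (lt_add_one k)]
  have := (M.strictMono i).lt_iff_lt.1 this
  omega

omit [ChartedSpace Plane X] [TranslationSurface X] in
theorem shift {i : ι} {k l m : ℤ} (h : M.θ i l = M.θ i k + m * M.P) :
    M.θ i (l + 1) = M.θ i (k + 1) + m * M.P := by
  refine le_antisymm (M.shift_le h) ?_
  have := M.shift_le (k := l) (l := k) (m := -m) (by push_cast; linarith)
  push_cast at this
  linarith

omit [ChartedSpace Plane X] [TranslationSurface X] in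
theorem shift_pred {i : ι} {k l m : ℤ} (h : M.θ i l = M.θ i k + m * M.P) :
    M.θ i (l - 1) = M.θ i (k - 1) + m * M.P := by
  obtain ⟨n, hn⟩ := (M.mem_marks i (M.θ i (k - 1) + m * M.P)).1
    (by rw [M.E_add]; exact (M.mem_marks _ _).2 ⟨_, rfl⟩)
  have h1 := M.shift hn
  rw [sub_add_cancel, ← h] at h1
  have := (M.strictMono i).injective h1
  rw [← hn, ← this, add_sub_cancel_right]

variable (hdev : IsDevelopingMap dev) {x : X} (hx : x ∈ U.1)
include hdev hx

theorem exists_successor : ∃ (z : ι → ℤ → U.conePoints) (s : Equiv.Perm U.conePoints),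
    (∀ i k, devExt dev (z i k) = M.E i (M.θ i k)) ∧ (∀ ξ, ∃ i k, z i k = ξ) ∧
    (∀ i j k l, z i k = z j l ↔ i = j ∧ ∃ m : ℤ, M.θ j l = M.θ i k + m * M.P) ∧
    (∀ i k, s (z i k) = z i (k + 1)) ∧ U.IsSuccessorFunction s := by
  have hmark : ∀ i k, M.E i (M.θ i k) ∈ U.marks := fun i k => (M.mem_marks _ _).2 ⟨k, rfl⟩
  let z : ι → ℤ → U.conePoints := fun i k =>
    ⟨limitPoint dev x (M.E i (M.θ i k)), U.limitPoint_mem_conePoints hdev hx (hmark i k)⟩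
  have hz : ∀ i k, devExt dev (z i k) = M.E i (M.θ i k) := fun i k =>
    U.devExt_limitPoint hdev hx (M.E_mem i _)
  have hinj : ∀ {ξ ξ' : U.conePoints}, devExt dev ξ = devExt dev ξ' → ξ = ξ' := by
    intro ξ ξ' h
    apply Subtype.ext
    rw [← U.limitPoint_devExt hdev hx ξ.2.1, h, U.limitPoint_devExt hdev hx ξ'.2.1]
  have hsurj : ∀ ξ : U.conePoints, ∃ q : ι × ℤ, z q.1 q.2 = ξ := by
    intro ξ
    obtain ⟨i, t, ht⟩ := (M.mem_frontier _).1 (U.devExt_mem_frontier hdev hx ξ.2.1)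
    have h1 : M.E i t ∈ U.marks := ht ▸ ⟨ξ, ξ.2, rfl⟩
    obtain ⟨k, rfl⟩ := (M.mem_marks i t).1 h1
    exact ⟨(i, k), hinj (by rw [hz, ht])⟩
  have hzz : ∀ {i j k l}, z i k = z j l ↔ i = j ∧ ∃ m : ℤ, M.θ j l = M.θ i k + m * M.P := by
    intro i j k l
    rw [← M.eq_iff, ← hz, ← hz]
    exact ⟨fun h => by rw [h], hinj⟩
  have hsucc : ∀ {i j k l}, z i k = z j l → z i (k + 1) = z j (l + 1) := by
    intro i j k l h
    obtain ⟨rfl, m, hm⟩ := hzz.1 h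
    exact hzz.2 ⟨rfl, m, M.shift hm⟩
  have hpred : ∀ {i j k l}, z i k = z j l → z i (k - 1) = z j (l - 1) := by
    intro i j k l h
    obtain ⟨rfl, m, hm⟩ := hzz.1 h
    exact hzz.2 ⟨rfl, m, M.shift_pred hm⟩
  choose q hq using hsurj
  let s : Equiv.Perm U.conePoints :=
    { toFun := fun ξ => z (q ξ).1 ((q ξ).2 + 1)
      invFun := fun ξ => z (q ξ).1 ((q ξ).2 - 1)
      left_inv := fun ξ => by
        have := hpred (hq (z (q ξ).1 ((q ξ).2 + 1)))
        exact this.trans (by rw [add_sub_cancel_right, hq])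
      right_inv := fun ξ => by
        have := hsucc (hq (z (q ξ).1 ((q ξ).2 - 1)))
        exact this.trans (by rw [sub_add_cancel, hq]) }
  have hs : ∀ i k, s (z i k) = z i (k + 1) := fun i k => hsucc (hq (z i k))
  refine ⟨z, s, hz, fun ξ => ⟨_, _, hq ξ⟩, fun _ _ _ _ => hzz, hs, fun ξ ζ => ⟨?_, ?_⟩⟩
  · rintro rfl
    obtain ⟨⟨i, k⟩, rfl⟩ : ∃ q : ι × ℤ, z q.1 q.2 = ξ := ⟨_, hq ξ⟩
    rw [hs]
    exact U.isSuccessor_of_arc hdev hx (M.strictMono i (lt_add_one k))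
      (M.lt_add.imp_right fun h => h i k) fun t ht => M.notMem_marks ht
  · rintro ⟨-, η, hη, α, hα, hαc, h0, h1⟩
    obtain ⟨i, t, ht⟩ := (M.mem_frontier _).1 (U.devExt_mem_frontier hdev hx hη.1)
    obtain ⟨k, hk1, hk2⟩ := M.exists_between i t
    have hne : M.θ i k ≠ t := by
      intro h
      refine hη.2 ((U.devExt_mem_marks hdev hx hη.1).1 ?_)
      rw [← ht, M.mem_marks]
      exact ⟨k, h⟩
    obtain ⟨h2, h3⟩ := U.eq_of_orientedPath hdev hx (M.strictMono i (lt_add_one k))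
      (M.lt_add.imp_right fun h => h i k) (hmark i k) (hmark i (k + 1))
      (fun t ht => M.notMem_marks ht) hη ⟨t, ⟨lt_of_le_of_ne hk1 hne, hk2⟩, ht⟩ hα hαc
      (h0 ▸ ξ.2.2) (h1 ▸ ζ.2.2)
    have h4 : ξ = z i k := Subtype.ext (by rw [← h0, h2])
    have h5 : ζ = z i (k + 1) := Subtype.ext (by rw [← h1, h3])
    rw [h4, h5, hs]

end Marking

end Marking

end TranslationConics
end

noncomputable section
namespace TranslationConics

section Params

theorem Frame.cross_map (F : Frame) (A B C D A' B' C' D' : ℝ) :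
    cross (F.map A B - F.map C D) (F.map A' B' - F.map C' D') =
      cross F.a F.b * ((A - C) * (B' - D') - (B - D) * (A' - C')) := by
  simp [cross, Frame.map]; ring

theorem Frame.cross_vec (F : Frame) (A B A' B' C' D' : ℝ) :
    cross (A • F.a + B • F.b) (F.map A' B' - F.map C' D') =
      cross F.a F.b * (A * (B' - D') - B * (A' - C')) := by
  simp [cross, Frame.map]; ring

theorem exists_cos_sin {A B : ℝ} (h : A ^ 2 + B ^ 2 = 1) : ∃ t, Real.cos t = A ∧ Real.sin t = B := by
  have hn : ‖(⟨A, B⟩ : ℂ)‖ = 1 := by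
    rw [← sq_eq_sq₀ (norm_nonneg _) zero_le_one, Complex.sq_norm, Complex.normSq_mk]; linarith
  have h0 : (⟨A, B⟩ : ℂ) ≠ 0 := by
    intro h; rw [h, norm_zero] at hn; exact zero_ne_one hn
  exact ⟨Complex.arg ⟨A, B⟩, by rw [Complex.cos_arg h0, hn, div_one], by
    rw [Complex.sin_arg, hn, div_one]⟩

theorem cos_sin_eq_iff {s t : ℝ} : (Real.cos s = Real.cos t ∧ Real.sin s = Real.sin t) ↔
    ∃ m : ℤ, t = s + m * (2 * Real.pi) := by
  constructor
  · rintro ⟨h1, h2⟩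
    have := Real.Angle.cos_sin_inj h1 h2
    obtain ⟨k, hk⟩ := Real.Angle.angle_eq_iff_two_pi_dvd_sub.1 this
    exact ⟨-k, by push_cast; linarith⟩
  · rintro ⟨m, rfl⟩
    exact ⟨(Real.cos_add_int_mul_two_pi s m).symm, (Real.sin_add_int_mul_two_pi s m).symm⟩

theorem exists_add_mem_Ico (a t : ℝ) : ∃ m : ℤ, t + m * (2 * Real.pi) ∈ Ico a (a + 2 * Real.pi) := by
  obtain ⟨m, hm, -⟩ := existsUnique_add_zsmul_mem_Ico Real.two_pi_pos t a
  exact ⟨m, by simpa using hm⟩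

variable {X : Type*} [MetricSpace X] {dev : X → Plane} {U : Subconic dev} {c : Fin 6 → ℝ} {F : Frame}

theorem Subconic.IsEllipseIn.mem_image (h : U.IsEllipseIn c F) {A B : ℝ} :
    F.map A B ∈ dev '' U.1 ↔ A ^ 2 + B ^ 2 < 1 := by
  rw [h.1, mem_ofPred_eq, h.2, sub_neg]

theorem Subconic.IsEllipseIn.mem_frontier (h : U.IsEllipseIn c F) {A B : ℝ} :
    F.map A B ∈ frontier (dev '' U.1) ↔ A ^ 2 + B ^ 2 = 1 := by
  rw [h.1, frontier_quadric (p := F.map 0 0) (by rw [h.2]; norm_num), mem_ofPred_eq, h.2, sub_eq_zero]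

theorem Subconic.IsBandIn.mem_image (h : U.IsBandIn c F) {A B : ℝ} :
    F.map A B ∈ dev '' U.1 ↔ -1 < B ∧ B < 1 := by
  rw [h.image_eq, F.map_mem_band]

/-- The parametrization of an ellipse by the eccentric angle. -/
def Subconic.IsEllipseIn.param (h : U.IsEllipseIn c F) : BoundaryParam (dev '' U.1) Unit where
  E _ t := F.map (Real.cos t) (Real.sin t)
  E' _ t := -Real.sin t • F.a + Real.cos t • F.b
  P := 2 * Real.pi
  P_nonneg := Real.two_pi_pos.le
  hasDerivAt _ t := by
    have h1 := (Real.hasDerivAt_cos t).smul_const F.a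
    have h2 := (Real.hasDerivAt_sin t).smul_const F.b
    have h3 := (h1.add h2).const_add F.o
    refine HasDerivAt.congr_of_eventuallyEq h3 (Eventually.of_forall fun s => ?_)
    simp [Frame.map, add_assoc]
  mem_frontier v := by
    constructor
    · intro hv
      obtain ⟨A, B, rfl⟩ := F.exists_map v
      obtain ⟨t, rfl, rfl⟩ := exists_cos_sin (h.mem_frontier.1 hv)
      exact ⟨(), t, rfl⟩
    · rintro ⟨-, t, rfl⟩
      exact h.mem_frontier.2 (Real.cos_sq_add_sin_sq t)
  eq_iff i j s t := by
    rw [F.map_inj, cos_sin_eq_iff]; simp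
  isClosed _ a b hab := by
    have hab' : b ≤ a + 2 * Real.pi := hab.resolve_left Real.two_pi_pos.ne'
    rcases le_or_gt b a with hba | hba
    · rw [Ioo_eq_empty (not_lt.2 hba), image_empty, sdiff_empty]; exact isClosed_frontier
    have : frontier (dev '' U.1) \ (fun t => F.map (Real.cos t) (Real.sin t)) '' Ioo a b =
        (fun t => F.map (Real.cos t) (Real.sin t)) '' Icc b (a + 2 * Real.pi) := by
      ext v
      constructor
      · rintro ⟨hv, hv'⟩
        obtain ⟨A, B, rfl⟩ := F.exists_map v
        obtain ⟨t, rfl, rfl⟩ := exists_cos_sin (h.mem_frontier.1 hv)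
        obtain ⟨m, hm⟩ := exists_add_mem_Ico a t
        have he := cos_sin_eq_iff.2 ⟨m, (rfl : t + m * (2 * Real.pi) = _)⟩
        rcases hm.1.eq_or_lt with h1 | h1
        · refine ⟨a + 2 * Real.pi, ⟨hab', le_rfl⟩, ?_⟩
          dsimp only
          rw [Real.cos_add_two_pi, Real.sin_add_two_pi, h1, ← he.1, ← he.2]
        · refine ⟨_, ⟨?_, hm.2.le⟩, F.map_inj.2 ⟨he.1.symm, he.2.symm⟩⟩
          by_contra! hcon
          exact hv' ⟨_, ⟨h1, hcon⟩, F.map_inj.2 ⟨he.1.symm, he.2.symm⟩⟩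
      · rintro ⟨t, ht, rfl⟩
        refine ⟨h.mem_frontier.2 (Real.cos_sq_add_sin_sq t), ?_⟩
        rintro ⟨s, hs, hst⟩
        obtain ⟨m, hm⟩ := cos_sin_eq_iff.1 (F.map_inj.1 hst)
        have hpi := Real.two_pi_pos
        have h1 : 0 < (m : ℝ) * (2 * Real.pi) := by linarith [hs.2, ht.1]
        have h2 : (m : ℝ) * (2 * Real.pi) < 1 * (2 * Real.pi) := by linarith [hs.1, ht.2]
        have h3 : (0 : ℝ) < m := pos_of_mul_pos_left h1 hpi.le
        have h4 : (m : ℝ) < 1 := lt_of_mul_lt_mul_right h2 hpi.le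
        have h5 : (0 : ℤ) < m := by exact_mod_cast h3
        have h6 : m < (1 : ℤ) := by exact_mod_cast h4
        omega
    rw [this]
    refine (isCompact_Icc.image ?_).isClosed
    exact F.continuous_map.comp (Real.continuous_cos.prodMk Real.continuous_sin)
  left _ t p hp := by
    obtain ⟨A, B, rfl⟩ := F.exists_map p
    have h1 := h.mem_image.1 hp
    rw [F.cross_vec]
    refine mul_pos F.cross_pos ?_
    nlinarith [Real.cos_sq_add_sin_sq t, sq_nonneg (A - Real.cos t), sq_nonneg (B - Real.sin t)]
  center _ t := by
    refine ⟨F.map 0 0, h.mem_image.2 (by norm_num), Real.pi, Real.pi_pos, fun s hs hc => ?_⟩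
    rw [F.cross_map] at hc
    have h1 := (mul_pos_iff_of_pos_left F.cross_pos).1 hc
    have h2 : 0 < Real.sin (s - t) := by rw [Real.sin_sub]; linarith
    by_contra! hcon
    rw [abs_lt] at hs
    linarith [Real.sin_nonpos_of_nonpos_of_neg_pi_le (x := s - t) (by linarith) (by linarith)]

/-- The orientation of the lower (`false`) and the upper (`true`) boundary line of a strip. -/
def lineSign (i : Bool) : ℝ := if i then -1 else 1

theorem lineSign_mul_self (i : Bool) : lineSign i * lineSign i = 1 := by
  cases i <;> simp [lineSign]

theorem lineSign_inj {i j : Bool} : lineSign i = lineSign j ↔ i = j := by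
  cases i <;> cases j <;> norm_num [lineSign]

/-- The oriented parametrization of the boundary of a strip. -/
def Subconic.IsBandIn.param (h : U.IsBandIn c F) : BoundaryParam (dev '' U.1) Bool where
  E i t := F.map (lineSign i * t) (-lineSign i)
  E' i _ := lineSign i • F.a
  P := 0
  P_nonneg := le_rfl
  hasDerivAt i t := by
    have h1 := (((hasDerivAt_id t).const_mul (lineSign i)).smul_const F.a).const_add
      (F.o - lineSign i • F.b)
    rw [mul_one] at h1
    refine HasDerivAt.congr_of_eventuallyEq h1 (Eventually.of_forall fun s => ?_)
    simp only [Frame.map, id]; module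
  mem_frontier v := by
    rw [h.frontier_eq, mem_ofPred_eq]
    obtain ⟨A, B, rfl⟩ := F.exists_map v
    rw [F.snd_map]
    constructor
    · rintro (rfl | rfl)
      · exact ⟨true, -A, by simp [lineSign]⟩
      · exact ⟨false, A, by simp [lineSign]⟩
    · rintro ⟨i, t, ht⟩
      rw [F.map_inj] at ht
      rw [← ht.2]
      cases i <;> simp [lineSign]
  eq_iff i j s t := by
    rw [F.map_inj, neg_inj, lineSign_inj]
    constructor
    · rintro ⟨h1, rfl⟩
      refine ⟨rfl, 0, ?_⟩
      have := congrArg (lineSign i * ·) h1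
      simp only [← mul_assoc, lineSign_mul_self, one_mul] at this
      simp [this]
    · rintro ⟨rfl, m, rfl⟩; simp
  isClosed i a b _ := by
    have : frontier (dev '' U.1) \ (fun t => F.map (lineSign i * t) (-lineSign i)) '' Ioo a b =
        frontier (dev '' U.1) ∩ ({v | 0 ≤ lineSign i * F.snd v} ∪
          ({v | lineSign i * F.fst v ≤ a} ∪ {v | b ≤ lineSign i * F.fst v})) := by
      ext v
      obtain ⟨A, B, rfl⟩ := F.exists_map v
      refine and_congr_right fun hv => ?_
      rw [h.frontier_eq, mem_ofPred_eq, F.snd_map] at hv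
      simp only [mem_union, mem_ofPred_eq, F.snd_map, F.fst_map]
      constructor
      · intro h1
        by_contra! hcon
        refine h1 ⟨lineSign i * A, hcon.2, ?_⟩
        dsimp only
        rw [← mul_assoc, lineSign_mul_self, one_mul]
        refine F.map_inj.2 ⟨rfl, ?_⟩
        have h3 := hcon.1
        cases i <;> rcases hv with rfl | rfl <;> simp [lineSign] at h3 ⊢ <;> linarith
      · rintro h1 ⟨t, ht, h2⟩
        obtain ⟨rfl, rfl⟩ := F.map_inj.1 h2
        rw [← mul_assoc, lineSign_mul_self, one_mul, mul_neg, lineSign_mul_self] at h1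
        rcases h1 with h1 | h1 | h1
        · linarith
        · linarith [ht.1]
        · linarith [ht.2]
    change IsClosed (frontier (dev '' U.1) \ (fun t => F.map (lineSign i * t) (-lineSign i)) '' Ioo a b)
    rw [this]
    exact isClosed_frontier.inter ((isClosed_le continuous_const
      (continuous_const.mul F.continuous_snd)).union ((isClosed_le (continuous_const.mul F.continuous_fst)
        continuous_const).union (isClosed_le continuous_const (continuous_const.mul F.continuous_fst))))
  left i t p hp := by
    obtain ⟨A, B, rfl⟩ := F.exists_map p
    have h1 := h.mem_image.1 hp
    have h2 := F.cross_vec (lineSign i) 0 A B (lineSign i * t) (-lineSign i)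
    rw [zero_smul, add_zero] at h2
    rw [h2]
    refine mul_pos F.cross_pos ?_
    cases i <;> simp [lineSign] <;> linarith [h1.1, h1.2]
  center i t := by
    refine ⟨F.map (lineSign i * t) 0, h.mem_image.2 (by norm_num), 1, one_pos, fun s hs hc => ?_⟩
    rw [F.cross_map] at hc
    have h1 := (mul_pos_iff_of_pos_left F.cross_pos).1 hc
    have h2 : (lineSign i * s - lineSign i * t) * (0 - -lineSign i) = (lineSign i * lineSign i) * (s - t) := by
      ring
    rw [h2, lineSign_mul_self] at h1
    linarith

end Params

end TranslationConics
end

noncomputable section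
namespace TranslationConics

section TrigQuadrics

theorem sin_half_sub_eq_zero_iff {s t : ℝ} :
    Real.sin ((s - t) / 2) = 0 ↔ ∃ m : ℤ, s = t + m * (2 * Real.pi) := by
  rw [Real.sin_eq_zero_iff]
  constructor
  · rintro ⟨m, hm⟩; exact ⟨m, by linarith⟩
  · rintro ⟨m, rfl⟩; exact ⟨m, by ring⟩

theorem two_mul_sin_half_mul_sin_half (a b t : ℝ) :
    2 * (Real.sin ((t - a) / 2) * Real.sin ((t - b) / 2)) =
      Real.cos ((a - b) / 2) - Real.cos t * Real.cos ((a + b) / 2) -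
        Real.sin t * Real.sin ((a + b) / 2) := by
  have h1 := Real.cos_sub ((t - a) / 2) ((t - b) / 2)
  have h2 := Real.cos_add ((t - a) / 2) ((t - b) / 2)
  have h3 := Real.cos_sub t ((a + b) / 2)
  rw [show (t - a) / 2 - (t - b) / 2 = -((a - b) / 2) by ring, Real.cos_neg] at h1
  rw [show (t - a) / 2 + (t - b) / 2 = t - (a + b) / 2 by ring] at h2
  linarith

/-- The quadric with prescribed zeros on an ellipse. -/
theorem Frame.exists_quadric_sin (F : Frame) (a b c d : ℝ) : ∃ h : Fin 6 → ℝ, ∀ t,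
    quadric h (F.map (Real.cos t) (Real.sin t)) = Real.sin ((t - a) / 2) * Real.sin ((t - b) / 2) *
      (Real.sin ((t - c) / 2) * Real.sin ((t - d) / 2)) := by
  set p := Real.cos ((a - b) / 2)
  set q := Real.cos ((a + b) / 2)
  set r := Real.sin ((a + b) / 2)
  set p' := Real.cos ((c - d) / 2)
  set q' := Real.cos ((c + d) / 2)
  set r' := Real.sin ((c + d) / 2)
  obtain ⟨h, hh⟩ := F.exists_quadric ![q * q' / 4, (q * r' + r * q') / 4, r * r' / 4,
    -(p * q' + q * p') / 4, -(p * r' + r * p') / 4, p * p' / 4]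
  refine ⟨h, fun t => ?_⟩
  have h1 := two_mul_sin_half_mul_sin_half a b t
  have h2 := two_mul_sin_half_mul_sin_half c d t
  have h3 : Real.sin ((t - a) / 2) * Real.sin ((t - b) / 2) =
      (p - Real.cos t * q - Real.sin t * r) / 2 := by linarith
  have h4 : Real.sin ((t - c) / 2) * Real.sin ((t - d) / 2) =
      (p' - Real.cos t * q' - Real.sin t * r') / 2 := by linarith
  rw [hh, h3, h4]
  simp [quadric]
  ring

theorem PosCoeffs.eventually {c : Fin 6 → ℝ} (hc : PosCoeffs c) (h : Fin 6 → ℝ) :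
    ∀ᶠ ε in 𝓝[>] (0 : ℝ), PosCoeffs (c + ε • h) := by
  refine nhdsWithin_le_nhds ?_
  have h0 : Continuous fun ε : ℝ => (c + ε • h) 0 := by fun_prop
  have h1 : Continuous fun ε : ℝ => 4 * (c + ε • h) 0 * (c + ε • h) 2 - (c + ε • h) 1 ^ 2 := by
    fun_prop
  have e0 := h0.tendsto 0 |>.eventually (Ioi_mem_nhds (a := 0) (by simpa using hc.1))
  have e1 := h1.tendsto 0 |>.eventually (Ioi_mem_nhds (a := 0) (by simpa using hc.2))
  filter_upwards [e0, e1] with ε h2 h3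
  exact ⟨h2, sub_pos.1 h3⟩

theorem Frame.posCoeffs_of_ellipse (F : Frame) {c : Fin 6 → ℝ}
    (hF : ∀ X Y, quadric c (F.map X Y) = X ^ 2 + Y ^ 2 - 1) : PosCoeffs c := by
  refine F.posCoeffs (h := ![1, 0, 1, 0, 0, -1]) (fun X Y => ?_) (by simp [PosCoeffs])
  rw [hF]; simp [quadric]; ring

end TrigQuadrics

section Cells

open UniformSpace

variable {Y X : Type*} [MetricSpace Y] [ChartedSpace Plane Y] [TranslationSurface Y]
  [MetricSpace X] [ChartedSpace Plane X] [TranslationSurface X] {dev : X → Plane}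
  (hdev : IsDevelopingMap dev)
include hdev

theorem Subconic.IsBandIn.snd_eq_of_mem_component {U : Subconic dev} {c : Fin 6 → ℝ} {F : Frame}
    (h : U.IsBandIn c F) {x : X} (hx : x ∈ U.1) {ξ ζ : Completion X} (hξ : ξ ∈ U.boundary)
    (hζ : ζ ∈ connectedComponentIn U.boundary ξ) : F.snd (devExt dev ζ) = F.snd (devExt dev ξ) := by
  have key : ∀ η ∈ connectedComponentIn U.boundary ξ,
      F.snd (devExt dev η) = 1 ∨ F.snd (devExt dev η) = -1 := by
    intro η hη
    have := U.devExt_mem_frontier hdev hx (connectedComponentIn_subset _ _ hη)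
    rwa [h.frontier_eq] at this
  have hcont : Continuous fun η => F.snd (devExt dev η) := F.continuous_snd.comp continuous_devExt
  have hpre := (isPreconnected_connectedComponentIn (F := U.boundary) (x := ξ)).image _
    hcont.continuousOn
  have hξ' := mem_connectedComponentIn hξ
  have hno : (0 : ℝ) ∉ (fun η => F.snd (devExt dev η)) '' connectedComponentIn U.boundary ξ := by
    rintro ⟨η, hη, h0⟩
    have h0' : F.snd (devExt dev η) = 0 := h0
    rcases key η hη with h | h <;> rw [h0'] at h <;> norm_num at h
  rcases key ξ hξ' with h1 | h1 <;> rcases key ζ hζ with h2 | h2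
  · rw [h1, h2]
  · exact absurd (hpre.ordConnected.out ⟨ζ, hζ, h2⟩ ⟨ξ, hξ', h1⟩
      (by norm_num : (0 : ℝ) ∈ Icc (-1) 1)) hno
  · exact absurd (hpre.ordConnected.out ⟨ξ, hξ', h1⟩ ⟨ζ, hζ, h2⟩
      (by norm_num : (0 : ℝ) ∈ Icc (-1) 1)) hno
  · rw [h1, h2]

theorem Subconic.IsEllipseIn.isPreconnected_boundary {U : Subconic dev} {c : Fin 6 → ℝ} {F : Frame}
    (h : U.IsEllipseIn c F) {x : X} (hx : x ∈ U.1) : IsPreconnected U.boundary := by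
  have h1 : frontier (dev '' U.1) = (h.param.E ()) '' univ := by
    ext v
    rw [h.param.mem_frontier]
    exact ⟨fun ⟨_, t, ht⟩ => ⟨t, mem_univ t, ht⟩, fun ⟨t, _, ht⟩ => ⟨(), t, ht⟩⟩
  rw [U.boundary_eq hdev hx]
  refine IsPreconnected.image ?_ _ ((U.continuousOn_limitPoint hdev hx).mono frontier_subset_closure)
  rw [h1]
  exact isPreconnected_univ.image _ (h.param.continuous ()).continuousOn

variable (hY : TotallyBounded (Set.univ : Set Y)) (hYne : (metricFrontier Y).Nonempty)
  {p : X → Y} (hp : IsCoveringMap p) (hpt : IsTranslationMap p)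
include hY hYne hp hpt

theorem Subconic.exists_ellipse_of_posCoeffs {U : Subconic dev} (hU : U.1.Nonempty) {c : Fin 6 → ℝ}
    (hc : dev '' U.1 = {v | quadric c v < 0}) (hpos : PosCoeffs c) : ∃ c F, U.IsEllipseIn c F := by
  obtain ⟨c', F, h | h⟩ := U.exists_frame hdev hY hYne hp hpt hU
  · exact ⟨c', F, h⟩
  exfalso
  have h1 := F.quadPart_pos hpos
  obtain ⟨k, hk, hk0⟩ := F.exists_quadric_map c
  rw [← hk0] at h1
  have h2 : ∀ A, k 0 * A ^ 2 + k 3 * A + k 5 < 0 := by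
    intro A
    have h3 : F.map A 0 ∈ dev '' U.1 := h.mem_image.2 (by norm_num)
    rw [hc, mem_ofPred_eq, hk] at h3
    simpa [quadric] using h3
  have h4 : 0 ≤ |k 5| / k 0 := div_nonneg (abs_nonneg _) h1.le
  have h5 : k 0 * (|k 5| / k 0) = |k 5| := by field_simp
  have h6 := h2 (|k 5| / k 0 + 1)
  have h7 := h2 (-(|k 5| / k 0 + 1))
  nlinarith [neg_abs_le (k 5), mul_nonneg h4 h1.le, mul_nonneg h4 (mul_nonneg h4 h1.le)]

theorem Subconic.mem_cell_of_posCoeffs {U : Subconic dev} (hU : U.1.Nonempty) {c : Fin 6 → ℝ}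
    (hc : dev '' U.1 = {v | quadric c v < 0}) (hpos : PosCoeffs c) {Z : Set (Completion X)}
    (hZ : U.conePoints = Z) (hne : Z.Nonempty) : U ∈ cell dev Z := by
  obtain ⟨c', F, h⟩ := U.exists_ellipse_of_posCoeffs hdev hY hYne hp hpt hU hc hpos
  obtain ⟨x, hx⟩ := hU
  refine ⟨hZ, fun y hy => ?_⟩
  obtain ⟨ζ, hζ⟩ := hne
  exact ⟨ζ, (h.isPreconnected_boundary hdev hx).subset_connectedComponentIn hy subset_rfl
    (hZ.symm ▸ hζ : ζ ∈ U.conePoints).1, hζ⟩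

theorem Subconic.mem_closure_cell (hX : DiscreteTopology (metricFrontier X)) {U : Subconic dev}
    {x : X} (hx : x ∈ U.1) {c h : Fin 6 → ℝ} (hU : dev '' U.1 = {v | quadric c v < 0})
    (hpos : ∀ᶠ ε in 𝓝[>] (0 : ℝ), PosCoeffs (c + ε • h))
    (hA : ∀ ξ ∈ U.conePoints, 0 ≤ quadric h (devExt dev ξ)) {Z : Set (Completion X)}
    (hZ : {ξ ∈ U.conePoints | quadric h (devExt dev ξ) = 0} = Z) (hne : Z.Nonempty) :
    U ∈ closure (cell dev Z) := by
  obtain ⟨W, hW, h1⟩ := exists_perturbation hdev hX hx hU hpos hA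
  refine mem_closure_of_tendsto hW ?_
  filter_upwards [h1] with ε ⟨h2, h3, h4, h5⟩
  exact Subconic.mem_cell_of_posCoeffs hdev hY hYne hp hpt h4 h2 h3 (h5.trans hZ) hne

omit hYne in
theorem Subconic.IsBandIn.infinite_marks {U : Subconic dev} {c : Fin 6 → ℝ} {F : Frame}
    (h : U.IsBandIn c F) (ht : U.IsTight F) (i : Bool) :
    {t | F.map t (-lineSign i) ∈ U.marks}.Infinite := by
  obtain ⟨⟨Q, hQ, hper⟩, h1, h2⟩ := h.exists_period hdev hp hpt hY ht
  intro hfin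
  obtain ⟨b, hb⟩ := hfin.bddAbove
  have hne : {t | F.map t (-lineSign i) ∈ U.marks}.Nonempty := by
    cases i
    · obtain ⟨A, hA⟩ := h2
      refine ⟨A, ?_⟩
      simpa [lineSign] using hA
    · obtain ⟨A, hA⟩ := h1
      refine ⟨A, ?_⟩
      simpa [lineSign] using hA
  obtain ⟨t, ht, hbt⟩ := (exists_mem_lt_of_periodic hQ (fun t => hper t _) hne b).1
  exact absurd (hb ht) (not_le.2 hbt)

/-- The elements of the cells of finite dimension are ellipses. -/
theorem Subconic.exists_ellipse_of_mem_cell {U : Subconic dev} {Z : Set (Completion X)}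
    (hU : U ∈ cell dev Z) (hZ : Z.Finite) (hne : Z.Nonempty) :
    U.1.Nonempty ∧ ∃ c F, U.IsEllipseIn c F := by
  obtain ⟨ζ, hζ⟩ := hne
  have hζU : ζ ∈ U.conePoints := hU.1.symm ▸ hζ
  have hUne := Subconic.nonempty_of_mem_boundary hζU.1
  refine ⟨hUne, ?_⟩
  obtain ⟨c, F, h | h⟩ := U.exists_frame hdev hY hYne hp hpt hUne
  · exact ⟨c, F, h⟩
  exfalso
  obtain ⟨x, hx⟩ := hUne
  have hline : ∀ B, (B = 1 ∨ B = -1) → ∃ A, F.map A B ∈ U.marks := by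
    intro B hB
    have hfr : F.map 0 B ∈ frontier (dev '' U.1) := by
      rw [h.frontier_eq, mem_ofPred_eq, F.snd_map]; exact hB
    have hb := U.limitPoint_mem_boundary hdev hx hfr
    obtain ⟨η, h1, h2⟩ := hU.2 _ hb
    have h3 := h.snd_eq_of_mem_component hdev hx hb h1
    rw [U.devExt_limitPoint hdev hx hfr, F.snd_map] at h3
    refine ⟨F.fst (devExt dev η), ?_⟩
    rw [← h3, F.map_coords]
    exact ⟨η, hU.1.symm ▸ h2, rfl⟩
  have hinf := h.infinite_marks hdev hY hp hpt
    (U.isTight_of_marks hdev (hline 1 (Or.inl rfl)) (hline (-1) (Or.inr rfl))) true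
  refine hinf (Finite.preimage (f := fun t => F.map t (-lineSign true))
    (fun s _ t _ hst => (F.map_inj.1 hst).1) (s := U.marks) ?_)
  rw [marks, hU.1]
  exact hZ.image _

theorem Subconic.mem_closure_cell_of_subset (hX : DiscreteTopology (metricFrontier X))
    {U : Subconic dev} {Z T : Set (Completion X)} (hU : U ∈ cell dev Z) (hZ : Z.encard = 4)
    (hT : T.encard = 3) (hTZ : T ⊆ Z) : U ∈ closure (cell dev T) := by
  have hZfin : Z.Finite := finite_of_encard_eq_coe hZ
  have hTne : T.Nonempty := by
    rw [nonempty_iff_ne_empty]; rintro rfl; simp at hT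
  obtain ⟨⟨x, hx⟩, c, F, h⟩ := Subconic.exists_ellipse_of_mem_cell hdev hY hYne hp hpt hU hZfin
    (hTne.mono hTZ)
  obtain ⟨ζ, hζ⟩ : ∃ ζ, Z \ T = {ζ} := by
    rw [← encard_eq_one]
    have := encard_sdiff_add_encard_of_subset hTZ
    rw [hZ, hT, show (4 : ℕ∞) = 1 + 3 by norm_num] at this
    exact WithTop.add_right_cancel (by norm_num : (3 : ℕ∞) ≠ ⊤) this
  obtain ⟨ξ₁, ξ₂, ξ₃, h12, h13, h23, rfl⟩ := encard_eq_three.1 hT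
  have hang : ∀ ξ ∈ Z, ∃ t, devExt dev ξ = F.map (Real.cos t) (Real.sin t) := by
    intro ξ hξ
    have h1 := U.devExt_mem_frontier hdev hx (hU.1.symm ▸ hξ : ξ ∈ U.conePoints).1
    obtain ⟨_, t, ht⟩ := (h.param.mem_frontier _).1 h1
    exact ⟨t, ht.symm⟩
  have hζZ : ζ ∈ Z ∧ ζ ∉ ({ξ₁, ξ₂, ξ₃} : Set _) := hζ.symm.subset (mem_singleton ζ)
  obtain ⟨t₁, ht₁⟩ := hang ξ₁ (hTZ (by simp))
  obtain ⟨t₂, ht₂⟩ := hang ξ₂ (hTZ (by simp))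
  obtain ⟨t₃, ht₃⟩ := hang ξ₃ (hTZ (by simp))
  obtain ⟨t, ht⟩ := hang ζ hζZ.1
  have hne : ∀ ξ ∈ ({ξ₁, ξ₂, ξ₃} : Set (Completion X)), ∀ s,
      devExt dev ξ = F.map (Real.cos s) (Real.sin s) → Real.sin ((t - s) / 2) ≠ 0 := by
    intro ξ hξ s hs h0
    obtain ⟨m, rfl⟩ := sin_half_sub_eq_zero_iff.1 h0
    rw [Real.cos_add_int_mul_two_pi, Real.sin_add_int_mul_two_pi, ← hs] at ht
    have h1 := U.limitPoint_devExt hdev hx (hU.1.symm ▸ hζZ.1 : ζ ∈ U.conePoints).1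
    rw [ht, U.limitPoint_devExt hdev hx (hU.1.symm ▸ hTZ hξ : ξ ∈ U.conePoints).1] at h1
    exact hζZ.2 (h1 ▸ hξ)
  obtain ⟨k, hk⟩ := F.exists_quadric_sin t₁ t₁ t₂ t₃
  have hk0 : quadric k (devExt dev ζ) ≠ 0 := by
    rw [ht, hk]
    exact mul_ne_zero (mul_ne_zero (hne ξ₁ (by simp) _ ht₁) (hne ξ₁ (by simp) _ ht₁))
      (mul_ne_zero (hne ξ₂ (by simp) _ ht₂) (hne ξ₃ (by simp) _ ht₃))
  have hkT : ∀ ξ ∈ ({ξ₁, ξ₂, ξ₃} : Set (Completion X)), quadric k (devExt dev ξ) = 0 := by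
    rintro ξ (rfl | rfl | rfl)
    · rw [ht₁, hk]; simp
    · rw [ht₂, hk]; simp
    · rw [ht₃, hk]; simp
  obtain ⟨σ, hσ⟩ : ∃ σ : ℝ, 0 < σ * quadric k (devExt dev ζ) := by
    rcases lt_or_gt_of_ne hk0 with h | h
    · exact ⟨-1, by linarith⟩
    · exact ⟨1, by linarith⟩
  have hσk : ∀ v, quadric (σ • k) v = σ * quadric k v := fun v => by simp [quadric]; ring
  have hcase : ∀ ξ ∈ Z, ξ ∈ ({ξ₁, ξ₂, ξ₃} : Set (Completion X)) ∨ ξ = ζ := by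
    intro ξ hξ
    by_cases h1 : ξ ∈ ({ξ₁, ξ₂, ξ₃} : Set (Completion X))
    · exact Or.inl h1
    · exact Or.inr (hζ.subset ⟨hξ, h1⟩)
  refine Subconic.mem_closure_cell hdev hY hYne hp hpt hX hx h.1
    ((F.posCoeffs_of_ellipse h.2).eventually (σ • k)) ?_ ?_ hTne
  · intro ξ hξ
    rw [hU.1] at hξ
    rw [hσk]
    rcases hcase ξ hξ with h1 | rfl
    · rw [hkT ξ h1, mul_zero]
    · exact hσ.le
  · ext ξ
    rw [mem_ofPred_eq, hU.1, hσk]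
    constructor
    · rintro ⟨hξ, h0⟩
      rcases hcase ξ hξ with h1 | rfl
      · exact h1
      · exact absurd h0 hσ.ne'
    · intro hξ
      exact ⟨hTZ hξ, by rw [hkT ξ hξ, mul_zero]⟩

theorem link_adj_iff (hX : DiscreteTopology (metricFrontier X)) {U : Subconic dev}
    (hU : 5 ≤ U.conePoints.encard) {v w : LinkVertex U} {Z W : Set (Completion X)}
    (hv : v.1 = cell dev Z) (hZ : Z.encard = 4) (hw : w.1 = cell dev W) (hW : W.encard = 4) :
    (link U).Adj v w ↔ Z ≠ W ∧ 3 ≤ (Z ∩ W).encard := by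
  have hcell : ∀ Z : Set (Completion X), Z.encard ≤ 4 → U ∉ cell dev Z := by
    intro Z hZ h
    rw [← h.1] at hZ
    exact absurd (hU.trans hZ) (by norm_num)
  obtain ⟨A, hA⟩ := v.2.1.1
  obtain ⟨B, hB⟩ := w.2.1.1
  constructor
  · rintro ⟨hne, D, ⟨-, T, hT, rfl⟩, -, hsub⟩
    refine ⟨fun h => hne (Subtype.ext (by rw [hv, hw, h])), ?_⟩
    have key : ∀ {A : Subconic dev} {Z : Set (Completion X)}, A ∈ cell dev Z → Z.encard = 4 →
        A ∈ cellBoundary (cell dev T) → T ⊆ Z := by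
      intro A Z hA hZ h
      have h1 := (Subconic.exists_ellipse_of_mem_cell hdev hY hYne hp hpt hA
        (finite_of_encard_eq_coe hZ) (by rw [nonempty_iff_ne_empty]; rintro rfl; simp at hZ)).1
      have h2 := subset_conePoints_of_mem_closure hdev h1 h.1
      rwa [hA.1] at h2
    have h3 : (3 : ℕ∞) = T.encard := hT.symm
    rw [h3]
    exact encard_le_encard (subset_inter (key (hv ▸ hA) hZ (hsub (Or.inl hA)))
      (key (hw ▸ hB) hW (hsub (Or.inr hB))))
  · rintro ⟨hne, h3⟩
    obtain ⟨T, hT, hT3⟩ := exists_subset_encard_eq h3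
    have hTne : ∀ {Z : Set (Completion X)}, Z.encard = 4 → Z ≠ T := by
      rintro Z hZ rfl
      rw [hT3] at hZ; norm_num at hZ
    have hdisj : ∀ {A : Subconic dev} {Z : Set (Completion X)}, A ∈ cell dev Z → Z.encard = 4 →
        T ⊆ Z → A ∈ cellBoundary (cell dev T) := by
      intro A Z hA hZ hTZ
      exact ⟨Subconic.mem_closure_cell_of_subset hdev hY hYne hp hpt hX hA hZ hT3 hTZ,
        fun h => hTne hZ (hA.1.symm.trans h.1)⟩
    refine ⟨fun h => ?_, cell dev T, ⟨?_, T, hT3, rfl⟩, ⟨⟨v.2.2, ?_⟩, ⟨w.2.2, ?_⟩⟩, ?_⟩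
    · have h1 : A ∈ w.1 := h ▸ hA
      rw [hv] at hA
      rw [hw] at h1
      exact hne (hA.1.symm.trans h1.1)
    · have := (hdisj (hv ▸ hA) hZ (hT.trans inter_subset_left)).1
      exact closure_nonempty_iff.1 ⟨A, this⟩
    · rw [hv]; exact hcell Z hZ.le
    · rw [hw]; exact hcell W hW.le
    · rintro A (hA | hA)
      · exact hdisj (hv ▸ hA) hZ (hT.trans inter_subset_left)
      · exact hdisj (hw ▸ hA) hW (hT.trans inter_subset_right)

end Cells

end TranslationConics
end

noncomputable section
namespace TranslationConics

section FiveZeros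

open Polynomial in
/-- A quadric that meets the unit circle in five points contains the circle. -/
theorem quadric_eq_zero_of_five {h : Fin 6 → ℝ} {q : Fin 5 → ℝ × ℝ} (hinj : Function.Injective q)
    (hq : ∀ j, (q j).1 ^ 2 + (q j).2 ^ 2 = 1) (h0 : ∀ j, quadric h !₂[(q j).1, (q j).2] = 0)
    {A B : ℝ} (hAB : A ^ 2 + B ^ 2 = 1) : quadric h !₂[A, B] = 0 := by
  let P : ℂ[X] := C ((h 0 - h 2 : ℂ) / 4 - Complex.I * h 1 / 4) * Polynomial.X ^ 4 +
    C ((h 3 : ℂ) / 2 - Complex.I * h 4 / 2) * Polynomial.X ^ 3 +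
    C ((h 0 + h 2 : ℂ) / 2 + h 5) * Polynomial.X ^ 2 +
    C ((h 3 : ℂ) / 2 + Complex.I * h 4 / 2) * Polynomial.X +
    C ((h 0 - h 2 : ℂ) / 4 + Complex.I * h 1 / 4)
  have key : ∀ A B : ℝ, A ^ 2 + B ^ 2 = 1 →
      P.eval ((A : ℂ) + Complex.I * B) = ((A : ℂ) + Complex.I * B) ^ 2 * quadric h !₂[A, B] := by
    intro A B hAB
    have hAB' : (A : ℂ) ^ 2 + (B : ℂ) ^ 2 = 1 := by exact_mod_cast hAB
    have hI := Complex.I_sq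
    set w : ℂ := (A : ℂ) + Complex.I * B with hw
    have h1 : w ^ 2 + 1 = 2 * A * w := by
      rw [hw]; linear_combination hAB' * (-1) + (B : ℂ) ^ 2 * hI
    have h2 : w ^ 2 - 1 = 2 * Complex.I * B * w := by
      rw [hw]; linear_combination hAB' - (B : ℂ) ^ 2 * hI
    have h3 : (w ^ 2 + 1) ^ 2 = 4 * A ^ 2 * w ^ 2 := by rw [h1]; ring
    have h4 : (w ^ 2 - 1) ^ 2 = -4 * B ^ 2 * w ^ 2 := by
      rw [h2]; linear_combination 4 * (B : ℂ) ^ 2 * w ^ 2 * hI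
    have h5 : w ^ 4 - 1 = 4 * Complex.I * A * B * w ^ 2 := by
      linear_combination (w ^ 2 - 1) * h1 + 2 * A * w * h2
    have h6 : w * (w ^ 2 + 1) = 2 * A * w ^ 2 := by rw [h1]; ring
    have h7 : w * (w ^ 2 - 1) = 2 * Complex.I * B * w ^ 2 := by rw [h2]; ring
    have h8 : P.eval w = h 0 * (w ^ 2 + 1) ^ 2 / 4 - h 2 * (w ^ 2 - 1) ^ 2 / 4 -
        Complex.I * h 1 * (w ^ 4 - 1) / 4 + h 3 * (w * (w ^ 2 + 1)) / 2 -
        Complex.I * h 4 * (w * (w ^ 2 - 1)) / 2 + h 5 * w ^ 2 := by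
      simp only [P, eval_add, eval_mul, eval_C, eval_pow, eval_X]; ring
    rw [h8, h3, h4, h5, h6, h7]
    simp only [quadric]
    push_cast
    simp
    linear_combination (-(h 1 : ℂ) * A * B * w ^ 2 - h 4 * B * w ^ 2) * hI
  have hdeg : P.natDegree < Fintype.card (Fin 5) := by
    have : P.natDegree ≤ 4 := by
      simp only [P]; compute_degree
    simpa using Nat.lt_succ_of_le this
  have hP : P = 0 := by
    refine Polynomial.eq_zero_of_natDegree_lt_card_of_eval_eq_zero P
      (f := fun j => ((q j).1 : ℂ) + Complex.I * (q j).2) (fun i j hij => hinj ?_) (fun j => ?_) hdeg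
    · have h1 := congrArg Complex.re hij
      have h2 := congrArg Complex.im hij
      simp at h1 h2
      exact Prod.ext h1 h2
    · rw [key _ _ (hq j), h0]; simp
  have h1 := key A B hAB
  rw [hP, eval_zero] at h1
  have hw : ((A : ℂ) + Complex.I * B) ≠ 0 := by
    intro h
    have h2 := congrArg Complex.re h
    have h3 := congrArg Complex.im h
    simp at h2 h3
    rw [h2, h3] at hAB; norm_num at hAB
  have := (mul_eq_zero.1 h1.symm).resolve_left (pow_ne_zero 2 hw)
  exact_mod_cast this

/-- The quadrics with four given zeros on an ellipse. -/
theorem Frame.exists_eq_sin (F : Frame) (k : Fin 6 → ℝ) {t : Fin 5 → ℝ}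
    (hinj : Function.Injective fun j => F.map (Real.cos (t j)) (Real.sin (t j)))
    (h0 : ∀ j, j ≠ 0 → quadric k (F.map (Real.cos (t j)) (Real.sin (t j))) = 0) :
    ∃ d : ℝ, ∀ s, quadric k (F.map (Real.cos s) (Real.sin s)) =
      d * (Real.sin ((s - t 1) / 2) * Real.sin ((s - t 2) / 2) *
      (Real.sin ((s - t 3) / 2) * Real.sin ((s - t 4) / 2))) := by
  obtain ⟨g, hg⟩ := F.exists_quadric_sin (t 1) (t 2) (t 3) (t 4)
  have hne : ∀ j, j ≠ 0 → Real.sin ((t 0 - t j) / 2) ≠ 0 := by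
    intro j hj h
    obtain ⟨m, hm⟩ := sin_half_sub_eq_zero_iff.1 h
    refine hj (hinj ?_)
    have := cos_sin_eq_iff.2 ⟨m, hm⟩
    exact F.map_inj.2 this
  have hg0 : quadric g (F.map (Real.cos (t 0)) (Real.sin (t 0))) ≠ 0 := by
    rw [hg]
    exact mul_ne_zero (mul_ne_zero (hne 1 (by decide)) (hne 2 (by decide)))
      (mul_ne_zero (hne 3 (by decide)) (hne 4 (by decide)))
  set d := quadric k (F.map (Real.cos (t 0)) (Real.sin (t 0))) /
    quadric g (F.map (Real.cos (t 0)) (Real.sin (t 0))) with hd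
  have hlin : ∀ v, quadric (k - d • g) v = quadric k v - d * quadric g v := fun v => by
    simp [quadric]; ring
  obtain ⟨h, hh, -⟩ := F.exists_quadric_map (k - d • g)
  refine ⟨d, fun s => ?_⟩
  rw [← hg]
  have h1 := quadric_eq_zero_of_five (h := h) (q := fun j => (Real.cos (t j), Real.sin (t j)))
    (fun i j hij => hinj (by simp only [Prod.mk.injEq] at hij; exact F.map_inj.2 hij))
    (fun j => Real.cos_sq_add_sin_sq _) (fun j => ?_) (Real.cos_sq_add_sin_sq s)
  · rw [← hh, hlin] at h1
    linarith
  · rw [← hh, hlin]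
    by_cases hj : j = 0
    · subst hj
      rw [hd, div_mul_cancel₀ _ hg0, sub_self]
    · rw [h0 j hj, hg]
      have : ∀ i, Real.sin ((t i - t i) / 2) = 0 := fun i => by simp
      fin_cases j
      · exact absurd rfl hj
      · simp
      · simp
      · simp
      · simp

end FiveZeros

end TranslationConics
end

noncomputable section
namespace TranslationConics

open UniformSpace

/-- The combinatorial description of the vertices of a link: `s` has no short cycles, and the
vertices are the sets `quad s ξ ζ` with `R ξ ζ`. -/
structure IsLinkRelation {X : Type*} [MetricSpace X] {dev : X → Plane} (U : Subconic dev)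
    (s : Equiv.Perm U.conePoints) (R : U.conePoints → U.conePoints → Prop) : Prop where
  pow_ne : ∀ ξ, ∀ k : ℕ, 1 ≤ k → k ≤ 4 → (s ^ k) ξ ≠ ξ
  symm : ∀ ξ ζ, R ξ ζ → R ζ ξ
  ne : ∀ ξ ζ, R ξ ζ → ζ ≠ ξ ∧ ζ ≠ s ξ ∧ ξ ≠ s ζ
  succ : ∀ ξ ζ, R ξ ζ → ζ ≠ s (s ξ) → R (s ξ) ζ
  pred : ∀ ξ ζ, R ξ ζ → ξ ≠ s (s ζ) → R (s⁻¹ ξ) ζ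
  vertex : ∀ Z : Set (Completion X), Z.encard = 4 →
    (U ∈ closure (cell dev Z) ↔ ∃ ξ ζ, R ξ ζ ∧ Z = quad s ξ ζ)
  of_quad : ∀ a b ξ ζ, R a b → quad s a b = quad s ξ ζ → R ξ ζ

section Vertices

variable {Y X : Type*} [MetricSpace Y] [ChartedSpace Plane Y] [TranslationSurface Y]
  [MetricSpace X] [ChartedSpace Plane X] [TranslationSurface X] {dev : X → Plane}
  (hdev : IsDevelopingMap dev)
include hdev

theorem exists_quadric_of_mem_closure_cell
    (hY : TotallyBounded (Set.univ : Set Y)) (hYne : (metricFrontier Y).Nonempty)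
    {p : X → Y} (hp : IsCoveringMap p) (hpt : IsTranslationMap p) {U : Subconic dev} {x : X}
    (hx : x ∈ U.1) {Z : Set (Completion X)} (hZ : Z.encard = 4) (h : U ∈ closure (cell dev Z)) :
    Z ⊆ U.conePoints ∧ ∃ c, PosCoeffs c ∧ ∀ ξ ∈ U.conePoints, 0 ≤ quadric c (devExt dev ξ) ∧
      (quadric c (devExt dev ξ) = 0 ↔ ξ ∈ Z) := by
  have hZU := subset_conePoints_of_mem_closure hdev ⟨x, hx⟩ h
  refine ⟨hZU, ?_⟩
  obtain ⟨W, hxW, hW⟩ := mem_closure_iff.1 h _ (isOpen_subconic_mem x) hx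
  have hxW' : x ∈ W.1 := hxW
  obtain ⟨-, c, F, hc⟩ := Subconic.exists_ellipse_of_mem_cell hdev hY hYne hp hpt hW
    (finite_of_encard_eq_coe hZ) (by rw [nonempty_iff_ne_empty]; rintro rfl; simp at hZ)
  refine ⟨c, F.posCoeffs_of_ellipse hc.2, fun ξ hξ => ?_⟩
  have h1 : devExt dev ξ ∈ U.marks := ⟨ξ, hξ, rfl⟩
  have h2 := ((U.mem_marks hdev hx).1 h1).2
  have hfr : ∀ v, v ∈ frontier (dev '' W.1) ↔ quadric c v = 0 := by
    intro v
    rw [hc.1, frontier_quadric (p := F.map 0 0) (by rw [hc.2]; norm_num)]; rfl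
  refine ⟨?_, fun h0 => ?_, fun hξZ => ?_⟩
  · by_contra! hcon
    exact h2 (W.image_subset hdev hxW' (by rw [hc.1]; exact hcon))
  · have h3 : devExt dev ξ ∈ W.marks := (W.mem_marks hdev hxW').2 ⟨(hfr _).2 h0, h2⟩
    have h4 := W.limitPoint_mem_conePoints hdev hxW' h3
    rwa [U.limitPoint_devExt hdev hx hξ.1, hW.1] at h4
  · rw [← hfr]
    exact W.devExt_mem_frontier hdev hxW' (hW.1.symm ▸ hξZ : ξ ∈ W.conePoints).1

omit [ChartedSpace Plane X] [TranslationSurface X] hdev in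
theorem quad_comm {U : Subconic dev} (s : Equiv.Perm U.conePoints) (ξ ζ : U.conePoints) :
    quad s ξ ζ = quad s ζ ξ := by
  ext w; simp only [quad, mem_insert_iff, mem_singleton_iff]; tauto

omit [ChartedSpace Plane X] [TranslationSurface X] hdev in
theorem encard_quad {U : Subconic dev} {s : Equiv.Perm U.conePoints} {ξ ζ : U.conePoints}
    (h1 : s ξ ≠ ξ) (h2 : s ζ ≠ ζ) (h : ζ ≠ ξ ∧ ζ ≠ s ξ ∧ ξ ≠ s ζ) :
    (quad s ξ ζ).encard = 4 := by
  have h3 : s ξ ≠ s ζ := fun e => h.1 (s.injective e).symm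
  unfold quad
  rw [encard_insert_of_notMem, encard_insert_of_notMem, encard_insert_of_notMem, encard_singleton]
  · norm_num
  all_goals
    simp only [mem_insert_iff, mem_singleton_iff, Subtype.coe_inj, not_or]
  · exact h2.symm
  · exact ⟨h.2.1.symm, h3⟩
  · exact ⟨h1.symm, h.1.symm, h.2.2⟩

omit [ChartedSpace Plane X] [TranslationSurface X] hdev in
theorem ne_of_encard_quad {U : Subconic dev} {s : Equiv.Perm U.conePoints} {ξ ζ : U.conePoints}
    (h : (quad s ξ ζ).encard = 4) : ζ ≠ ξ ∧ ζ ≠ s ξ ∧ ξ ≠ s ζ := by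
  have key : ∀ a b c : Completion X, ¬ (4 : ℕ∞) ≤ ({a, b, c} : Set (Completion X)).encard := by
    intro a b c h
    have := h.trans (encard_insert_le _ _)
    have h2 := this.trans (add_le_add_left (encard_insert_le _ _) 1)
    rw [encard_singleton] at h2
    norm_num at h2
  refine ⟨?_, ?_, ?_⟩
  · rintro rfl
    refine key ζ (s ζ) (s ζ) (h.symm.trans_le (encard_le_encard fun w hw => ?_))
    simp only [quad, mem_insert_iff, mem_singleton_iff] at *; tauto
  · rintro rfl
    refine key ξ (s ξ) (s (s ξ)) (h.symm.trans_le (encard_le_encard fun w hw => ?_))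
    simp only [quad, mem_insert_iff, mem_singleton_iff] at *; tauto
  · rintro rfl
    refine key ζ (s ζ) (s (s ζ)) (h.symm.trans_le (encard_le_encard fun w hw => ?_))
    simp only [quad, mem_insert_iff, mem_singleton_iff] at *; tauto

/-- The cone points of an ellipse, enumerated in the positive direction. -/
structure CircularMarks (U : Subconic dev) (F : Frame) (s : Equiv.Perm U.conePoints) where
  /-- the eccentric angles -/
  θ : ℤ → ℝ
  /-- the cone points -/
  z : ℤ → U.conePoints
  strictMono : StrictMono θ
  devExt_z : ∀ k, devExt dev (z k) = F.map (Real.cos (θ k)) (Real.sin (θ k))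
  exists_z : ∀ k ξ, ∃ m, z m = ξ ∧ θ k ≤ θ m ∧ θ m < θ k + 2 * Real.pi
  inj : ∀ k l, z k = z l → |θ k - θ l| < 2 * Real.pi → k = l
  succ_z : ∀ k, s (z k) = z (k + 1)
  exists_add : ∀ k, ∃ m, θ m = θ k + 2 * Real.pi ∧ z m = z k

theorem exists_circularMarks (hX : DiscreteTopology (metricFrontier X)) {U : Subconic dev}
    {c : Fin 6 → ℝ} {F : Frame} (h : U.IsEllipseIn c F) {x : X} (hx : x ∈ U.1)
    (h2 : 2 ≤ U.conePoints.encard) :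
    ∃ s : Equiv.Perm U.conePoints, U.IsSuccessorFunction s ∧ Nonempty (CircularMarks U F s) := by
  have hpi := Real.two_pi_pos
  have hadd : ∀ (t : ℝ) (m : ℤ), h.param.E () (t + m * (2 * Real.pi)) = h.param.E () t := fun t m =>
    ((h.param.eq_iff () () t _).2 ⟨rfl, m, rfl⟩).symm
  have hadd1 : ∀ t : ℝ, h.param.E () (t + 2 * Real.pi) = h.param.E () t := fun t => by
    simpa using hadd t 1
  have hex : ∀ ξ ∈ U.conePoints, ∃ t, h.param.E () t = devExt dev ξ := by
    intro ξ hξ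
    obtain ⟨_, t, ht⟩ := (h.param.mem_frontier _).1 (U.devExt_mem_frontier hdev hx hξ.1)
    exact ⟨t, ht⟩
  have hinj : ∀ {ξ ζ}, ξ ∈ U.conePoints → ζ ∈ U.conePoints → devExt dev ξ = devExt dev ζ → ξ = ζ := by
    intro ξ ζ hξ hζ he
    rw [← U.limitPoint_devExt hdev hx hξ.1, he, U.limitPoint_devExt hdev hx hζ.1]
  obtain ⟨ξ₀, hξ₀, ζ₀, hζ₀, hne⟩ : ∃ ξ ∈ U.conePoints, ∃ ζ ∈ U.conePoints, ξ ≠ ζ := by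
    have : (1 : ℕ∞) < U.conePoints.encard := lt_of_lt_of_le (by norm_num) h2
    obtain ⟨a, b, ha, hb, hab⟩ := one_lt_encard_iff.1 this
    exact ⟨a, ha, b, hb, hab⟩
  obtain ⟨M, hM⟩ := exists_marking hdev hX hx h.param (fun i => by
      obtain ⟨t, ht⟩ := hex ξ₀ hξ₀
      exact ⟨t, ht ▸ ⟨ξ₀, hξ₀, rfl⟩⟩)
    (fun i => ⟨2 * Real.pi, hpi, fun t => by rw [hadd1]⟩) (Or.inr fun i t => by
      obtain ⟨ξ, hξ, hξt⟩ : ∃ ξ ∈ U.conePoints, devExt dev ξ ≠ h.param.E () t := by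
        by_contra! hcon
        exact hne (hinj hξ₀ hζ₀ ((hcon ξ₀ hξ₀).trans (hcon ζ₀ hζ₀).symm))
      obtain ⟨r, hr⟩ := hex ξ hξ
      obtain ⟨m, hm⟩ := exists_add_mem_Ico t r
      refine ⟨_, ⟨lt_of_le_of_ne hm.1 fun he => hξt ?_, hm.2⟩, ?_⟩
      · rw [he, hadd, hr]
      · change h.param.E () _ ∈ _
        rw [hadd, hr]; exact ⟨ξ, hξ, rfl⟩)
  obtain ⟨z, s, hz, hsurj, hzz, hs, hsucc⟩ := M.exists_successor hdev hx
  have hE : ∀ t, M.E () t = F.map (Real.cos t) (Real.sin t) := fun t => by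
    rw [hM]; rfl
  have hP : M.P = 2 * Real.pi := by
    rw [hM]; rfl
  have hE' : ∀ t, M.E () t = h.param.E () t := fun t => by
    rw [hM]
  have hzex : ∀ (a : ℝ) (ξ : U.conePoints), ∃ m, z () m = ξ ∧ a ≤ M.θ () m ∧
      M.θ () m < a + 2 * Real.pi := by
    intro a ξ
    obtain ⟨t, ht⟩ := hex ξ ξ.2
    obtain ⟨m, hm⟩ := exists_add_mem_Ico a t
    obtain ⟨k, hk⟩ := (M.mem_marks () (t + m * (2 * Real.pi))).1
      (by rw [hE', hadd, ht]; exact ⟨ξ, ξ.2, rfl⟩)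
    refine ⟨k, Subtype.ext (hinj (z () k).2 ξ.2 ?_), hk ▸ hm.1, hk ▸ hm.2⟩
    rw [hz, hk, hE', hadd, ht]
  refine ⟨s, hsucc, ⟨⟨M.θ (), z (), M.strictMono (), fun k => by rw [hz, hE], fun k ξ => hzex _ ξ,
    fun k l hkl hlt => ?_, hs (), fun k => ?_⟩⟩⟩
  · refine (M.strictMono ()).injective ((M.toBoundaryParam.eq_of_abs_lt (i := ()) ?_ (Or.inr ?_)).symm)
    · rw [← hz, ← hz, hkl]
    · rw [hP]; exact hlt
  · obtain ⟨m, hm⟩ := (M.mem_marks () (M.θ () k + 2 * Real.pi)).1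
      (by rw [hE', hadd1, ← hE', ← hz]; exact ⟨z () k, (z () k).2, rfl⟩)
    refine ⟨m, hm, Subtype.ext (hinj (z () m).2 (z () k).2 ?_)⟩
    rw [hz, hz, hm, hE', hadd1, ← hE']

namespace CircularMarks

variable {U : Subconic dev} {F : Frame} {s : Equiv.Perm U.conePoints} (C : CircularMarks U F s)
include C

omit [ChartedSpace Plane X] [TranslationSurface X] hdev in
theorem zpow_z (k n : ℤ) : (s ^ n) (C.z k) = C.z (k + n) := by
  induction n using Int.induction_on with
  | zero => simp
  | succ n ih => 
    rw [add_comm, zpow_add, zpow_one, Equiv.Perm.mul_apply, ih, C.succ_z]; congr 1; ring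
  | pred n ih =>
    rw [sub_eq_neg_add, zpow_add, Equiv.Perm.mul_apply, ih, zpow_neg_one, Equiv.Perm.inv_eq_iff_eq, C.succ_z]
    congr 1; ring

omit [ChartedSpace Plane X] [TranslationSurface X] hdev in
theorem pow_ne (h5 : 5 ≤ U.conePoints.encard) (ξ : U.conePoints) (k : ℕ) (hk : 1 ≤ k) (hk4 : k ≤ 4) :
    (s ^ k) ξ ≠ ξ := by
  intro h
  have hsub : U.conePoints ⊆ (fun i : ℕ => (((s ^ i) ξ : U.conePoints) : Completion X)) '' Finset.range k := by
    intro ζ hζ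
    obtain ⟨l, rfl, -⟩ := C.exists_z 0 ξ
    obtain ⟨m, hm, -⟩ := C.exists_z 0 ⟨ζ, hζ⟩
    have hk0 : (k : ℤ) ≠ 0 := by omega
    have h1 := Int.emod_add_mul_ediv (m - l) k
    have h2 := Int.emod_nonneg (m - l) hk0
    have h3 := Int.emod_lt_of_pos (m - l) (by omega : (0 : ℤ) < k)
    obtain ⟨r, hr⟩ := Int.eq_ofNat_of_zero_le h2
    refine ⟨r, ?_, ?_⟩
    · simp only [Finset.coe_range, mem_Iio]; omega
    · have h4 : (s ^ ((m - l) : ℤ)) (C.z l) = (s ^ r) (C.z l) := by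
        rw [← h1, add_comm, zpow_add, zpow_mul, hr] 
        simp only [zpow_natCast, Equiv.Perm.mul_apply]
        have h5 : ∀ n : ℤ, ((s ^ k) ^ n) (C.z l) = C.z l := fun n => by
          exact Equiv.Perm.zpow_apply_eq_self_of_apply_eq_self h n
        rw [← Equiv.Perm.mul_apply, ← zpow_natCast s r, ← zpow_natCast s k, ← zpow_mul, ← zpow_add, add_comm, zpow_add, zpow_mul, zpow_natCast s k, Equiv.Perm.mul_apply, h5]
      dsimp only
      rw [← h4, C.zpow_z, add_sub_cancel, hm]
  have h6 := h5.trans (encard_le_encard hsub)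
  have h7 := h6.trans (encard_image_le _ _)
  rw [encard_coe_eq_coe_finsetCard, Finset.card_range] at h7
  have h8 : 5 ≤ k := by exact_mod_cast h7
  omega

omit [ChartedSpace Plane X] [TranslationSurface X] hdev in
theorem eq_quad {Z : Set (Completion X)} (hZ : Z.encard = 4) (h5 : 5 ≤ U.conePoints.encard)
    (hZU : Z ⊆ U.conePoints) {k : Fin 6 → ℝ} (hk : ∀ ξ ∈ U.conePoints, 0 ≤ quadric k (devExt dev ξ) ∧
      (quadric k (devExt dev ξ) = 0 ↔ ξ ∈ Z)) : ∃ ξ ζ, Z = quad s ξ ζ := by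
  obtain ⟨ξ₀, hξ₀, hξ₀Z⟩ : ∃ ξ ∈ U.conePoints, ξ ∉ Z := by
    by_contra! hcon
    have := h5.trans (encard_le_encard (show U.conePoints ⊆ Z from hcon))
    rw [hZ] at this
    norm_num at this
  obtain ⟨k₀, hk₀, -⟩ := C.exists_z 0 ⟨ξ₀, hξ₀⟩
  have hz₀ : (C.z k₀ : Completion X) = ξ₀ := by rw [hk₀]
  let K : Set ℤ := {m | (C.θ k₀ ≤ C.θ m ∧ C.θ m < C.θ k₀ + 2 * Real.pi) ∧ (C.z m : Completion X) ∈ Z}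
  have hKZ : (fun m => (C.z m : Completion X)) '' K = Z := by
    ext ζ
    constructor
    · rintro ⟨m, hm, rfl⟩; exact hm.2
    · intro hζ
      obtain ⟨m, hm, h1⟩ := C.exists_z k₀ ⟨ζ, hZU hζ⟩
      have h2 : (C.z m : Completion X) = ζ := by rw [hm]
      exact ⟨m, ⟨h1, h2 ▸ hζ⟩, h2⟩
  have hinjK : InjOn (fun m => (C.z m : Completion X)) K := by
    intro a ha b hb hab
    refine C.inj a b (Subtype.ext hab) ?_
    rw [abs_lt]
    constructor <;> linarith [ha.1.1, ha.1.2, hb.1.1, hb.1.2]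
  have hKcard : K.encard = 4 := by rw [← hinjK.encard_image, hKZ, hZ]
  have hKfin : K.Finite := finite_of_encard_eq_coe hKcard
  have hcard : hKfin.toFinset.card = 4 := by
    have := hKfin.encard_eq_coe_toFinset_card
    rw [hKcard] at this
    exact_mod_cast this.symm
  let e := hKfin.toFinset.orderEmbOfFin hcard
  have heK : ∀ j, e j ∈ K := fun j =>
    hKfin.mem_toFinset.1 (Finset.orderEmbOfFin_mem hKfin.toFinset hcard j)
  have hKe : ∀ m ∈ K, ∃ j, e j = m := by
    intro m hm
    have : m ∈ Set.range e := by
      rw [Finset.range_orderEmbOfFin]; simpa using hm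
    exact this
  have hgt : ∀ j, C.θ k₀ < C.θ (e j) := by
    intro j
    refine lt_of_le_of_ne (heK j).1.1 fun h => ?_
    have := C.strictMono.injective h
    have h1 := (heK j).2
    rw [← this, hz₀] at h1
    exact hξ₀Z h1
  have he01 : C.θ (e 0) < C.θ (e 1) := C.strictMono (e.strictMono (by decide))
  have he12 : C.θ (e 1) < C.θ (e 2) := C.strictMono (e.strictMono (by decide))
  have he23 : C.θ (e 2) < C.θ (e 3) := C.strictMono (e.strictMono (by decide))
  have h0 := hgt 0
  have h3 := (heK 3).1.2
  set t : Fin 5 → ℝ := ![C.θ k₀, C.θ (e 0), C.θ (e 1), C.θ (e 2), C.θ (e 3)] with ht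
  have htmono : StrictMono t := by
    rw [Fin.strictMono_iff_lt_succ]
    intro j
    fin_cases j
    · exact h0
    · exact he01
    · exact he12
    · exact he23
  have htb : ∀ j, C.θ k₀ ≤ t j ∧ t j < C.θ k₀ + 2 * Real.pi := fun j =>
    ⟨htmono.monotone (Fin.zero_le j), (htmono.monotone (Fin.le_last j)).trans_lt h3⟩
  obtain ⟨d, hd⟩ := F.exists_eq_sin k (t := t) (by
      intro i j hij
      obtain ⟨m, hm⟩ := cos_sin_eq_iff.1 (F.map_inj.1 hij)
      have hpi := Real.two_pi_pos
      have hbound : |(m : ℝ) * (2 * Real.pi)| < 1 * (2 * Real.pi) := by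
        rw [show (m : ℝ) * (2 * Real.pi) = t j - t i by rw [hm]; ring, abs_lt]
        constructor <;> linarith [(htb i).1, (htb i).2, (htb j).1, (htb j).2]
      rw [abs_mul, abs_of_pos hpi, mul_lt_mul_iff_left₀ hpi] at hbound
      have hm0 : m = 0 := Int.abs_lt_one_iff.1 (by exact_mod_cast hbound)
      rw [hm0, Int.cast_zero, zero_mul, add_zero] at hm
      exact (htmono.injective hm).symm)
    (by
      intro j hj
      have : ∀ j, quadric k (F.map (Real.cos (C.θ (e j))) (Real.sin (C.θ (e j)))) = 0 := fun j => by
        rw [← C.devExt_z]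
        exact ((hk _ (C.z (e j)).2).2).2 (heK j).2
      fin_cases j
      · exact absurd rfl hj
      · exact this 0
      · exact this 1
      · exact this 2
      · exact this 3)
  simp only [ht, Matrix.cons_val] at hd
  have hpos : ∀ a b, a < b → b < a + 2 * Real.pi → 0 < Real.sin ((b - a) / 2) := fun a b h1 h2 =>
    Real.sin_pos_of_pos_of_lt_pi (by linarith) (by linarith)
  have hneg : ∀ a b, a < b → b < a + 2 * Real.pi → Real.sin ((a - b) / 2) < 0 := fun a b h1 h2 =>
    Real.sin_neg_of_neg_of_neg_pi_lt (by linarith) (by linarith)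
  have hdpos : 0 < d := by
    have h4 := hk _ (C.z k₀).2
    have h5 : 0 < quadric k (devExt dev (C.z k₀)) := by
      refine lt_of_le_of_ne h4.1 fun h => ?_
      have h6 := h4.2.1 h.symm
      rw [hz₀] at h6
      exact hξ₀Z h6
    rw [C.devExt_z, hd] at h5
    have h6 := mul_pos (mul_pos_of_neg_of_neg (hneg _ _ h0 (by linarith)) (hneg _ _ (hgt 1) (heK 1).1.2))
      (mul_pos_of_neg_of_neg (hneg _ _ (hgt 2) (heK 2).1.2) (hneg _ _ (hgt 3) h3))
    exact pos_of_mul_pos_left h5 h6.le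
  have hnn : ∀ m, 0 ≤ d * (Real.sin ((C.θ m - C.θ (e 0)) / 2) * Real.sin ((C.θ m - C.θ (e 1)) / 2) *
      (Real.sin ((C.θ m - C.θ (e 2)) / 2) * Real.sin ((C.θ m - C.θ (e 3)) / 2))) := by
    intro m
    rw [← hd, ← C.devExt_z]
    exact (hk _ (C.z m).2).1
  have h1eq : e 1 = e 0 + 1 := by
    have hlt : e 0 < e 1 := e.strictMono (by decide)
    by_contra hne
    have hm1 : C.θ (e 0) < C.θ (e 0 + 1) := C.strictMono (by omega)
    have hm2 : C.θ (e 0 + 1) < C.θ (e 1) := C.strictMono (by omega)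
    have := hnn (e 0 + 1)
    have h4 := mul_neg_of_neg_of_pos (mul_neg_of_pos_of_neg (hpos _ _ hm1 (by linarith)) (hneg _ _ hm2 (by linarith)))
      (mul_pos_of_neg_of_neg (hneg _ _ (hm2.trans he12) (by linarith)) (hneg _ _ ((hm2.trans he12).trans he23) (by linarith)))
    nlinarith [mul_neg_of_pos_of_neg hdpos h4]
  have h3eq : e 3 = e 2 + 1 := by
    have hlt : e 2 < e 3 := e.strictMono (by decide)
    by_contra hne
    have hm1 : C.θ (e 2) < C.θ (e 2 + 1) := C.strictMono (by omega)
    have hm2 : C.θ (e 2 + 1) < C.θ (e 3) := C.strictMono (by omega)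
    have := hnn (e 2 + 1)
    have h4 := mul_neg_of_pos_of_neg (mul_pos (hpos _ _ ((he01.trans he12).trans hm1) (by linarith)) (hpos _ _ (he12.trans hm1) (by linarith)))
      (mul_neg_of_pos_of_neg (hpos _ _ hm1 (by linarith)) (hneg _ _ hm2 (by linarith)))
    nlinarith [mul_neg_of_pos_of_neg hdpos h4]
  refine ⟨C.z (e 0), C.z (e 2), ?_⟩
  rw [quad, C.succ_z, C.succ_z, ← h1eq, ← h3eq, ← hKZ]
  ext ζ
  simp only [mem_insert_iff, mem_singleton_iff]
  constructor
  · rintro ⟨m, hm, rfl⟩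
    obtain ⟨j, rfl⟩ := hKe m hm
    fin_cases j
    · exact Or.inl rfl
    · exact Or.inr (Or.inl rfl)
    · exact Or.inr (Or.inr (Or.inl rfl))
    · exact Or.inr (Or.inr (Or.inr rfl))
  · rintro (rfl | rfl | rfl | rfl)
    · exact ⟨_, heK 0, rfl⟩
    · exact ⟨_, heK 1, rfl⟩
    · exact ⟨_, heK 2, rfl⟩
    · exact ⟨_, heK 3, rfl⟩

theorem mem_closure_cell_quad
    (hY : TotallyBounded (Set.univ : Set Y)) (hYne : (metricFrontier Y).Nonempty)
    {p : X → Y} (hp : IsCoveringMap p) (hpt : IsTranslationMap p)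
    (hX : DiscreteTopology (metricFrontier X)) {c : Fin 6 → ℝ} (h : U.IsEllipseIn c F) {x : X}
    (hx : x ∈ U.1) {ξ ζ : U.conePoints} (hR : ζ ≠ ξ ∧ ζ ≠ s ξ ∧ ξ ≠ s ζ) :
    U ∈ closure (cell dev (quad s ξ ζ)) := by
  obtain ⟨k, rfl, -⟩ := C.exists_z 0 ξ
  obtain ⟨m, rfl, hkm, hm2⟩ := C.exists_z k ζ
  obtain ⟨n, hn, hzn⟩ := C.exists_add k
  have hkm' : k + 2 ≤ m := by
    have h1 := C.strictMono.le_iff_le.1 hkm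
    have h2 : m ≠ k := by rintro rfl; exact hR.1 rfl
    have h3 : m ≠ k + 1 := by rintro rfl; exact hR.2.1 (C.succ_z k).symm
    omega
  have hmn : m + 1 < n := by
    rw [← hn] at hm2
    have h1 := C.strictMono.lt_iff_lt.1 hm2
    have h2 : n ≠ m + 1 := by
      rintro rfl
      exact hR.2.2 (by rw [C.succ_z, hzn])
    omega
  have hlt : C.θ (m + 1) < C.θ k + 2 * Real.pi := hn ▸ C.strictMono hmn
  have hk1 : C.θ k < C.θ (k + 1) := C.strictMono (by omega)
  have hk2 : C.θ (k + 1) < C.θ m := C.strictMono (by omega)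
  have hm1 : C.θ m < C.θ (m + 1) := C.strictMono (by omega)
  obtain ⟨g, hg⟩ := F.exists_quadric_sin (C.θ k) (C.θ (k + 1)) (C.θ m) (C.θ (m + 1))
  have hpos : ∀ a b, a < b → b < a + 2 * Real.pi → 0 < Real.sin ((b - a) / 2) := fun a b h1 h2 =>
    Real.sin_pos_of_pos_of_lt_pi (by linarith) (by linarith)
  have hneg : ∀ a b, a < b → b < a + 2 * Real.pi → Real.sin ((a - b) / 2) < 0 := fun a b h1 h2 =>
    Real.sin_neg_of_neg_of_neg_pi_lt (by linarith) (by linarith)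
  have hquad : ∀ l, (l = k ∨ l = k + 1 ∨ l = m ∨ l = m + 1) →
      (C.z l : Completion X) ∈ quad s (C.z k) (C.z m) ∧ quadric g (devExt dev (C.z l)) = 0 := by
    intro l hl
    rw [C.devExt_z, hg, quad, C.succ_z, C.succ_z]
    rcases hl with rfl | rfl | rfl | rfl <;> simp
  have key : ∀ ξ : U.conePoints, ((ξ : Completion X) ∈ quad s (C.z k) (C.z m) ∧
      quadric g (devExt dev ξ) = 0) ∨ 0 < quadric g (devExt dev ξ) := by
    intro ξ
    obtain ⟨l, rfl, hl1, hl2⟩ := C.exists_z k ξ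
    by_cases hl : l = k ∨ l = k + 1 ∨ l = m ∨ l = m + 1
    · exact Or.inl (hquad l hl)
    · right
      push Not at hl
      have hkl := C.strictMono.le_iff_le.1 hl1
      have e1 : C.θ k < C.θ l := C.strictMono (by omega)
      have e2 : C.θ (k + 1) < C.θ l := C.strictMono (by omega)
      rw [C.devExt_z, hg]
      refine mul_pos (mul_pos (hpos _ _ e1 hl2) (hpos _ _ e2 (by linarith))) ?_
      rcases lt_or_gt_of_ne hl.2.2.1 with h1 | h1
      · have e3 : C.θ l < C.θ m := C.strictMono h1
        exact mul_pos_of_neg_of_neg (hneg _ _ e3 (by linarith)) (hneg _ _ (e3.trans hm1) (by linarith))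
      · have e3 : C.θ (m + 1) < C.θ l := C.strictMono (by omega)
        exact mul_pos (hpos _ _ (hm1.trans e3) (by linarith)) (hpos _ _ e3 (by linarith))
  refine Subconic.mem_closure_cell hdev hY hYne hp hpt hX hx h.1
    ((F.posCoeffs_of_ellipse h.2).eventually g) ?_ ?_ ⟨C.z k, (hquad k (Or.inl rfl)).1⟩
  · intro ξ hξ
    rcases key ⟨ξ, hξ⟩ with h1 | h1
    · exact h1.2.ge
    · exact h1.le
  · ext ξ
    constructor
    · rintro ⟨hξ, h0⟩
      rcases key ⟨ξ, hξ⟩ with h1 | h1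
      · exact h1.1
      · exact absurd h0 h1.ne'
    · intro hξ
      have hξ' := hξ
      rw [quad, C.succ_z, C.succ_z] at hξ'
      simp only [mem_insert_iff, mem_singleton_iff] at hξ'
      rcases hξ' with rfl | rfl | rfl | rfl
      · exact ⟨(C.z _).2, (hquad k (by simp)).2⟩
      · exact ⟨(C.z _).2, (hquad (k + 1) (by simp)).2⟩
      · exact ⟨(C.z _).2, (hquad m (by simp)).2⟩
      · exact ⟨(C.z _).2, (hquad (m + 1) (by simp)).2⟩

theorem isLinkRelation
    (hY : TotallyBounded (Set.univ : Set Y)) (hYne : (metricFrontier Y).Nonempty)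
    {p : X → Y} (hp : IsCoveringMap p) (hpt : IsTranslationMap p)
    (hX : DiscreteTopology (metricFrontier X)) {c : Fin 6 → ℝ} (h : U.IsEllipseIn c F) {x : X}
    (hx : x ∈ U.1) (h5 : 5 ≤ U.conePoints.encard) :
    IsLinkRelation U s fun ξ ζ => ζ ≠ ξ ∧ ζ ≠ s ξ ∧ ξ ≠ s ζ where
  pow_ne := C.pow_ne h5
  symm ξ ζ h := ⟨h.1.symm, h.2.2, h.2.1⟩
  ne ξ ζ h := h
  succ ξ ζ h1 h2 := ⟨h1.2.1, h2, fun h => h1.1 (s.injective h).symm⟩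
  pred ξ ζ h1 h2 := by
    refine ⟨fun h => h1.2.2 ?_, by simpa using h1.1, fun h => h2 ?_⟩
    · rw [h]; simp
    · rw [← h]; simp
  vertex Z hZ := by
    constructor
    · intro hU
      obtain ⟨hZU, k, -, hk⟩ := exists_quadric_of_mem_closure_cell hdev hY hYne hp hpt hx hZ hU
      obtain ⟨ξ, ζ, rfl⟩ := C.eq_quad hZ h5 hZU hk
      exact ⟨ξ, ζ, ne_of_encard_quad hZ, rfl⟩
    · rintro ⟨ξ, ζ, hR, rfl⟩
      exact C.mem_closure_cell_quad hdev hY hYne hp hpt hX h hx hR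
  of_quad a b ξ ζ hR he := by
    refine ne_of_encard_quad (he ▸ encard_quad ?_ ?_ hR)
    · simpa using C.pow_ne h5 a 1 le_rfl (by norm_num)
    · simpa using C.pow_ne h5 b 1 le_rfl (by norm_num)

end CircularMarks

end Vertices

end TranslationConics
end

noncomputable section
namespace TranslationConics

open UniformSpace

section StripVertices

/-- The cone points of a strip, enumerated in the positive direction on both lines. -/
structure LinearMarks {X : Type*} [MetricSpace X] {dev : X → Plane} (U : Subconic dev) (F : Frame)
    (s : Equiv.Perm U.conePoints) where
  /-- the parameters -/
  θ : Bool → ℤ → ℝ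
  /-- the cone points -/
  z : Bool → ℤ → U.conePoints
  strictMono : ∀ i, StrictMono (θ i)
  devExt_z : ∀ i k, devExt dev (z i k) = F.map (lineSign i * θ i k) (-lineSign i)
  exists_z : ∀ ξ, ∃ i k, z i k = ξ
  inj : ∀ i j k l, z i k = z j l → i = j ∧ k = l
  succ_z : ∀ i k, s (z i k) = z i (k + 1)

variable {Y X : Type*} [MetricSpace Y] [ChartedSpace Plane Y] [TranslationSurface Y]
  [MetricSpace X] [ChartedSpace Plane X] [TranslationSurface X] {dev : X → Plane}
  (hdev : IsDevelopingMap dev)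
include hdev

theorem exists_linearMarks (hY : TotallyBounded (Set.univ : Set Y)) {p : X → Y}
    (hp : IsCoveringMap p) (hpt : IsTranslationMap p)
    (hX : DiscreteTopology (metricFrontier X)) {U : Subconic dev}
    {c : Fin 6 → ℝ} {F : Frame} (h : U.IsBandIn c F) (ht : U.IsTight F) {x : X} (hx : x ∈ U.1) :
    ∃ s : Equiv.Perm U.conePoints, U.IsSuccessorFunction s ∧ Nonempty (LinearMarks U F s) := by
  obtain ⟨⟨Q, hQ, hper⟩, h1, h2⟩ := h.exists_period hdev hp hpt hY ht
  have hE0 : ∀ i t, h.param.E i t = F.map (lineSign i * t) (-lineSign i) := fun _ _ => rfl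
  obtain ⟨M, hM⟩ := exists_marking hdev hX hx h.param (fun i => by
      cases i
      · obtain ⟨A, hA⟩ := h2
        exact ⟨A, by rw [hE0]; simpa [lineSign] using hA⟩
      · obtain ⟨A, hA⟩ := h1
        exact ⟨-A, by rw [hE0]; simpa [lineSign] using hA⟩)
    (fun i => ⟨Q, hQ, fun t => by
      rw [hE0, hE0]
      cases i
      · simpa [lineSign] using hper t (-1)
      · have := hper (-(t + Q)) 1
        simpa [lineSign] using this.symm⟩) (Or.inl rfl)
  obtain ⟨z, s, hz, hsurj, hzz, hs, hsucc⟩ := M.exists_successor hdev hx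
  refine ⟨s, hsucc, ⟨⟨M.θ, z, M.strictMono, fun i k => ?_, hsurj, fun i j k l hkl => ?_, hs⟩⟩⟩
  · rw [hz, hM, hE0]
  · obtain ⟨rfl, m, hm⟩ := (hzz i j k l).1 hkl
    have hP : M.P = 0 := by rw [hM]; rfl
    rw [hP, mul_zero, add_zero] at hm
    exact ⟨rfl, ((M.strictMono i).injective hm).symm⟩

namespace LinearMarks

omit hdev in
theorem quadratic_eq {α β γ p q : ℝ} (hpq : p ≠ q) (hp : α * p ^ 2 + β * p + γ = 0)
    (hq : α * q ^ 2 + β * q + γ = 0) (t : ℝ) : α * t ^ 2 + β * t + γ = α * ((t - p) * (t - q)) := by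
  have h1 : (p - q) * (α * (p + q) + β) = 0 := by linear_combination hp - hq
  have h2 : β = -α * (p + q) := by
    have := (mul_eq_zero.1 h1).resolve_left (sub_ne_zero.2 hpq)
    linarith
  have h3 : γ = α * p * q := by rw [h2] at hp; linarith
  rw [h2, h3]; ring

variable {U : Subconic dev} {F : Frame} {s : Equiv.Perm U.conePoints} (C : LinearMarks U F s)
include C

omit [ChartedSpace Plane X] [TranslationSurface X] hdev in
theorem zpow_z (i : Bool) (k n : ℤ) : (s ^ n) (C.z i k) = C.z i (k + n) := by
  induction n using Int.induction_on with
  | zero => simp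
  | succ n ih =>
    rw [add_comm, zpow_add, zpow_one, Equiv.Perm.mul_apply, ih, C.succ_z]; congr 1; ring
  | pred n ih =>
    rw [sub_eq_neg_add, zpow_add, Equiv.Perm.mul_apply, ih, zpow_neg_one, Equiv.Perm.inv_eq_iff_eq, C.succ_z]
    congr 1; ring

omit [ChartedSpace Plane X] [TranslationSurface X] hdev in
theorem sameCycle_iff (i j : Bool) (k l : ℤ) : s.SameCycle (C.z i k) (C.z j l) ↔ i = j := by
  constructor
  · rintro ⟨n, hn⟩
    rw [C.zpow_z] at hn
    exact (C.inj _ _ _ _ hn).1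
  · rintro rfl
    exact ⟨l - k, by rw [C.zpow_z, add_sub_cancel]⟩

omit [ChartedSpace Plane X] [TranslationSurface X] hdev in
theorem eq_quad {Z : Set (Completion X)} (hZ : Z.encard = 4)
    (hZU : Z ⊆ U.conePoints) {k : Fin 6 → ℝ} (hpos : PosCoeffs k)
    (hk : ∀ ξ ∈ U.conePoints, 0 ≤ quadric k (devExt dev ξ) ∧
      (quadric k (devExt dev ξ) = 0 ↔ ξ ∈ Z)) :
    ∃ a b, Z = quad s (C.z false a) (C.z true b) := by
  have hα := F.quadPart_pos hpos
  obtain ⟨g, hg, hg0⟩ := F.exists_quadric_map k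
  rw [← hg0] at hα
  have hf : ∀ i, ∃ β γ : ℝ, ∀ t, quadric k (F.map (lineSign i * t) (-lineSign i)) =
      g 0 * t ^ 2 + β * t + γ := by
    intro i
    refine ⟨-g 1 + g 3 * lineSign i, g 2 - g 4 * lineSign i + g 5, fun t => ?_⟩
    rw [hg]
    have h1 := lineSign_mul_self i
    have h2 : quadric g !₂[lineSign i * t, -lineSign i] = g 0 * (lineSign i * t) ^ 2 +
      g 1 * (lineSign i * t * -lineSign i) + g 2 * (-lineSign i) ^ 2 + g 3 * (lineSign i * t) +
        g 4 * -lineSign i + g 5 := by simp [quadric]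
    rw [h2]
    linear_combination (g 0 * t ^ 2 - g 1 * t + g 2) * h1
  choose β γ hβ using hf
  let K : Bool → Set ℤ := fun i => {m | (C.z i m : Completion X) ∈ Z}
  have hzero : ∀ i m, m ∈ K i ↔ g 0 * C.θ i m ^ 2 + β i * C.θ i m + γ i = 0 := by
    intro i m
    rw [← hβ, ← C.devExt_z]
    exact ((hk _ (C.z i m).2).2).symm
  have hnn : ∀ i m, 0 ≤ g 0 * C.θ i m ^ 2 + β i * C.θ i m + γ i := by
    intro i m
    rw [← hβ, ← C.devExt_z]
    exact (hk _ (C.z i m).2).1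
  have hfac : ∀ i a b, a ≠ b → a ∈ K i → b ∈ K i → ∀ m, g 0 * C.θ i m ^ 2 + β i * C.θ i m + γ i =
      g 0 * ((C.θ i m - C.θ i a) * (C.θ i m - C.θ i b)) := fun i a b hab ha hb m =>
    quadratic_eq (fun h => hab ((C.strictMono i).injective h)) ((hzero i a).1 ha) ((hzero i b).1 hb) _
  have hle : ∀ i, (K i).encard ≤ 2 := by
    intro i
    by_contra! hcon
    have h3 : (3 : ℕ∞) ≤ (K i).encard := by
      have := Order.add_one_le_of_lt hcon
      simpa [show (2 : ℕ∞) + 1 = 3 by norm_num] using this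
    obtain ⟨T, hT, hT3⟩ := exists_subset_encard_eq h3
    obtain ⟨a, b, d, hab, had, hbd, rfl⟩ := encard_eq_three.1 hT3
    have h4 := hfac i a b hab (hT (by simp)) (hT (by simp)) d
    rw [(hzero i d).1 (hT (by simp))] at h4
    have h5 := (C.strictMono i).injective.ne had
    have h6 := (C.strictMono i).injective.ne hbd
    exact mul_ne_zero hα.ne' (mul_ne_zero (sub_ne_zero.2 h5.symm) (sub_ne_zero.2 h6.symm)) h4.symm
  have hKZ : Z = (fun m => (C.z false m : Completion X)) '' K false ∪
      (fun m => (C.z true m : Completion X)) '' K true := by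
    ext ζ
    constructor
    · intro hζ
      obtain ⟨i, m, hm⟩ := C.exists_z ⟨ζ, hZU hζ⟩
      have h2 : (C.z i m : Completion X) = ζ := by rw [hm]
      cases i
      · exact Or.inl ⟨m, (by change (C.z false m : Completion X) ∈ Z; rw [h2]; exact hζ), h2⟩
      · exact Or.inr ⟨m, (by change (C.z true m : Completion X) ∈ Z; rw [h2]; exact hζ), h2⟩
    · rintro (⟨m, hm, rfl⟩ | ⟨m, hm, rfl⟩) <;> exact hm
  have hle' : ∀ i, ((fun m => (C.z i m : Completion X)) '' K i).encard ≤ 2 := fun i =>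
    (encard_image_le _ _).trans (hle i)
  have hge : ∀ i, 2 ≤ (K i).encard := by
    have h4 : (4 : ℕ∞) ≤ (K false).encard + (K true).encard := by
      rw [← hZ, hKZ]
      exact (encard_union_le _ _).trans (add_le_add (encard_image_le _ _) (encard_image_le _ _))
    have hf : ∀ i, ∃ n : ℕ, (K i).encard = n ∧ n ≤ 2 := fun i => by
      obtain ⟨n, hn⟩ := ENat.ne_top_iff_exists.1
        (ne_top_of_le_ne_top (by norm_num : (2 : ℕ∞) ≠ ⊤) (hle i))
      refine ⟨n, hn.symm, ?_⟩
      have := hle i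
      rw [← hn] at this
      exact_mod_cast this
    obtain ⟨n, hn, hn2⟩ := hf false
    obtain ⟨m, hm, hm2⟩ := hf true
    rw [hn, hm] at h4
    have h5 : 4 ≤ n + m := by exact_mod_cast h4
    intro i
    cases i
    · rw [hn]; exact_mod_cast (by omega : 2 ≤ n)
    · rw [hm]; exact_mod_cast (by omega : 2 ≤ m)
  have hpair : ∀ i, ∃ a, K i = {a, a + 1} := by
    intro i
    obtain ⟨a, b, hab, hK⟩ := encard_eq_two.1 (le_antisymm (hle i) (hge i))
    have key : ∀ a b : ℤ, a < b → K i = {a, b} → b = a + 1 := by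
      intro a b hab hK
      by_contra hne
      have ha : a ∈ K i := by rw [hK]; simp
      have hb : b ∈ K i := by rw [hK]; simp
      have h1 := hnn i (a + 1)
      rw [hfac i a b hab.ne ha hb] at h1
      have h2 : C.θ i a < C.θ i (a + 1) := C.strictMono i (by omega)
      have h3 : C.θ i (a + 1) < C.θ i b := C.strictMono i (by omega)
      have h4 := mul_neg_of_pos_of_neg hα (mul_neg_of_pos_of_neg (sub_pos.2 h2) (sub_neg.2 h3))
      linarith
    rcases lt_or_gt_of_ne hab with h | h
    · exact ⟨a, by rw [← key a b h hK, hK]⟩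
    · rw [pair_comm] at hK
      exact ⟨b, by rw [← key b a h hK, hK]⟩
  obtain ⟨a, ha⟩ := hpair false
  obtain ⟨b, hb⟩ := hpair true
  refine ⟨a, b, ?_⟩
  rw [hKZ, ha, hb, quad, C.succ_z, C.succ_z, image_pair, image_pair]
  ext ζ
  simp only [mem_union, mem_insert_iff, mem_singleton_iff]
  tauto

omit [ChartedSpace Plane X] [TranslationSurface X] hdev in
theorem mul_nonneg_of_int (i : Bool) (a m : ℤ) :
    0 ≤ (C.θ i m - C.θ i a) * (C.θ i m - C.θ i (a + 1)) ∧
      ((C.θ i m - C.θ i a) * (C.θ i m - C.θ i (a + 1)) = 0 ↔ m = a ∨ m = a + 1) := by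
  constructor
  · rcases le_or_gt m a with h | h
    · have h1 := (C.strictMono i).monotone h
      have h2 : C.θ i a < C.θ i (a + 1) := C.strictMono i (by omega)
      exact mul_nonneg_of_nonpos_of_nonpos (by linarith) (by linarith)
    · have h1 := (C.strictMono i).monotone (by omega : a + 1 ≤ m)
      have h2 : C.θ i a < C.θ i (a + 1) := C.strictMono i (by omega)
      exact mul_nonneg (by linarith) (by linarith)
  · rw [mul_eq_zero, sub_eq_zero, sub_eq_zero, (C.strictMono i).injective.eq_iff,
      (C.strictMono i).injective.eq_iff]

theorem mem_closure_cell_quad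
    (hY : TotallyBounded (Set.univ : Set Y)) (hYne : (metricFrontier Y).Nonempty)
    {p : X → Y} (hp : IsCoveringMap p) (hpt : IsTranslationMap p)
    (hX : DiscreteTopology (metricFrontier X)) {c : Fin 6 → ℝ} (h : U.IsBandIn c F) {x : X}
    (hx : x ∈ U.1) (a b : ℤ) :
    U ∈ closure (cell dev (quad s (C.z false a) (C.z true b))) := by
  set p₀ := C.θ false a
  set p₁ := C.θ false (a + 1)
  set q₀ := C.θ true b
  set q₁ := C.θ true (b + 1)
  let g' : Fin 6 → ℝ := ![1, ((q₀ + q₁) + (p₀ + p₁)) / 2, 0, ((q₀ + q₁) - (p₀ + p₁)) / 2,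
    (q₀ * q₁ - p₀ * p₁) / 2, (q₀ * q₁ + p₀ * p₁) / 2]
  obtain ⟨g, hg⟩ := F.exists_quadric g'
  have hg0 : ∀ t, quadric g (F.map (lineSign false * t) (-lineSign false)) = (t - p₀) * (t - p₁) := by
    intro t; rw [hg]; simp [quadric, g', lineSign]; ring
  have hg1 : ∀ t, quadric g (F.map (lineSign true * t) (-lineSign true)) = (t - q₀) * (t - q₁) := by
    intro t; rw [hg]; simp [quadric, g', lineSign]; ring
  have hpos : ∀ᶠ ε in 𝓝[>] (0 : ℝ), PosCoeffs (c + ε • g) := by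
    have hδ : 0 < 4 / (g' 1 ^ 2 + 1) := by positivity
    filter_upwards [Ioo_mem_nhdsGT hδ] with ε hε
    refine F.posCoeffs (h := ![0, 0, 1, 0, 0, -1] + ε • g') (fun A B => ?_) ?_
    · rw [quadric_add_smul, quadric_add_smul, h.2, hg]
      congr 1
      simp [quadric]; ring
    · have h1 := (lt_div_iff₀ (by positivity)).1 hε.2
      refine ⟨by simpa [g'] using hε.1, ?_⟩
      have h2 : (![0, 0, 1, 0, 0, -1] + ε • g' : Fin 6 → ℝ) 1 = ε * g' 1 := by simp
      have h3 : (![0, 0, 1, 0, 0, -1] + ε • g' : Fin 6 → ℝ) 0 = ε := by simp [g']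
      have h4 : (![0, 0, 1, 0, 0, -1] + ε • g' : Fin 6 → ℝ) 2 = 1 := by simp [g']
      rw [h2, h3, h4]
      nlinarith [hε.1, mul_pos hε.1 hε.1]
  have hval : ∀ i m, quadric g (devExt dev (C.z i m)) =
      if i then (C.θ true m - q₀) * (C.θ true m - q₁) else (C.θ false m - p₀) * (C.θ false m - p₁) := by
    intro i m
    rw [C.devExt_z]
    cases i
    · rw [hg0]; rfl
    · rw [hg1]; rfl
  refine Subconic.mem_closure_cell hdev hY hYne hp hpt hX hx h.1 hpos (fun ξ hξ => ?_) ?_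
    ⟨C.z false a, by simp [quad]⟩
  · obtain ⟨i, m, hm⟩ := C.exists_z ⟨ξ, hξ⟩
    have h2 : (C.z i m : Completion X) = ξ := by rw [hm]
    rw [← h2, hval]
    cases i
    · exact (C.mul_nonneg_of_int false a m).1
    · exact (C.mul_nonneg_of_int true b m).1
  · have hquad : ∀ i m, (C.z i m : Completion X) ∈ quad s (C.z false a) (C.z true b) ↔
        if i then (m = b ∨ m = b + 1) else (m = a ∨ m = a + 1) := by
      intro i m
      rw [quad, C.succ_z, C.succ_z]
      simp only [mem_insert_iff, mem_singleton_iff, Subtype.val_inj]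
      have key : ∀ i j k l, C.z i k = C.z j l ↔ i = j ∧ k = l := fun i j k l =>
        ⟨C.inj i j k l, fun h => by rw [h.1, h.2]⟩
      simp only [key]
      cases i <;> simp
    have hsub : quad s (C.z false a) (C.z true b) ⊆ U.conePoints := by
      rintro ξ (rfl | rfl | rfl | rfl) <;> exact Subtype.coe_prop _
    have hz : ∀ i m, quadric g (devExt dev (C.z i m)) = 0 ↔
        (C.z i m : Completion X) ∈ quad s (C.z false a) (C.z true b) := by
      intro i m
      rw [hval, hquad]
      cases i
      · exact (C.mul_nonneg_of_int false a m).2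
      · exact (C.mul_nonneg_of_int true b m).2
    ext ξ
    constructor
    · rintro ⟨hξ, h0⟩
      obtain ⟨i, m, hm⟩ := C.exists_z ⟨ξ, hξ⟩
      have h2 : (C.z i m : Completion X) = ξ := by rw [hm]
      rw [← h2] at h0 ⊢
      exact (hz i m).1 h0
    · intro hξ
      obtain ⟨i, m, hm⟩ := C.exists_z ⟨ξ, hsub hξ⟩
      have h2 : (C.z i m : Completion X) = ξ := by rw [hm]
      rw [← h2] at hξ ⊢
      exact ⟨(C.z i m).2, (hz i m).2 hξ⟩

theorem isLinkRelation
    (hY : TotallyBounded (Set.univ : Set Y)) (hYne : (metricFrontier Y).Nonempty)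
    {p : X → Y} (hp : IsCoveringMap p) (hpt : IsTranslationMap p)
    (hX : DiscreteTopology (metricFrontier X)) {c : Fin 6 → ℝ} (h : U.IsBandIn c F) {x : X}
    (hx : x ∈ U.1) : IsLinkRelation U s fun ξ ζ => ¬ s.SameCycle ξ ζ where
  pow_ne ξ k hk _ he := by
    obtain ⟨i, m, rfl⟩ := C.exists_z ξ
    have := C.zpow_z i m k
    rw [zpow_natCast, he] at this
    have := (C.inj _ _ _ _ this).2
    omega
  symm ξ ζ h h' := h h'.symm
  ne ξ ζ h := by
    refine ⟨?_, ?_, ?_⟩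
    · rintro rfl; exact h (Equiv.Perm.SameCycle.refl _ _)
    · rintro rfl; exact h (Equiv.Perm.sameCycle_apply_right.2 (Equiv.Perm.SameCycle.refl _ _))
    · rintro rfl; exact h (Equiv.Perm.sameCycle_apply_left.2 (Equiv.Perm.SameCycle.refl _ _))
  succ ξ ζ h _ := by rwa [Equiv.Perm.sameCycle_apply_left]
  pred ξ ζ h _ := by 
    have h1 := @Equiv.Perm.sameCycle_apply_left _ s (s⁻¹ ξ) ζ
    rw [show s (s⁻¹ ξ) = ξ from s.apply_symm_apply ξ] at h1
    exact fun h2 => h (h1.2 h2)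
  of_quad a b ξ ζ hR he hS := by
    have key : ∀ w : U.conePoints, (w : Completion X) ∈ quad s a b → s.SameCycle ξ w := by
      intro w hw
      rw [he] at hw
      simp only [quad, mem_insert_iff, mem_singleton_iff, Subtype.coe_inj] at hw
      rcases hw with rfl | rfl | rfl | rfl
      · exact Equiv.Perm.SameCycle.refl _ _
      · exact Equiv.Perm.sameCycle_apply_right.2 (Equiv.Perm.SameCycle.refl _ _)
      · exact hS
      · exact Equiv.Perm.sameCycle_apply_right.2 hS
    exact hR ((key a (by simp [quad])).symm.trans (key b (by simp [quad])))
  vertex Z hZ := by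
    constructor
    · intro hU
      obtain ⟨hZU, k, hpos, hk⟩ := exists_quadric_of_mem_closure_cell hdev hY hYne hp hpt hx hZ hU
      obtain ⟨a, b, hab⟩ := C.eq_quad hZ hZU hpos hk
      exact ⟨_, _, by rw [C.sameCycle_iff]; decide, hab⟩
    · rintro ⟨ξ, ζ, hR, rfl⟩
      obtain ⟨i, a, rfl⟩ := C.exists_z ξ
      obtain ⟨j, b, rfl⟩ := C.exists_z ζ
      rw [C.sameCycle_iff] at hR
      cases i <;> cases j
      · exact absurd rfl hR
      · exact C.mem_closure_cell_quad hdev hY hYne hp hpt hX h hx a b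
      · rw [quad_comm]; exact C.mem_closure_cell_quad hdev hY hYne hp hpt hX h hx b a
      · exact absurd rfl hR

end LinearMarks

end StripVertices

end TranslationConics
end

noncomputable section
namespace TranslationConics

open UniformSpace

section Quads

variable {X : Type*} [MetricSpace X] {dev : X → Plane} {U : Subconic dev}
  {s : Equiv.Perm U.conePoints} {R : U.conePoints → U.conePoints → Prop}

theorem mem_quad {ξ ζ w : U.conePoints} :
    (w : Completion X) ∈ quad s ξ ζ ↔ w = ξ ∨ w = s ξ ∨ w = ζ ∨ w = s ζ := by
  simp [quad, Subtype.coe_inj]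

theorem three_le_encard {α : Type*} {A : Set α} {a b c : α} (ha : a ∈ A) (hb : b ∈ A) (hc : c ∈ A)
    (hab : a ≠ b) (hac : a ≠ c) (hbc : b ≠ c) : 3 ≤ A.encard := by
  rw [← encard_eq_three.2 ⟨a, b, c, hab, hac, hbc, rfl⟩]
  apply encard_le_encard
  rintro w (rfl | rfl | rfl) <;> assumption

theorem encard_eq_four {α : Type*} {a b c d : α} (hab : a ≠ b) (hac : a ≠ c) (had : a ≠ d)
    (hbc : b ≠ c) (hbd : b ≠ d) (hcd : c ≠ d) : ({a, b, c, d} : Set α).encard = 4 := by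
  rw [encard_insert_of_notMem (by simp [*]), encard_eq_three.2 ⟨b, c, d, hbc, hbd, hcd, rfl⟩]
  norm_num

/-- Two sets of four elements that have exactly three elements in common. -/
def NearlyEqual {α : Type*} (Z W : Set α) : Prop := Z ≠ W ∧ 3 ≤ (Z ∩ W).encard

theorem mem_or_mem_of_three_le {α : Type*} {Z W : Set α} (hW : W.encard = 4)
    (h : 3 ≤ (Z ∩ W).encard) {a b : α} (ha : a ∈ W) (hb : b ∈ W) (hab : a ≠ b) :
    a ∈ Z ∨ b ∈ Z := by
  by_contra! hcon
  have h1 : (Z ∩ W).encard ≤ (W \ {a, b}).encard := by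
    apply encard_le_encard
    rintro w ⟨h1, h2⟩
    refine ⟨h2, ?_⟩
    rintro (rfl | rfl)
    · exact hcon.1 h1
    · exact hcon.2 h1
  have h2 := encard_sdiff_add_encard_of_subset (s := {a, b}) (t := W)
    (by rintro w (rfl | rfl) <;> assumption)
  rw [encard_pair hab, hW] at h2
  have h3 := add_le_add_left (h.trans h1) 2
  rw [h2] at h3
  norm_num at h3

theorem quad_ne {a b c d : U.conePoints} (w : U.conePoints)
    (h : w = a ∨ w = s a ∨ w = b ∨ w = s b) (h' : ¬ (w = c ∨ w = s c ∨ w = d ∨ w = s d)) :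
    quad s a b ≠ quad s c d :=
  fun e => h' (mem_quad.1 (e ▸ mem_quad.2 h))

theorem nearlyEqual_quad {a b c d : U.conePoints} (w u v t : U.conePoints)
    (hw : w = a ∨ w = s a ∨ w = b ∨ w = s b) (hw' : ¬ (w = c ∨ w = s c ∨ w = d ∨ w = s d))
    (hu : u = a ∨ u = s a ∨ u = b ∨ u = s b) (hu' : u = c ∨ u = s c ∨ u = d ∨ u = s d)
    (hv : v = a ∨ v = s a ∨ v = b ∨ v = s b) (hv' : v = c ∨ v = s c ∨ v = d ∨ v = s d)
    (ht : t = a ∨ t = s a ∨ t = b ∨ t = s b) (ht' : t = c ∨ t = s c ∨ t = d ∨ t = s d)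
    (huv : u ≠ v) (hut : u ≠ t) (hvt : v ≠ t) : NearlyEqual (quad s a b) (quad s c d) :=
  ⟨quad_ne w hw hw', three_le_encard ⟨mem_quad.2 hu, mem_quad.2 hu'⟩ ⟨mem_quad.2 hv, mem_quad.2 hv'⟩
    ⟨mem_quad.2 ht, mem_quad.2 ht'⟩ (fun e => huv (Subtype.ext e)) (fun e => hut (Subtype.ext e))
    (fun e => hvt (Subtype.ext e))⟩

namespace IsLinkRelation

variable (hL : IsLinkRelation U s R)

include hL

theorem apply_ne (ξ : U.conePoints) :
    s ξ ≠ ξ ∧ s (s ξ) ≠ ξ ∧ s (s (s ξ)) ≠ ξ ∧ s (s (s (s ξ))) ≠ ξ :=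
  ⟨hL.pow_ne ξ 1 le_rfl (by norm_num), hL.pow_ne ξ 2 (by norm_num) (by norm_num),
    hL.pow_ne ξ 3 (by norm_num) (by norm_num), hL.pow_ne ξ 4 (by norm_num) le_rfl⟩

theorem encard_quad_eq {ξ ζ : U.conePoints} (h : R ξ ζ) : (quad s ξ ζ).encard = 4 :=
  encard_quad (hL.apply_ne ξ).1 (hL.apply_ne ζ).1 (hL.ne _ _ h)

theorem exists_side {Z : Set (Completion X)} {a b : U.conePoints} (hR : R a b)
    (h : NearlyEqual Z (quad s a b)) :
    ∃ a' b', R a' b' ∧ quad s a b = quad s a' b' ∧ (a' : Completion X) ∈ Z ∧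
      (s a' : Completion X) ∈ Z ∧ ((b' : Completion X) ∈ Z ∨ (s b' : Completion X) ∈ Z) := by
  have key : ∀ c d : U.conePoints, (c : Completion X) ∈ quad s a b →
      (d : Completion X) ∈ quad s a b → c ≠ d → (c : Completion X) ∈ Z ∨ (d : Completion X) ∈ Z :=
    fun c d hc hd hcd => mem_or_mem_of_three_le (hL.encard_quad_eq hR) h.2 hc hd
      (fun e => hcd (Subtype.ext e))
  have hne := hL.ne _ _ hR
  have ha := hL.apply_ne a
  have hb := hL.apply_ne b
  have hab : s a ≠ s b := fun e => hne.1 (s.injective e).symm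
  have k1 := key a b (by simp [quad]) (by simp [quad]) hne.1.symm
  have k2 := key a (s b) (by simp [quad]) (by simp [quad]) hne.2.2
  have k3 := key (s a) b (by simp [quad]) (by simp [quad]) hne.2.1.symm
  have k4 := key (s a) (s b) (by simp [quad]) (by simp [quad]) hab
  have k5 := key a (s a) (by simp [quad]) (by simp [quad]) ha.1.symm
  have k6 := key b (s b) (by simp [quad]) (by simp [quad]) hb.1.symm
  by_cases h1 : (a : Completion X) ∈ Z ∧ (s a : Completion X) ∈ Z
  · exact ⟨a, b, hR, rfl, h1.1, h1.2, k6⟩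
  · exact ⟨b, a, hL.symm _ _ hR, quad_comm _ _ _, by tauto, by tauto, k5⟩

set_option maxHeartbeats 1000000 in
/-- The neighbours of a vertex that is not consecutive. -/
theorem nearlyEqual_iff {x y : U.conePoints} (hR : R x y) (h1 : y ≠ s (s x)) (h2 : x ≠ s (s y))
    (Z : Set (Completion X)) :
    (∃ a b, R a b ∧ Z = quad s a b ∧ NearlyEqual (quad s x y) (quad s a b)) ↔
      Z ∈ ({quad s x (s⁻¹ y), quad s x (s y), quad s (s x) y, quad s (s⁻¹ x) y} :
        Set (Set (Completion X))) := by
  have hne := hL.ne _ _ hR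
  have hinj := s.injective
  obtain ⟨y', rfl⟩ := s.surjective y
  obtain ⟨x', rfl⟩ := s.surjective x
  have hy' : s⁻¹ (s y') = y' := s.symm_apply_apply y'
  have hx' : s⁻¹ (s x') = x' := s.symm_apply_apply x'
  have hx0 := hL.apply_ne x'
  have hx1 := hL.apply_ne (s x')
  have hy0 := hL.apply_ne y'
  have hy1 := hL.apply_ne (s y')
  rw [hx', hy']
  constructor
  · rintro ⟨a, b, hab, rfl, h⟩
    obtain ⟨a', b', hab', e, ha, hsa, hb⟩ := hL.exists_side hab h
    have hne' := hL.ne _ _ hab'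
    have hnq := h.1
    rw [e] at hnq ⊢
    simp only [mem_quad] at ha hsa hb
    simp only [mem_insert_iff, mem_singleton_iff]
    have ha' : a' = s x' ∨ a' = s y' := by grind
    rcases ha' with rfl | rfl
    · have : b' = s (s y') ∨ b' = y' := by
        have : b' ≠ s y' := by rintro rfl; exact hnq rfl
        grind
      grind
    · have : b' = s (s x') ∨ b' = x' := by
        have : b' ≠ s x' := by rintro rfl; exact hnq (quad_comm _ _ _)
        grind
      rw [quad_comm]
      grind
  · have r1 : R (s x') y' := by
      have := hL.symm _ _ (hL.pred _ _ (hL.symm _ _ hR) h1)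
      rwa [hy'] at this
    have r2 : R (s x') (s (s y')) := hL.symm _ _ (hL.succ _ _ (hL.symm _ _ hR) h2)
    have r3 := hL.succ _ _ hR h1
    have r4 : R x' (s y') := by
      have := hL.pred _ _ hR h2
      rwa [hx'] at this
    rintro (rfl | rfl | rfl | rfl)
    · exact ⟨_, _, r1, rfl, nearlyEqual_quad (s (s y')) (s x') (s (s x')) (s y') (by simp) (by grind) (by simp)
        (by simp) (by simp) (by simp) (by simp) (by simp) (by grind) (by grind) (by grind)⟩
    · exact ⟨_, _, r2, rfl, nearlyEqual_quad (s y') (s x') (s (s x')) (s (s y')) (by simp) (by grind) (by simp)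
        (by simp) (by simp) (by simp) (by simp) (by simp) (by grind) (by grind) (by grind)⟩
    · exact ⟨_, _, r3, rfl, nearlyEqual_quad (s x') (s (s x')) (s y') (s (s y')) (by simp) (by grind) (by simp)
        (by simp) (by simp) (by simp) (by simp) (by simp) (by grind) (by grind) (by grind)⟩
    · exact ⟨_, _, r4, rfl, nearlyEqual_quad (s (s x')) (s x') (s y') (s (s y')) (by simp) (by grind) (by simp)
        (by simp) (by simp) (by simp) (by simp) (by simp) (by grind) (by grind) (by grind)⟩

theorem encard_neighbours {x y : U.conePoints} (hR : R x y) (h1 : y ≠ s (s x))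
    (h2 : x ≠ s (s y)) :
    ({quad s x (s⁻¹ y), quad s x (s y), quad s (s x) y, quad s (s⁻¹ x) y} :
        Set (Set (Completion X))).encard = 4 := by
  have hne := hL.ne _ _ hR
  have hinj := s.injective
  obtain ⟨y', rfl⟩ := s.surjective y
  obtain ⟨x', rfl⟩ := s.surjective x
  have hy' : s⁻¹ (s y') = y' := s.symm_apply_apply y'
  have hx' : s⁻¹ (s x') = x' := s.symm_apply_apply x'
  have hx0 := hL.apply_ne x'
  have hx1 := hL.apply_ne (s x')
  have hy0 := hL.apply_ne y'
  have hy1 := hL.apply_ne (s y')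
  rw [hx', hy']
  apply encard_eq_four
  · exact quad_ne (s y') (by simp) (by grind)
  · exact quad_ne (s x') (by simp) (by grind)
  · exact quad_ne (s (s x')) (by simp) (by grind)
  · exact quad_ne (s x') (by simp) (by grind)
  · exact quad_ne (s (s x')) (by simp) (by grind)
  · exact quad_ne (s (s x')) (by simp) (by grind)

set_option maxHeartbeats 1000000 in
/-- The neighbours of a consecutive vertex. -/
theorem nearlyEqual_iff_of_consecutive {x : U.conePoints} (hR : R x (s (s x)))
    (Z : Set (Completion X)) :
    (∃ a b, R a b ∧ Z = quad s a b ∧ NearlyEqual (quad s x (s (s x))) (quad s a b)) ↔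
      Z ∈ ({quad s (s⁻¹ x) (s (s x)), quad s (s⁻¹ x) (s x), quad s x (s (s (s x))),
        quad s (s x) (s (s (s x)))} : Set (Set (Completion X))) := by
  have hinj := s.injective
  obtain ⟨x', rfl⟩ := s.surjective x
  have hx' : s⁻¹ (s x') = x' := s.symm_apply_apply x'
  have hx'' : s⁻¹ (s (s (s x'))) = s (s x') := s.symm_apply_apply _
  have hx0 := hL.apply_ne x'
  have hx1 := hL.apply_ne (s x')
  rw [hx']
  constructor
  · rintro ⟨a, b, hab, rfl, h⟩
    obtain ⟨a', b', hab', e, ha, hsa, hb⟩ := hL.exists_side hab h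
    have hne' := hL.ne _ _ hab'
    have hnq := h.1
    rw [e] at hnq ⊢
    simp only [mem_quad] at ha hsa hb
    simp only [mem_insert_iff, mem_singleton_iff]
    have ha' : a' = s x' ∨ a' = s (s x') ∨ a' = s (s (s x')) := by grind
    rcases ha' with rfl | rfl | rfl
    · have : b' = s (s (s (s x'))) := by
        have : b' ≠ s (s (s x')) := by rintro rfl; exact hnq rfl
        grind
      grind
    · have : b' = s (s (s (s x'))) ∨ b' = x' := by grind
      rcases this with rfl | rfl
      · simp
      · rw [quad_comm]; simp
    · have : b' = x' := by
        have : b' ≠ s x' := by rintro rfl; exact hnq (quad_comm _ _ _)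
        grind
      rw [quad_comm]
      grind
  · have r1 : R x' (s (s (s x'))) := by
      have := hL.pred _ _ hR (by grind)
      rwa [hx'] at this
    have r2 : R x' (s (s x')) := by
      have := hL.symm _ _ (hL.pred _ _ (hL.symm _ _ r1) (by grind))
      rwa [hx''] at this
    have r3 : R (s x') (s (s (s (s x')))) :=
      hL.symm _ _ (hL.succ _ _ (hL.symm _ _ hR) (by grind))
    have r4 := hL.succ _ _ r3 (by grind)
    rintro (rfl | rfl | rfl | rfl)
    · exact ⟨_, _, r1, rfl, nearlyEqual_quad (s (s x')) (s x') (s (s (s x'))) (s (s (s (s x')))) (by simp) (by grind) (by simp)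
        (by simp) (by simp) (by simp) (by simp) (by simp) (by grind) (by grind) (by grind)⟩
    · exact ⟨_, _, r2, rfl, nearlyEqual_quad (s (s (s (s x')))) (s x') (s (s x')) (s (s (s x'))) (by simp) (by grind) (by simp)
        (by simp) (by simp) (by simp) (by simp) (by simp) (by grind) (by grind) (by grind)⟩
    · exact ⟨_, _, r3, rfl, nearlyEqual_quad (s (s (s x'))) (s x') (s (s x')) (s (s (s (s x')))) (by simp) (by grind) (by simp)
        (by simp) (by simp) (by simp) (by simp) (by simp) (by grind) (by grind) (by grind)⟩
    · exact ⟨_, _, r4, rfl, nearlyEqual_quad (s x') (s (s x')) (s (s (s x'))) (s (s (s (s x')))) (by simp) (by grind) (by simp)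
        (by simp) (by simp) (by simp) (by simp) (by simp) (by grind) (by grind) (by grind)⟩

theorem encard_neighbours_of_consecutive (x : U.conePoints) :
    ({quad s (s⁻¹ x) (s (s x)), quad s (s⁻¹ x) (s x), quad s x (s (s (s x))),
        quad s (s x) (s (s (s x)))} : Set (Set (Completion X))).encard = 4 := by
  have hinj := s.injective
  obtain ⟨x', rfl⟩ := s.surjective x
  have hx' : s⁻¹ (s x') = x' := s.symm_apply_apply x'
  have hx0 := hL.apply_ne x'
  have hx1 := hL.apply_ne (s x')
  rw [hx']
  apply encard_eq_four
  · exact quad_ne (s (s (s (s x')))) (by simp) (by grind)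
  · exact quad_ne (s (s (s x'))) (by simp) (by grind)
  · exact quad_ne (s x') (by simp) (by grind)
  · exact quad_ne (s (s (s x'))) (by simp) (by grind)
  · exact quad_ne (s x') (by simp) (by grind)
  · exact quad_ne (s x') (by simp) (by grind)

end IsLinkRelation

end Quads

end TranslationConics
end

noncomputable section
namespace TranslationConics

open UniformSpace

theorem eq_of_cell_eq {X : Type*} [MetricSpace X] {dev : X → Plane} {Z W : Set (Completion X)}
    (hne : (cell dev Z).Nonempty) (h : cell dev Z = cell dev W) : Z = W := by
  obtain ⟨V, hV⟩ := hne
  exact hV.1.symm.trans (h ▸ hV : V ∈ cell dev W).1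

theorem setOf_eq_of_iff {α : Type*} {P : α → Prop} {T : Set α} (h : ∀ a, P a ↔ a ∈ T) :
    {a | P a} = T := Set.ext h

namespace IsLinkRelation

section

variable {X : Type*} [MetricSpace X] {dev : X → Plane} {U : Subconic dev}
  {s : Equiv.Perm U.conePoints} {R : U.conePoints → U.conePoints → Prop}
  (hL : IsLinkRelation U s R)

include hL

theorem mem_closure {a b : U.conePoints} (h : R a b) : U ∈ closure (cell dev (quad s a b)) :=
  (hL.vertex _ (hL.encard_quad_eq h)).2 ⟨a, b, h, rfl⟩

theorem cell_nonempty {a b : U.conePoints} (h : R a b) : (cell dev (quad s a b)).Nonempty :=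
  closure_nonempty_iff.1 ⟨U, hL.mem_closure h⟩

/-- The vertex of the link that belongs to a pair of cone points. -/
def toVertex {a b : U.conePoints} (h : R a b) : LinkVertex U :=
  ⟨cell dev (quad s a b), ⟨hL.cell_nonempty h, _, hL.encard_quad_eq h, rfl⟩, hL.mem_closure h⟩

theorem exists_quad (v : LinkVertex U) : ∃ a b, R a b ∧ v.1 = cell dev (quad s a b) := by
  obtain ⟨⟨-, Z, hZ, hv⟩, hU⟩ := v.2
  rw [hv] at hU
  obtain ⟨a, b, hR, rfl⟩ := (hL.vertex Z hZ).1 hU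
  exact ⟨a, b, hR, hv⟩

theorem rel_of_eq {v : LinkVertex U} {a b : U.conePoints} (hv : v.1 = cell dev (quad s a b)) :
    R a b := by
  obtain ⟨c, d, hR, h⟩ := hL.exists_quad v
  exact hL.of_quad c d a b hR (eq_of_cell_eq (hL.cell_nonempty hR) (h.symm.trans hv))

theorem eq_of_isConsecutive {x y : U.conePoints} (hR : R x y)
    (hc : IsConsecutive s (quad s x y)) : y = s (s x) ∨ x = s (s y) := by
  obtain ⟨a, k, -, h⟩ := hc
  have h0 := hL.apply_ne a
  have hinj := s.injective
  have hne := hL.ne _ _ hR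
  have hmem : ∀ w : U.conePoints, (w = x ∨ w = s x ∨ w = y ∨ w = s y) ↔ ∃ i ≤ k, w = (s ^ i) a := by
    intro w
    rw [← mem_quad (s := s), h]
    simp [Subtype.coe_inj]
  have hk : k ≤ 3 := by
    by_contra! hk
    have m0 := (hmem a).2 ⟨0, by omega, rfl⟩
    have m1 := (hmem (s a)).2 ⟨1, by omega, rfl⟩
    have m2 := (hmem (s (s a))).2 ⟨2, by omega, rfl⟩
    have m3 := (hmem (s (s (s a)))).2 ⟨3, by omega, rfl⟩
    have m4 := (hmem (s (s (s (s a))))).2 ⟨4, by omega, rfl⟩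
    have := hL.apply_ne (s a)
    grind
  have key : ∀ w : U.conePoints, (w = x ∨ w = s x ∨ w = y ∨ w = s y) →
      w = a ∨ w = s a ∨ w = s (s a) ∨ w = s (s (s a)) := by
    intro w hw
    obtain ⟨i, hi, rfl⟩ := (hmem w).1 hw
    have : i = 0 ∨ i = 1 ∨ i = 2 ∨ i = 3 := by omega
    rcases this with rfl | rfl | rfl | rfl
    · exact Or.inl rfl
    · exact Or.inr (Or.inl rfl)
    · exact Or.inr (Or.inr (Or.inl rfl))
    · exact Or.inr (Or.inr (Or.inr rfl))
  have k1 := key x (by simp)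
  have k2 := key (s x) (by simp)
  have k3 := key y (by simp)
  have k4 := key (s y) (by simp)
  grind

end

theorem isConsecutive_quad {X : Type*} [MetricSpace X] {dev : X → Plane} {U : Subconic dev}
    (s : Equiv.Perm U.conePoints) (x : U.conePoints) : IsConsecutive s (quad s x (s (s x))) := by
  refine ⟨x, 3, by norm_num, ?_⟩
  ext w
  constructor
  · rintro (rfl | rfl | rfl | rfl)
    · exact ⟨_, ⟨0, by norm_num, rfl⟩, rfl⟩
    · exact ⟨_, ⟨1, by norm_num, rfl⟩, rfl⟩
    · exact ⟨_, ⟨2, by norm_num, rfl⟩, rfl⟩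
    · exact ⟨_, ⟨3, by norm_num, rfl⟩, rfl⟩
  · rintro ⟨_, ⟨i, hi, rfl⟩, rfl⟩
    have : i = 0 ∨ i = 1 ∨ i = 2 ∨ i = 3 := by omega
    rcases this with rfl | rfl | rfl | rfl
    · exact mem_quad.2 (Or.inl rfl)
    · exact mem_quad.2 (Or.inr (Or.inl rfl))
    · exact mem_quad.2 (Or.inr (Or.inr (Or.inl rfl)))
    · exact mem_quad.2 (Or.inr (Or.inr (Or.inr rfl)))

variable {Y X : Type*} [MetricSpace Y] [ChartedSpace Plane Y] [TranslationSurface Y]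
  [MetricSpace X] [ChartedSpace Plane X] [TranslationSurface X] {dev : X → Plane}
  (hdev : IsDevelopingMap dev)
  (hY : TotallyBounded (Set.univ : Set Y)) (hYne : (metricFrontier Y).Nonempty)
  {p : X → Y} (hp : IsCoveringMap p) (hpt : IsTranslationMap p)
  (hX : DiscreteTopology (metricFrontier X)) {U : Subconic dev}
  {s : Equiv.Perm U.conePoints} {R : U.conePoints → U.conePoints → Prop}
  (hL : IsLinkRelation U s R) (h5 : 5 ≤ U.conePoints.encard)

include hdev hY hYne hp hpt hX hL h5

theorem adj_iff {v w : LinkVertex U} {x y a b : U.conePoints} (hxy : R x y) (hab : R a b)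
    (hv : v.1 = cell dev (quad s x y)) (hw : w.1 = cell dev (quad s a b)) :
    (link U).Adj v w ↔ NearlyEqual (quad s x y) (quad s a b) :=
  link_adj_iff hdev hY hYne hp hpt hX h5 hv (hL.encard_quad_eq hxy) hw (hL.encard_quad_eq hab)

theorem neighbourCells_eq {v : LinkVertex U} {x y : U.conePoints} (hxy : R x y)
    (hv : v.1 = cell dev (quad s x y)) : neighbourCells U v = cell dev ''
      {Z | ∃ a b, R a b ∧ Z = quad s a b ∧ NearlyEqual (quad s x y) (quad s a b)} := by
  ext D
  constructor
  · rintro ⟨w, hw, rfl⟩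
    obtain ⟨a, b, hab, h⟩ := hL.exists_quad w
    exact ⟨_, ⟨a, b, hab, rfl, (adj_iff hdev hY hYne hp hpt hX hL h5 hxy hab hv h).1 hw⟩, h.symm⟩
  · rintro ⟨Z, ⟨a, b, hab, rfl, h⟩, rfl⟩
    exact ⟨hL.toVertex hab, (adj_iff hdev hY hYne hp hpt hX hL h5 hxy hab hv rfl).2 h, rfl⟩

theorem encard_neighborSet {v : LinkVertex U} {x y : U.conePoints} (hxy : R x y)
    (hv : v.1 = cell dev (quad s x y)) : ((link U).neighborSet v).encard =
      {Z | ∃ a b, R a b ∧ Z = quad s a b ∧ NearlyEqual (quad s x y) (quad s a b)}.encard := by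
  have h1 : (neighbourCells U v).encard = ((link U).neighborSet v).encard :=
    Subtype.val_injective.encard_image _
  rw [← h1, neighbourCells_eq hdev hY hYne hp hpt hX hL h5 hxy hv, InjOn.encard_image]
  rintro Z ⟨a, b, hab, rfl, -⟩ W - h
  exact eq_of_cell_eq (hL.cell_nonempty hab) h

theorem link_description :
    (∀ v : LinkVertex U, ((link U).neighborSet v).encard = 4) ∧
    (∀ v : LinkVertex U, ∃ x y, v.1 = cell dev (quad s x y)) ∧
    (∀ (v : LinkVertex U) (x y : U.conePoints), v.1 = cell dev (quad s x y) →
      IsConsecutive s (quad s x y) →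
        (y = (s ^ 2) x ∨ x = (s ^ 2) y) ∧
        (y = (s ^ 2) x →
          neighbourCells U v =
            {cell dev (quad s (s⁻¹ x) ((s ^ 2) x)), cell dev (quad s (s⁻¹ x) (s x)),
              cell dev (quad s x ((s ^ 3) x)), cell dev (quad s (s x) ((s ^ 3) x))})) ∧
    (∀ (v : LinkVertex U) (x y : U.conePoints), v.1 = cell dev (quad s x y) →
      ¬ IsConsecutive s (quad s x y) →
        neighbourCells U v =
          {cell dev (quad s x (s⁻¹ y)), cell dev (quad s x (s y)),
            cell dev (quad s (s x) y), cell dev (quad s (s⁻¹ x) y)}) := by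
  have hcons : ∀ x y : U.conePoints, ¬ IsConsecutive s (quad s x y) → y ≠ s (s x) ∧ x ≠ s (s y) := by
    intro x y h
    refine ⟨?_, ?_⟩
    · rintro rfl; exact h (isConsecutive_quad s x)
    · rintro rfl; exact h (quad_comm s _ _ ▸ isConsecutive_quad s y)
  refine ⟨fun v => ?_, fun v => ?_, fun v x y hv hc => ?_, fun v x y hv hc => ?_⟩
  · obtain ⟨x, y, hR, hv⟩ := hL.exists_quad v
    by_cases h1 : y = s (s x)
    · subst h1
      rw [encard_neighborSet hdev hY hYne hp hpt hX hL h5 hR hv,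
        setOf_eq_of_iff (hL.nearlyEqual_iff_of_consecutive hR)]
      exact hL.encard_neighbours_of_consecutive x
    by_cases h2 : x = s (s y)
    · subst h2
      rw [quad_comm] at hv
      have hR := hL.symm _ _ hR
      rw [encard_neighborSet hdev hY hYne hp hpt hX hL h5 hR hv,
        setOf_eq_of_iff (hL.nearlyEqual_iff_of_consecutive hR)]
      exact hL.encard_neighbours_of_consecutive y
    rw [encard_neighborSet hdev hY hYne hp hpt hX hL h5 hR hv, setOf_eq_of_iff (hL.nearlyEqual_iff hR h1 h2)]
    exact hL.encard_neighbours hR h1 h2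
  · obtain ⟨x, y, -, hv⟩ := hL.exists_quad v
    exact ⟨x, y, hv⟩
  · have hR := hL.rel_of_eq hv
    refine ⟨hL.eq_of_isConsecutive hR hc, ?_⟩
    rintro rfl
    change R x (s (s x)) at hR
    change v.1 = cell dev (quad s x (s (s x))) at hv
    change neighbourCells U v = {cell dev (quad s (s⁻¹ x) (s (s x))), cell dev (quad s (s⁻¹ x) (s x)),
      cell dev (quad s x (s (s (s x)))), cell dev (quad s (s x) (s (s (s x))))}
    rw [neighbourCells_eq hdev hY hYne hp hpt hX hL h5 hR hv,
      setOf_eq_of_iff (hL.nearlyEqual_iff_of_consecutive hR)]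
    simp only [image_insert_eq, image_singleton]
  · have hR := hL.rel_of_eq hv
    obtain ⟨h1, h2⟩ := hcons x y hc
    rw [neighbourCells_eq hdev hY hYne hp hpt hX hL h5 hR hv, setOf_eq_of_iff (hL.nearlyEqual_iff hR h1 h2)]
    simp only [image_insert_eq, image_singleton]

end IsLinkRelation

end TranslationConics
end

noncomputable section
namespace TranslationConics

open UniformSpace

section Span

variable (F : Frame)

theorem Frame.map_sub_map (A B A' B' : ℝ) :
    F.map A B - F.map A' B' = (A - A') • F.a + (B - B') • F.b := by
  simp only [Frame.map]; module

theorem Frame.finrank_vectorSpan_le {S : Set Plane} {b : ℝ} (h : ∀ v ∈ S, F.snd v = b) :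
    Module.finrank ℝ (vectorSpan ℝ S) ≤ 1 := by
  have h1 : vectorSpan ℝ S ≤ Submodule.span ℝ {F.a} := by
    rw [vectorSpan_def, Submodule.span_le]
    rintro _ ⟨v, hv, w, hw, rfl⟩
    change v - w ∈ _
    rw [← F.map_coords v, ← F.map_coords w, h v hv, h w hw, F.map_sub_map, sub_self, zero_smul,
      add_zero]
    exact Submodule.smul_mem _ _ (Submodule.mem_span_singleton_self _)
  exact (Submodule.finrank_mono h1).trans (by
    simpa using finrank_span_le_card (R := ℝ) ({F.a} : Set Plane))

theorem Frame.finrank_vectorSpan_eq {S : Set Plane} {A A' C : ℝ} (hA : A ≠ A')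
    (h1 : F.map A 1 ∈ S) (h2 : F.map A' 1 ∈ S) (h3 : F.map C (-1) ∈ S) :
    Module.finrank ℝ (vectorSpan ℝ S) = 2 := by
  have ha : F.a ∈ vectorSpan ℝ S := by
    have := vsub_mem_vectorSpan ℝ h1 h2
    rw [vsub_eq_sub, F.map_sub_map, sub_self, zero_smul, add_zero] at this
    have h4 := Submodule.smul_mem _ (A - A')⁻¹ this
    rwa [smul_smul, inv_mul_cancel₀ (sub_ne_zero.2 hA), one_smul] at h4
  have hb : F.b ∈ vectorSpan ℝ S := by
    have := vsub_mem_vectorSpan ℝ h1 h3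
    rw [vsub_eq_sub, F.map_sub_map] at this
    have h4 := Submodule.sub_mem _ this (Submodule.smul_mem _ (A - C) ha)
    rw [add_sub_cancel_left] at h4
    have h5 := Submodule.smul_mem _ (1 - -1 : ℝ)⁻¹ h4
    rwa [smul_smul, inv_mul_cancel₀ (by norm_num), one_smul] at h5
  have htop : vectorSpan ℝ S = ⊤ := by
    rw [eq_top_iff]
    intro w _
    obtain ⟨A, B, h⟩ := F.exists_map (F.o + w)
    have : w = A • F.a + B • F.b := by
      rw [Frame.map, add_assoc] at h
      exact (add_left_cancel h).symm
    rw [this]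
    exact Submodule.add_mem _ (Submodule.smul_mem _ _ ha) (Submodule.smul_mem _ _ hb)
  rw [htop, finrank_top]
  simp

end Span

section Strips

variable {Y X : Type*} [MetricSpace Y] [ChartedSpace Plane Y] [TranslationSurface Y]
  [MetricSpace X] [ChartedSpace Plane X] [TranslationSurface X] {dev : X → Plane}
  (hdev : IsDevelopingMap dev)
include hdev

theorem Subconic.encard_marks {U : Subconic dev} {x : X} (hx : x ∈ U.1) :
    U.marks.encard = U.conePoints.encard := by
  rw [marks, InjOn.encard_image]
  intro ξ hξ ζ hζ h
  rw [← U.limitPoint_devExt hdev hx hξ.1, h, U.limitPoint_devExt hdev hx hζ.1]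

theorem Subconic.snd_of_mem_marks {U : Subconic dev} {c : Fin 6 → ℝ} {F : Frame}
    (h : U.IsBandIn c F) {x : X} (hx : x ∈ U.1) {v : Plane} (hv : v ∈ U.marks) :
    F.snd v = 1 ∨ F.snd v = -1 := by
  have h1 := ((U.mem_marks hdev hx).1 hv).1
  rwa [h.frontier_eq] at h1

theorem Subconic.IsBandIn.isTight_of_isRigid {U : Subconic dev} {c : Fin 6 → ℝ} {F : Frame}
    (h : U.IsBandIn c F) (hr : U.IsRigid) {x : X} (hx : x ∈ U.1) : U.IsTight F := by
  obtain ⟨h5, hs⟩ := hr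
  have h5 : 5 ≤ U.conePoints.encard := h5
  change HasMaximalSpan U.marks at hs
  have key : ∀ b, ¬ ∀ v ∈ U.marks, F.snd v = b := by
    intro b hb
    have h1 := F.finrank_vectorSpan_le hb
    rcases hs with h2 | h2
    · omega
    · rw [U.encard_marks hdev hx] at h2
      have h3 := h5.trans h2
      have h4 : (5 : ℕ) ≤ Module.finrank ℝ (vectorSpan ℝ U.marks) + 1 := by exact_mod_cast h3
      omega
  refine U.isTight_of_marks hdev ?_ ?_
  · by_contra hcon
    refine key (-1) fun v hv => (U.snd_of_mem_marks hdev h hx hv).resolve_left fun h1 => hcon ?_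
    exact ⟨F.fst v, by rwa [← h1, F.map_coords]⟩
  · by_contra hcon
    refine key 1 fun v hv => (U.snd_of_mem_marks hdev h hx hv).resolve_right fun h1 => hcon ?_
    exact ⟨F.fst v, by rwa [← h1, F.map_coords]⟩

theorem Subconic.IsBandIn.isRigid (hY : TotallyBounded (Set.univ : Set Y)) {p : X → Y}
    (hp : IsCoveringMap p) (hpt : IsTranslationMap p) {U : Subconic dev} {c : Fin 6 → ℝ} {F : Frame}
    (h : U.IsBandIn c F) (ht : U.IsTight F) {x : X} (hx : x ∈ U.1) : U.IsRigid := by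
  have hinf1 := h.infinite_marks hdev hY hp hpt ht true
  have hinf2 := h.infinite_marks hdev hY hp hpt ht false
  simp only [lineSign, if_true, Bool.false_eq_true, if_false, neg_neg] at hinf1 hinf2
  constructor
  · have h1 : U.marks.Infinite := by
      refine (hinf1.image (f := fun t => F.map t 1) ?_).mono ?_
      · intro s _ t _ hst
        exact (F.map_inj.1 hst).1
      · rintro _ ⟨t, ht, rfl⟩; exact ht
    rw [← U.encard_marks hdev hx, h1.encard_eq]
    exact le_top
  · left
    obtain ⟨A, hA, A', hA', hne⟩ := hinf1.nontrivial
    obtain ⟨C, hC⟩ := hinf2.nonempty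
    exact (F.finrank_vectorSpan_eq hne hA hA' hC).ge

/-- The link relation of a rigid subconic. -/
theorem Subconic.IsRigid.exists_isLinkRelation (hY : TotallyBounded (Set.univ : Set Y))
    (hYne : (metricFrontier Y).Nonempty) {p : X → Y} (hp : IsCoveringMap p)
    (hpt : IsTranslationMap p) (hX : DiscreteTopology (metricFrontier X)) {U : Subconic dev}
    (hU : U.IsRigid) :
    ∃ s : Equiv.Perm U.conePoints, U.IsSuccessorFunction s ∧ ∃ R, IsLinkRelation U s R := by
  have h5 : 5 ≤ U.conePoints.encard := hU.1
  have hne : U.conePoints.Nonempty := by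
    rw [← encard_pos]; exact lt_of_lt_of_le (by norm_num) h5
  obtain ⟨ξ, hξ⟩ := hne
  have hUne := Subconic.nonempty_of_mem_boundary hξ.1
  obtain ⟨c, F, h | h⟩ := U.exists_frame hdev hY hYne hp hpt hUne
  · obtain ⟨x, hx⟩ := hUne
    obtain ⟨s, hs, ⟨C⟩⟩ := exists_circularMarks hdev hX h hx (le_trans (by norm_num) h5)
    exact ⟨s, hs, _, C.isLinkRelation hdev hY hYne hp hpt hX h hx h5⟩
  · obtain ⟨x, hx⟩ := hUne
    obtain ⟨s, hs, ⟨C⟩⟩ := exists_linearMarks hdev hY hp hpt hX h (h.isTight_of_isRigid hdev hU hx) hx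
    exact ⟨s, hs, _, C.isLinkRelation hdev hY hYne hp hpt hX h hx⟩

namespace LinearMarks

variable {U : Subconic dev} {F : Frame} {s : Equiv.Perm U.conePoints} (C : LinearMarks U F s)
include C

theorem not_sameCycle_of_component_ne {c : Fin 6 → ℝ} (h : U.IsBandIn c F) {x : X} (hx : x ∈ U.1)
    {ξ ζ : U.conePoints} (hne : connectedComponentIn U.boundary (ξ : Completion X) ≠
      connectedComponentIn U.boundary (ζ : Completion X)) : ¬ s.SameCycle ξ ζ := by
  intro hS
  obtain ⟨i, k, rfl⟩ := C.exists_z ξ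
  obtain ⟨j, l, rfl⟩ := C.exists_z ζ
  obtain rfl := (C.sameCycle_iff _ _ _ _).1 hS
  apply hne
  set L := h.param.E i '' univ with hL
  have hLf : L ⊆ frontier (dev '' U.1) := by
    rintro _ ⟨t, -, rfl⟩; exact h.param.E_mem i t
  have hpre : IsPreconnected (limitPoint dev x '' L) :=
    (isPreconnected_univ.image _ (h.param.continuous i).continuousOn).image _
      ((U.continuousOn_limitPoint hdev hx).mono (hLf.trans frontier_subset_closure))
  have hsub : limitPoint dev x '' L ⊆ U.boundary := by
    rw [U.boundary_eq hdev hx]; exact image_mono hLf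
  have hz : ∀ k, (C.z i k : Completion X) ∈ limitPoint dev x '' L := by
    intro k
    refine ⟨_, ⟨C.θ i k, mem_univ _, rfl⟩, ?_⟩
    rw [show h.param.E i (C.θ i k) = devExt dev (C.z i k) from (C.devExt_z i k).symm]
    exact U.limitPoint_devExt hdev hx (C.z i k).2.1
  exact connectedComponentIn_eq (hpre.subset_connectedComponentIn (hz k) hsub (hz l))

omit [ChartedSpace Plane X] [TranslationSurface X] hdev in
theorem z_mem_quad {i j : Bool} (hij : i ≠ j) {k l m : ℤ} :
    (C.z i m : Completion X) ∈ quad s (C.z i k) (C.z j l) ↔ m = k ∨ m = k + 1 := by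
  rw [mem_quad, C.succ_z, C.succ_z]
  constructor
  · rintro (h | h | h | h)
    · exact Or.inl (C.inj _ _ _ _ h).2
    · exact Or.inr (C.inj _ _ _ _ h).2
    · exact absurd (C.inj _ _ _ _ h).1 hij
    · exact absurd (C.inj _ _ _ _ h).1 hij
  · rintro (rfl | rfl) <;> simp

omit [ChartedSpace Plane X] [TranslationSurface X] hdev in
theorem eq_of_quad_eq {i j : Bool} (hij : i ≠ j) {k l k' l' : ℤ}
    (h : quad s (C.z i k) (C.z j l) = quad s (C.z i k') (C.z j l')) : k = k' ∧ l = l' := by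
  have key : ∀ {i j : Bool}, i ≠ j → ∀ {k l k' l' : ℤ},
      quad s (C.z i k) (C.z j l) = quad s (C.z i k') (C.z j l') → k = k' := by
    intro i j hij k l k' l' h
    have h1 := (C.z_mem_quad hij).1 (h ▸ (C.z_mem_quad hij).2 (Or.inl rfl))
    have h2 := (C.z_mem_quad hij).1 (h ▸ (C.z_mem_quad hij).2 (Or.inr rfl))
    omega
  refine ⟨key hij h, key hij.symm (l := k) (l' := k') ?_⟩
  rw [quad_comm, h, quad_comm]

theorem exists_gridIso (hY : TotallyBounded (Set.univ : Set Y)) (hYne : (metricFrontier Y).Nonempty)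
    {p : X → Y} (hp : IsCoveringMap p) (hpt : IsTranslationMap p)
    (hX : DiscreteTopology (metricFrontier X))
    (hL : IsLinkRelation U s fun ξ ζ => ¬ s.SameCycle ξ ζ)
    (h5 : 5 ≤ U.conePoints.encard) {ξ ζ : U.conePoints} (hξζ : ¬ s.SameCycle ξ ζ) :
    ∃ f : grid 2 ≃g link U, ∀ m n : ℤ,
      (f ![m, n]).1 = cell dev (quad s ((s ^ m) ξ) ((s ^ n) ζ)) := by
  obtain ⟨i, k, rfl⟩ := C.exists_z ξ
  obtain ⟨j, l, rfl⟩ := C.exists_z ζ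
  have hij : i ≠ j := fun h => hξζ ((C.sameCycle_iff _ _ _ _).2 h)
  have hR : ∀ m n, ¬ s.SameCycle (C.z i m) (C.z j n) := fun m n =>
    fun h => hij ((C.sameCycle_iff _ _ _ _).1 h)
  let f : (Fin 2 → ℤ) → LinkVertex U := fun a => hL.toVertex (hR (k + a 0) (l + a 1))
  have hf : ∀ a, (f a).1 = cell dev (quad s (C.z i (k + a 0)) (C.z j (l + a 1))) := fun a => rfl
  have hinj : Function.Injective f := by
    intro a b hab
    have h1 := eq_of_cell_eq (hL.cell_nonempty (hR _ _)) (congrArg Subtype.val hab)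
    obtain ⟨h2, h3⟩ := C.eq_of_quad_eq hij h1
    funext t
    fin_cases t
    · exact add_left_cancel h2
    · exact add_left_cancel h3
  have hsurj : Function.Surjective f := by
    have key : ∀ m n, ∀ v : LinkVertex U, v.1 = cell dev (quad s (C.z i m) (C.z j n)) →
        ∃ a, f a = v := by
      intro m n v hv
      refine ⟨![m - k, n - l], Subtype.ext ?_⟩
      rw [hv, hf]
      simp
    intro v
    obtain ⟨ξ, ζ, hR', hv⟩ := hL.exists_quad v
    obtain ⟨i', m, rfl⟩ := C.exists_z ξ
    obtain ⟨j', n, rfl⟩ := C.exists_z ζ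
    have hij' : i' ≠ j' := fun h => hR' ((C.sameCycle_iff _ _ _ _).2 h)
    have h2 : (i' = i ∧ j' = j) ∨ (i' = j ∧ j' = i) := by
      revert hij hij'; cases i <;> cases j <;> cases i' <;> cases j' <;> simp
    rcases h2 with ⟨rfl, rfl⟩ | ⟨rfl, rfl⟩
    · exact key m n v hv
    · exact key n m v (by rw [hv, quad_comm])
  have hadj : ∀ a b, (link U).Adj (f a) (f b) ↔ (grid 2).Adj a b := by
    intro a b
    rw [IsLinkRelation.adj_iff hdev hY hYne hp hpt hX hL h5 (hR _ _) (hR _ _) (hf a) (hf b)]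
    have hne : ∀ (i j : Bool) (m n : ℤ), i ≠ j → C.z i m ≠ s (s (C.z j n)) := by
      intro i j m n hij h
      rw [C.succ_z, C.succ_z] at h
      exact hij (C.inj _ _ _ _ h).1
    have hinv : ∀ (i : Bool) (m : ℤ), s⁻¹ (C.z i m) = C.z i (m - 1) := by
      intro i m
      have := C.zpow_z i m (-1)
      rwa [zpow_neg_one, ← sub_eq_add_neg] at this
    have h1 := hL.nearlyEqual_iff (hR (k + a 0) (l + a 1)) (hne j i _ _ hij.symm) (hne i j _ _ hij)
      (quad s (C.z i (k + b 0)) (C.z j (l + b 1)))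
    have h2 : NearlyEqual (quad s (C.z i (k + a 0)) (C.z j (l + a 1)))
        (quad s (C.z i (k + b 0)) (C.z j (l + b 1))) ↔
        ∃ c d, ¬ s.SameCycle c d ∧ quad s (C.z i (k + b 0)) (C.z j (l + b 1)) = quad s c d ∧
          NearlyEqual (quad s (C.z i (k + a 0)) (C.z j (l + a 1))) (quad s c d) := by
      constructor
      · intro h; exact ⟨_, _, hR _ _, rfl, h⟩
      · rintro ⟨c, d, -, he, h⟩; rwa [he]
    have h3 : ∀ m n m' n' : ℤ, quad s (C.z i m) (C.z j n) = quad s (C.z i m') (C.z j n') ↔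
        m = m' ∧ n = n' :=
      fun m n m' n' => ⟨C.eq_of_quad_eq hij, by rintro ⟨rfl, rfl⟩; rfl⟩
    rw [h2, h1]
    simp only [hinv, C.succ_z, mem_insert_iff, mem_singleton_iff, h3, grid, Fin.exists_fin_two,
      Fin.forall_fin_two]
    simp only [ne_eq, not_true_eq_false, false_implies, true_and, and_true, zero_ne_one,
      one_ne_zero, not_false_eq_true, forall_const]
    rw [abs_eq (by norm_num), abs_eq (by norm_num)]
    omega
  refine ⟨⟨Equiv.ofBijective f ⟨hinj, hsurj⟩, fun {a b} => hadj a b⟩, fun m n => ?_⟩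
  change (f ![m, n]).1 = _
  rw [hf, C.zpow_z, C.zpow_z]
  rfl

end LinearMarks

end Strips

end TranslationConics
end


theorem mainTheorem10
    {Y X : Type*}
    [MetricSpace Y] [ChartedSpace Plane Y] [TranslationSurface Y] [ConnectedSpace Y]
    [MetricSpace X] [ChartedSpace Plane X] [TranslationSurface X] [SimplyConnectedSpace X]
    (hY : TotallyBounded (Set.univ : Set Y))
    (hYfin : (metricFrontier Y).Finite) (hYne : (metricFrontier Y).Nonempty)
    (p : X → Y) (hp : IsCoveringMap p) (hpt : IsTranslationMap p)
    (hX : DiscreteTopology (metricFrontier X))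
    (dev : X → Plane) (hdev : IsDevelopingMap dev) :
    (∀ U : Subconic dev, U.IsRigid →
      ∃ s : Equiv.Perm U.conePoints, U.IsSuccessorFunction s ∧
        (∀ v : LinkVertex U, ((link U).neighborSet v).encard = 4) ∧
        (∀ v : LinkVertex U, ∃ x y, v.1 = cell dev (quad s x y)) ∧
        (∀ (v : LinkVertex U) (x y : U.conePoints), v.1 = cell dev (quad s x y) →
          IsConsecutive s (quad s x y) →
            (y = (s ^ 2) x ∨ x = (s ^ 2) y) ∧
            (y = (s ^ 2) x →
              neighbourCells U v =
                {cell dev (quad s (s⁻¹ x) ((s ^ 2) x)), cell dev (quad s (s⁻¹ x) (s x)),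
                  cell dev (quad s x ((s ^ 3) x)), cell dev (quad s (s x) ((s ^ 3) x))})) ∧
        (∀ (v : LinkVertex U) (x y : U.conePoints), v.1 = cell dev (quad s x y) →
          ¬ IsConsecutive s (quad s x y) →
            neighbourCells U v =
              {cell dev (quad s x (s⁻¹ y)), cell dev (quad s x (s y)),
                cell dev (quad s (s x) y), cell dev (quad s (s⁻¹ x) y)})) ∧
    (∀ U : Subconic dev, U.IsMaximalStrip →
      U.IsRigid ∧ Nonempty (grid 2 ≃g link U) ∧
      ∃ s : Equiv.Perm U.conePoints, U.IsSuccessorFunction s ∧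
        ∀ x y : U.conePoints,
          connectedComponentIn U.boundary (x : UniformSpace.Completion X) ≠
            connectedComponentIn U.boundary (y : UniformSpace.Completion X) →
          ∃ f : grid 2 ≃g link U, ∀ m n : ℤ,
            (f ![m, n]).1 = cell dev (quad s ((s ^ m) x) ((s ^ n) y))) := by
  refine ⟨fun U hU => ?_, fun U hU => ?_⟩
  · obtain ⟨s, hs, R, hL⟩ := hU.exists_isLinkRelation hdev hY hYne hp hpt hX
    exact ⟨s, hs, hL.link_description hdev hY hYne hp hpt hX hU.1⟩
  · obtain ⟨c, F, h⟩ := hU.1.exists_band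
    have ht := Subconic.isTight_of_isMaximalStrip hdev h hU
    obtain ⟨x, hx, -⟩ : F.map 0 0 ∈ dev '' U.1 := by
      rw [h.1, Set.mem_ofPred_eq, h.2]; norm_num
    have hr := h.isRigid hdev hY hp hpt ht hx
    obtain ⟨s, hs, ⟨C⟩⟩ := exists_linearMarks hdev hY hp hpt hX h ht hx
    have hL := C.isLinkRelation hdev hY hYne hp hpt hX h hx
    have key := fun ξ ζ hξζ => C.exists_gridIso hdev hY hYne hp hpt hX hL hr.1 (ξ := ξ) (ζ := ζ) hξζ
    refine ⟨hr, ?_, s, hs, fun ξ ζ hne => key ξ ζ ?_⟩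
    · obtain ⟨f, -⟩ := key (C.z false 0) (C.z true 0) (by rw [C.sameCycle_iff]; exact Bool.false_ne_true)
      exact ⟨f⟩
    · exact C.not_sameCycle_of_component_ne hdev h hx hne
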